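/- **Setting.** An oracle is a function $O:\{0,1\}^*\to\{0,1\}$; a *random oracle* has independent uniformly random values. "Relative to $O$" means that machines may query $O$ and that Boolean circuits may contain $O$-gates. A *total search problem* relative to $O$ ($R\in\mathsf{TFNP}^O$) is a relation $R\subseteq\{0,1\}^*\times\{0,1\}^*$ that is decidable in polynomial time relative to $O$, whose solutions have polynomially bounded length, and in which every instance $x$ has a solution $y$, $(x,y)\in R$. * $A\le B$ (*many-one*): there are functions $f,g$, polynomial-time computable relative to $O$, with $(f(x),y)\in B\Rightarrow(x,g(x,y))\in A$ for all $x,y$. * $A\le_T B$ (*adaptive Turing*): a polynomial-time machine with access to $O$ and to a solver of $B$, which it may query adaptively, solves $A$, whatever solver of $B$ it is given. * *Non-adaptive Turing*: the whole list of queries to $B$ is computed from the instance in polynomial time relative to $O$, and then a solution is computed from the instance and all the answers in polynomial time relative to $O$; this has to succeed for every solver of $B$. $\mathrm{Collision}^O$: given a circuit $C:\{0,1\}^n\to\{0,1\}^{n-1}$, $n\ge1$, with $O$-gates, find $x_1\ne x_2$ in $\{0,1\}^n$ with $C^O(x_1)=C^O(x_2)$. $\mathsf{PWPP}^O$ is the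 class of all $R\in\mathsf{TFNP}^O$ with $R\le\mathrm{Collision}^O$. $\mathrm{NestedCollision}^O$: given circuits $f:\{0,1\}^n\to\{0,1\}^{n-1}$ and $g:\{0,1\}^{2n}\times\{0,1\}^n\to\{0,1\}^{n-1}$, $n\ge1$, with $O$-gates, find $(x,y,u,v)\in\{0,1\}^{4n}$ such that $x\ne y$, $f^O(x)=f^O(y)$, $u\ne v$ and $g^O(x,y,u)=g^O(x,y,v)$. (Strings that are not descriptions of instances have the empty string as their only solution.) **Statement.** Relative to a random oracle, black-box $\mathsf{PWPP}$ is not closed under adaptive Turing reductions. In detail: 1. For every oracle $O$, $\mathrm{NestedCollision}^O\in\mathsf{TFNP}^O$ and $\mathrm{NestedCollision}^O\le_T\mathrm{Collision}^O$ by a polynomial-time reduction that makes at most two (adaptive) queries to the solver of $\mathrm{Collision}^O$. 2. With probability $1$ over a random oracle $O$: $\mathrm{NestedCollision}^O$ is not reducible to $\mathrm{Collision}^O$ by a non-adaptive Turing reduction, $\mathrm{NestedCollision}^O\notin\mathsf{PWPP}^O$, and hence $\mathsf{PWPP}^O$ is not closed under adaptive Turing reductions (i.e. it is false that $A\in\mathsf{PWPP}^O$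 whenever $A\in\mathsf{TFNP}^O$, $B\in\mathsf{PWPP}^O$ and $A\le_T B$). 3. For every $n$ let $(f_n,g_n)$ be the instance of $\mathrm{NestedCollision}^O$ with $f_n(x)=(O(0\,x\,1^i))_{i<n-1}$ and $g_n(z,u)=(O(1\,z\,u\,1^i))_{i<n-1}$; for a random oracle $O$ these are independent uniformly random functions. For every polynomial $q$ and every (non-uniform, computationally unbounded) sequence of black-box non-adaptive reductions, the $n$-th of which makes at most $q(n)$ queries to $O$ in preprocessing, then submits a list of $\mathrm{Collision}^O$ instances of total size at most $q(n)$, and then, given the answers, makes at most $q(n)$ queries to $O$ in postprocessing, the probability over $O$ that the $n$-th reduction outputs a solution of $(f_n,g_n)$ for every solver of $\mathrm{Collision}^O$ is negligible in $n$. -/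

import Mathlib

open MeasureTheory Filter Topology
open scoped ENNReal

namespace PWPPTuring

/-! ### Encodings of finite objects as bit strings (all of them are prefix-free) -/

/-- Unary encoding of a natural number: `1ᵏ0`. -/
def encNat (k : ℕ) : List Bool := List.replicate k true ++ [false]

/-- Encoding of a list: a `1` before every encoded entry, a `0` at the end. -/
def encList {α : Type} (enc : α → List Bool) (l : List α) : List Bool :=
  l.flatMap (fun a => true :: enc a) ++ [false]

/-- Self-delimiting encoding of a list of bit strings. -/
def encStrings (l : List (List Bool)) : List Bool :=
  encList (encList fun b => [b]) l

/-! ### Boolean circuits with oracle gates -/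

/-- An oracle `O : {0,1}* → {0,1}`. -/
abbrev Oracle : Type := List Bool → Bool

/-- Gates of an oracle-aided Boolean circuit, over the complete basis of `NAND` and constants.
The arguments of a gate are wire numbers; an oracle gate has arbitrary fan-in. -/
inductive Gate : Type
  | const (b : Bool)
  | nand (i j : ℕ)
  | oracle (args : List ℕ)

/-- An oracle-aided Boolean circuit. The wires `0, …, inputs - 1` carry the input bits and the
`k`-th gate writes to the wire `inputs + k`. `outputs` lists the output wires. -/
structure Circuit : Type where
  inputs : ℕ
  gates : List Gate
  outputs : List ℕ

/-- The value on wire `i`, given the values of the wires computed so far.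
Reading a wire that is not (yet) defined yields `0`. -/
def wire (w : List Bool) (i : ℕ) : Bool := w.getD i false

/-- The value computed by a gate from the values of the previous wires. -/
def Gate.eval (O : Oracle) (w : List Bool) : Gate → Bool
  | .const b => b
  | .nand i j => !(wire w i && wire w j)
  | .oracle args => O (args.map (wire w))

/-- The output `C^O(x)` of the circuit on the input `x` (of length `C.inputs`). -/
def Circuit.eval (C : Circuit) (O : Oracle) (x : List Bool) : List Bool :=
  C.outputs.map (wire (C.gates.foldl (fun w g => w ++ [g.eval O w]) x))

/-- Description of a gate as a bit string. -/
def Gate.code : Gate → List Bool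
  | .const b => [false, b]
  | .nand i j => [true, false] ++ encNat i ++ encNat j
  | .oracle args => [true, true] ++ encList encNat args

/-- Description of a circuit as a bit string. -/
def Circuit.code (C : Circuit) : List Bool :=
  encNat C.inputs ++ encList Gate.code C.gates ++ encList encNat C.outputs

/-! ### Polynomial-time oracle computation

The machine model is a multi-stack machine with structured control: finitely many registers hold
bit strings, and every elementary instruction touches one bit at the top of one register. An
oracle instruction replaces the content of a register by the oracle's answer to it; its cost
includes the lengths of query and answer. -/

/-- The contents of the registers. -/
abbrev Store : Type := ℕ → List Bool

/-- Oracle programs; `ι` is the set of names of the available oracles. -/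
inductive Prog (ι : Type) : Type
  | skip
  | push (r : ℕ) (b : Bool)
  | pop (r : ℕ)
  | seq (P Q : Prog ι)
  | branch (r : ℕ) (onNil onFalse onTrue : Prog ι)
  | loop (r : ℕ) (body : Prog ι)
  | query (i : ι) (r : ℕ)

/-- `Runs ora P σ t log σ'`: started on the store `σ` with the oracles `ora`, the program `P` halts
after exactly `t` steps in the store `σ'`, and `log` lists the oracle queries it made.
`branch r` inspects the top of register `r` without removing it,
`loop r` repeats its body while register `r` is non-empty. -/
inductive Runs {ι : Type} (ora : ι → List Bool → List Bool) :
    Prog ι → Store → ℕ → List (ι × List Bool) → Store → Prop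
  | skip (σ : Store) : Runs ora .skip σ 1 [] σ
  | push (σ : Store) (r : ℕ) (b : Bool) :
      Runs ora (.push r b) σ 1 [] (Function.update σ r (b :: σ r))
  | pop (σ : Store) (r : ℕ) :
      Runs ora (.pop r) σ 1 [] (Function.update σ r (σ r).tail)
  | seq {P Q : Prog ι} {σ σ' σ'' : Store} {t t' : ℕ} {l l' : List (ι × List Bool)}
      (hP : Runs ora P σ t l σ') (hQ : Runs ora Q σ' t' l' σ'') :
      Runs ora (.seq P Q) σ (t + t') (l ++ l') σ''
  | branchNil {r : ℕ} {P Q R : Prog ι} {σ σ' : Store} {t : ℕ} {l : List (ι × List Bool)}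
      (h : σ r = []) (hP : Runs ora P σ t l σ') :
      Runs ora (.branch r P Q R) σ (t + 1) l σ'
  | branchFalse {r : ℕ} {P Q R : Prog ι} {σ σ' : Store} {t : ℕ} {l : List (ι × List Bool)}
      (h : (σ r).head? = some false) (hQ : Runs ora Q σ t l σ') :
      Runs ora (.branch r P Q R) σ (t + 1) l σ'
  | branchTrue {r : ℕ} {P Q R : Prog ι} {σ σ' : Store} {t : ℕ} {l : List (ι × List Bool)}
      (h : (σ r).head? = some true) (hR : Runs ora R σ t l σ') :
      Runs ora (.branch r P Q R) σ (t + 1) l σ'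
  | loopNil {r : ℕ} {P : Prog ι} {σ : Store} (h : σ r = []) :
      Runs ora (.loop r P) σ 1 [] σ
  | loopCons {r : ℕ} {P : Prog ι} {σ σ' σ'' : Store} {t t' : ℕ} {l l' : List (ι × List Bool)}
      (h : σ r ≠ []) (hP : Runs ora P σ t l σ') (hL : Runs ora (.loop r P) σ' t' l' σ'') :
      Runs ora (.loop r P) σ (t + t' + 1) (l ++ l') σ''
  | query (σ : Store) (i : ι) (r : ℕ) :
      Runs ora (.query i r) σ (1 + (σ r).length + (ora i (σ r)).length) [(i, σ r)]
        (Function.update σ r (ora i (σ r)))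

/-- The initial store: the arguments in the registers `0, 1, …`, all other registers empty.
The result of a computation is the final content of register `0`. -/
def load (args : List (List Bool)) : Store := fun r => args.getD r []

/-- `f : {0,1}* → {0,1}*` is computable in polynomial time relative to `O`. -/
def PolyTime₁ (O : Oracle) (f : List Bool → List Bool) : Prop :=
  ∃ (P : Prog Unit) (p : Polynomial ℕ), ∀ x, ∃ t log σ,
    Runs (fun _ q => [O q]) P (load [x]) t log σ ∧ σ 0 = f x ∧ t ≤ p.eval x.length

/-- `g : {0,1}* × {0,1}* → {0,1}*` is computable in polynomial time relative to `O`. -/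
def PolyTime₂ (O : Oracle) (g : List Bool → List Bool → List Bool) : Prop :=
  ∃ (P : Prog Unit) (p : Polynomial ℕ), ∀ x y, ∃ t log σ,
    Runs (fun _ q => [O q]) P (load [x, y]) t log σ ∧ σ 0 = g x y ∧
      t ≤ p.eval (x.length + y.length)

/-! ### Total search problems and reductions, relative to an oracle -/

/-- A search problem: `R x y` says that `y` is a solution of the instance `x`. -/
abbrev SearchProblem : Type := List Bool → List Bool → Prop

/-- `R` belongs to `TFNP` relative to `O`: it is polynomial-time decidable, its solutions have
polynomially bounded length, and every instance has a solution. -/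
def TFNP (O : Oracle) (R : SearchProblem) : Prop :=
  (∃ V, PolyTime₂ O V ∧ ∀ x y, R x y ↔ V x y = [true]) ∧
  (∃ p : Polynomial ℕ, ∀ x y, R x y → y.length ≤ p.eval x.length) ∧
  ∀ x, ∃ y, R x y

/-- Many-one reducibility `A ≤ B` relative to `O`. -/
def ManyOneReducible (O : Oracle) (A B : SearchProblem) : Prop :=
  ∃ f g, PolyTime₁ O f ∧ PolyTime₂ O g ∧ ∀ x y, B (f x) y → A x (g x y)

/-- `S` answers every instance of `B` by a (arbitrarily chosen) solution. -/
def Solves (S : List Bool → List Bool) (B : SearchProblem) : Prop := ∀ x, B x (S x)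

/-- Non-adaptive Turing reducibility relative to `O`: all queries to `B` are computed from the
instance before any answer is received, and the reduction has to succeed for every choice of
solutions as answers. -/
def NonAdaptiveReducible (O : Oracle) (A B : SearchProblem) : Prop :=
  ∃ (f : List Bool → List (List Bool)) (g : List Bool → List Bool → List Bool),
    PolyTime₁ O (fun x => encStrings (f x)) ∧ PolyTime₂ O g ∧
    ∀ S, Solves S B → ∀ x, A x (g x (encStrings ((f x).map S)))

/-- The oracles of an adaptive reduction: the name `false` stands for `O`,
the name `true` for the solver `S` of the target problem. -/
def withSolver (O : Oracle) (S : List Bool → List Bool) : Bool → List Bool → List Bool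
  | false => fun q => [O q]
  | true => S

/-- Adaptive Turing reducibility `A ≤_T B` relative to `O`: a polynomial-time program with access
to `O` and to a solver of `B` solves `A`, whatever solver of `B` it is given. -/
def TuringReducible (O : Oracle) (A B : SearchProblem) : Prop :=
  ∃ (P : Prog Bool) (p : Polynomial ℕ), ∀ S, Solves S B → ∀ x, ∃ t log σ,
    Runs (withSolver O S) P (load [x]) t log σ ∧ t ≤ p.eval x.length ∧ A x (σ 0)

/-- Adaptive Turing reducibility in which the solver of `B` is called at most `k` times. -/
def TuringReducibleIn (k : ℕ) (O : Oracle) (A B : SearchProblem) : Prop :=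
  ∃ (P : Prog Bool) (p : Polynomial ℕ), ∀ S, Solves S B → ∀ x, ∃ t log σ,
    Runs (withSolver O S) P (load [x]) t log σ ∧ t ≤ p.eval x.length ∧ A x (σ 0) ∧
      log.countP (fun e => e.1) ≤ k

/-! ### The problems `Collision` and `NestedCollision` and the class `PWPP` -/

/-- `C` maps `{0,1}ⁿ` to `{0,1}ⁿ⁻¹` with `n ≥ 1`. -/
def Circuit.IsCollisionInstance (C : Circuit) : Prop := C.outputs.length + 1 = C.inputs

/-- The pair `(x₁, x₂)` is a non-trivial collision of `C` relative to `O`. -/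
def IsCollision (O : Oracle) (C : Circuit) (x₁ x₂ : List Bool) : Prop :=
  x₁.length = C.inputs ∧ x₂.length = C.inputs ∧ x₁ ≠ x₂ ∧ C.eval O x₁ = C.eval O x₂

/-- The search problem `Collision` relative to `O`. The instances are circuits
`C : {0,1}ⁿ → {0,1}ⁿ⁻¹` with `O`-gates and the solutions are their non-trivial collisions.
A string that describes no such circuit has the empty string as its only solution. -/
def Collision (O : Oracle) : SearchProblem := fun s t =>
  (∃ C : Circuit, s = C.code ∧ C.IsCollisionInstance ∧
    ∃ x₁ x₂, t = x₁ ++ x₂ ∧ IsCollision O C x₁ x₂) ∨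
  ((¬ ∃ C : Circuit, s = C.code ∧ C.IsCollisionInstance) ∧ t = [])

/-- `f : {0,1}ⁿ → {0,1}ⁿ⁻¹` and `g : {0,1}²ⁿ × {0,1}ⁿ → {0,1}ⁿ⁻¹` with `n ≥ 1`. -/
def IsNestedInstance (F G : Circuit) : Prop :=
  F.outputs.length + 1 = F.inputs ∧ G.inputs = 3 * F.inputs ∧
    G.outputs.length = F.outputs.length

/-- `(x, y)` is a non-trivial collision of `f`, and `(u, v)` is one of `g(x, y, ·)`. -/
def IsNestedCollision (O : Oracle) (F G : Circuit) (x y u v : List Bool) : Prop :=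
  (x.length = F.inputs ∧ y.length = F.inputs ∧ u.length = F.inputs ∧ v.length = F.inputs) ∧
  (x ≠ y ∧ F.eval O x = F.eval O y) ∧
  (u ≠ v ∧ G.eval O (x ++ y ++ u) = G.eval O (x ++ y ++ v))

/-- The search problem `NestedCollision` relative to `O`. The instances are pairs of circuits with
`O`-gates. A string that describes no instance has the empty string as its only solution. -/
def NestedCollision (O : Oracle) : SearchProblem := fun s t =>
  (∃ F G : Circuit, s = F.code ++ G.code ∧ IsNestedInstance F G ∧
    ∃ x y u v, t = x ++ y ++ u ++ v ∧ IsNestedCollision O F G x y u v) ∨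
  ((¬ ∃ F G : Circuit, s = F.code ++ G.code ∧ IsNestedInstance F G) ∧ t = [])

/-- The class `PWPP` relative to `O`. -/
def PWPP (O : Oracle) : Set SearchProblem :=
  {R | TFNP O R ∧ ManyOneReducible O R (Collision O)}

/-- Closure of a class of total search problems under adaptive Turing reductions
relative to `O`. -/
def ClosedUnderTuring (O : Oracle) (𝒞 : Set SearchProblem) : Prop :=
  ∀ A B, TFNP O A → B ∈ 𝒞 → TuringReducible O A B → A ∈ 𝒞

/-! ### The random oracle and random instances of `NestedCollision` -/

/-- The distribution of a random oracle: its values on the strings are independent fair coins. -/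
noncomputable def randomOracle : Measure Oracle :=
  Measure.infinitePi fun _ : List Bool => (PMF.uniformOfFintype Bool).toMeasure

/-- The `i`-th output bit of this circuit on `x ∈ {0,1}ⁿ` is `O(0 x 1ⁱ)`, for `i < n - 1`. For a
random oracle, the circuit computes a uniformly random function `{0,1}ⁿ → {0,1}ⁿ⁻¹`. -/
def randomF (n : ℕ) : Circuit where
  inputs := n
  gates := [.const false, .const true] ++ (List.range (n - 1)).map fun i =>
    .oracle (n :: List.range n ++ List.replicate i (n + 1))
  outputs := (List.range (n - 1)).map fun i => n + 2 + i

/-- The `i`-th output bit of this circuit on `z u ∈ {0,1}³ⁿ` is `O(1 z u 1ⁱ)`, for `i < n - 1`. For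
a random oracle, the circuit computes a uniformly random function `{0,1}³ⁿ → {0,1}ⁿ⁻¹`, which is
independent of that of `randomF n`. -/
def randomG (n : ℕ) : Circuit where
  inputs := 3 * n
  gates := [.const false, .const true] ++ (List.range (n - 1)).map fun i =>
    .oracle ((3 * n + 1) :: List.range (3 * n) ++ List.replicate i (3 * n + 1))
  outputs := (List.range (n - 1)).map fun i => 3 * n + 2 + i

/-- The random instance `(f, g)` of `NestedCollision` of parameter `n`. -/
def randomInstance (n : ℕ) : List Bool := (randomF n).code ++ (randomG n).code

/-! ### Black-box non-adaptive reductions, measured by their oracle queries -/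

/-- A computation that is unbounded apart from its adaptive queries to the oracle `O`. -/
inductive QueryTree (α : Type) : Type
  | done (a : α)
  | ask (q : List Bool) (next : Bool → QueryTree α)

/-- The result of the computation for the oracle `O`. -/
def QueryTree.eval {α : Type} (O : Oracle) : QueryTree α → α
  | .done a => a
  | .ask q next => (next (O q)).eval O

/-- The number of oracle queries in the worst case. -/
def QueryTree.depth {α : Type} : QueryTree α → ℕ
  | .done _ => 0
  | .ask _ next => max (next false).depth (next true).depth + 1

/-- A black-box non-adaptive reduction at one instance size. The preprocessing queries the oracle,
and yields the list of search queries and the postprocessing, which receives the list of answers,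
queries the oracle again and yields the output. -/
abbrev BlackBoxReduction : Type :=
  QueryTree (List (List Bool) × (List (List Bool) → QueryTree (List Bool)))

/-- Preprocessing and postprocessing make at most `q` queries each, and the search queries have
total (encoded) size at most `q`. -/
def BlackBoxReduction.Bounded (T : BlackBoxReduction) (q : ℕ) : Prop :=
  T.depth ≤ q ∧ ∀ O, (encStrings (QueryTree.eval O T).1).length ≤ q ∧
    ∀ answers, ((QueryTree.eval O T).2 answers).depth ≤ q

/-- The output of the reduction for the oracle `O` and the solver `S` of the search queries. -/
def BlackBoxReduction.output (T : BlackBoxReduction) (O : Oracle) (S : List Bool → List Bool) :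
    List Bool :=
  ((QueryTree.eval O T).2 ((QueryTree.eval O T).1.map S)).eval O

/-- The event that the reduction solves the random instance of parameter `n`, whichever collisions
it is given. -/
def BlackBoxReduction.Success (T : BlackBoxReduction) (n : ℕ) : Set Oracle :=
  {O | ∀ S, Solves S (Collision O) → NestedCollision O (randomInstance n) (T.output O S)}

/-- `ε : ℕ → [0, ∞]` tends to zero faster than every inverse polynomial. -/
def Negligible (ε : ℕ → ℝ≥0∞) : Prop :=
  ∀ c : ℕ, Tendsto (fun n : ℕ => (n : ℝ≥0∞) ^ c * ε n) atTop (𝓝 0)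

end PWPPTuring

/-! Upper bound. A collision `(x, y)` of `f` is one call to the solver, and a collision of `g(x, y,
·)` is a second call whose circuit contains the first answer as constants.

Lower bound. Call a string `1 x y r` nested if `(x, y)` is a non-trivial collision of the random
function `f` (`nestedQueries`). A computation with `D` oracle queries finds a collision of a random
function with `k` output bits with probability at most `(D + 2)² / 2ᵏ` (`pr_find_collision_le`), so
it rarely makes a nested query (`pr_not_avoids_le`). This applies to the preprocessing and also to
the preprocessing followed by the evaluation of a submitted circuit on a fixed input. By Markov's
inequality, with high probability every submitted circuit makes nested queries on fewer than half of
its inputs. The remaining inputs outnumber the possible outputs, so two of them collide, and the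
solver can answer with such a good collision (`MostlyAvoids.goodSolver_eq`).

Now resample the oracle on the set of nested strings. That set is unchanged, because it depends only
on strings starting with `0`. The preprocessing, the submitted circuits and the canonical good
answers are unchanged too. Hence the answers carry no information about the functions `g(x, y, ·)`
at collisions `(x, y)` of `f`, and the postprocessing has to find a collision of fresh random
functions with its own few queries (`BlackBoxReduction.pr_goodSuccess_le`). Together the success
probability is at most `18 (q + 2)⁵ / 2ⁿ⁻¹`. All events involved depend on finitely many oracle
bits, so the probabilities are quotients of finite cardinalities. Resampling is a measure-preserving
swap of two independent finite oracles (`pr_le_of_resample`).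

Almost sure statement. A pair of programs with polynomial time bounds yields one black-box reduction
for each `n`. It succeeds for all `n` with probability at most the infimum of a sequence tending to
zero. There are only countably many programs and bounds.

Polynomial time. The explicit machine model requires actual programs. They are built around one
finite-state scanner, which parses the description of a circuit bit by bit and at the same time
evaluates it and copies it with shifted wire numbers. Verifying solutions takes two or four runs of
the scanner. The adaptive reduction uses two runs and assembles the second query from the shifted
copy of `g`. -/

namespace PWPPTuring

/-! ### Query trees -/

namespace QueryTree

variable {α β : Type}

/-- Sequential composition of computations. -/
def bind : QueryTree α → (α → QueryTree β) → QueryTree β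
  | .done a, k => k a
  | .ask q next, k => .ask q fun b => (next b).bind k

/-- The list of queries made by the computation. -/
def trace (O : Oracle) : QueryTree α → List (List Bool)
  | .done _ => []
  | .ask q next => q :: (next (O q)).trace O

/-- The computation that stops before the `j`-th query and returns it. -/
def nthQuery : ℕ → QueryTree α → QueryTree (Option (List Bool))
  | _, .done _ => .done none
  | 0, .ask q _ => .done (some q)
  | j + 1, .ask q next => .ask q fun b => (next b).nthQuery j

open Classical in
/-- The computation in which all queries outside of `B` are answered according to `O`. -/
noncomputable def fixOutside (B : Set (List Bool)) (O : Oracle) : QueryTree α → QueryTree α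
  | .done a => .done a
  | .ask q next => if q ∈ B then .ask q fun b => (next b).fixOutside B O
      else (next (O q)).fixOutside B O

theorem eval_bind (O : Oracle) (T : QueryTree α) (k : α → QueryTree β) :
    (T.bind k).eval O = (k (T.eval O)).eval O := by
  induction T with
  | done a => rfl
  | ask q next ih => exact ih (O q)

theorem trace_bind (O : Oracle) (T : QueryTree α) (k : α → QueryTree β) :
    (T.bind k).trace O = T.trace O ++ (k (T.eval O)).trace O := by
  induction T with
  | done a => rfl
  | ask q next ih => simp [bind, trace, eval, ih]

theorem length_trace_le (O : Oracle) (T : QueryTree α) : (T.trace O).length ≤ T.depth := by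
  induction T with
  | done a => simp [trace]
  | ask q next ih =>
    have := ih (O q)
    simp only [trace, List.length_cons, depth]
    cases h : O q <;> rw [h] at this <;> omega

theorem eval_nthQuery (O : Oracle) (T : QueryTree α) (j : ℕ) :
    (T.nthQuery j).eval O = (T.trace O)[j]? := by
  induction T generalizing j with
  | done a => cases j <;> simp [nthQuery, eval, trace]
  | ask q next ih => cases j <;> simp [nthQuery, eval, trace, ih]

theorem length_trace_nthQuery_le (O : Oracle) (T : QueryTree α) (j : ℕ) :
    ((T.nthQuery j).trace O).length ≤ (T.trace O).length := by
  induction T generalizing j with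
  | done a => cases j <;> simp [nthQuery, trace]
  | ask q next ih => cases j <;> simp [nthQuery, trace, ih]

/-- The query of index `j` is determined by the answers to the `j` earlier ones. The gain from `j`
to `j + 1` makes it possible to resample the oracle at the query of index `j` without changing that
query. -/
theorem take_trace_congr {O O' : Oracle} (T : QueryTree α) (j : ℕ)
    (h : ∀ q ∈ (T.trace O).take j, O q = O' q) :
    (T.trace O').take (j + 1) = (T.trace O).take (j + 1) := by
  induction T generalizing j with
  | done a => simp [trace]
  | ask q next ih =>
    cases j with
    | zero => simp [trace]
    | succ j =>
      simp only [trace, List.take_succ_cons, List.mem_cons, forall_eq_or_imp] at h ⊢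
      rw [← h.1, ih _ _ h.2]

theorem trace_eval_congr {O O' : Oracle} (T : QueryTree α)
    (h : ∀ q ∈ T.trace O, O q = O' q) : T.trace O' = T.trace O ∧ T.eval O' = T.eval O := by
  induction T with
  | done a => simp [trace, eval]
  | ask q next ih =>
    simp only [trace, List.mem_cons, forall_eq_or_imp, eval] at h ⊢
    rw [← h.1]
    simp [ih _ h.2]

open Classical in
theorem eval_fixOutside (B : Set (List Bool)) (O O' : Oracle) (T : QueryTree α) :
    (T.fixOutside B O).eval O' = T.eval (B.piecewise O' O) := by
  induction T with
  | done a => simp [fixOutside, eval]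
  | ask q next ih =>
    by_cases hq : q ∈ B <;> simp [fixOutside, eval, hq, ih]

open Classical in
theorem length_trace_fixOutside_le (B : Set (List Bool)) (O O' : Oracle) (T : QueryTree α) :
    ((T.fixOutside B O).trace O').length ≤ (T.trace (B.piecewise O' O)).length := by
  induction T with
  | done a => simp [fixOutside, trace]
  | ask q next ih =>
    by_cases hq : q ∈ B
    · simpa [fixOutside, trace, hq] using ih (O' q)
    · simpa [fixOutside, trace, hq] using (ih (O q)).trans (Nat.le_succ _)

end QueryTree

/-! ### Functions of finitely many oracle bits -/

/-- `F` depends on the oracle through finitely many of its values only. -/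
def FinDep {α : Type*} (F : Oracle → α) : Prop :=
  ∃ W : Finset (List Bool), ∀ O O' : Oracle, (∀ q ∈ W, O q = O' q) → F O = F O'

namespace FinDep

variable {α β γ : Type*}

theorem const (a : α) : FinDep fun _ => a := ⟨∅, fun _ _ _ => rfl⟩

theorem apply (q : List Bool) : FinDep fun O => O q := ⟨{q}, fun _ _ h => h q (by simp)⟩

theorem comp {F : Oracle → α} (hF : FinDep F) (g : α → β) : FinDep fun O => g (F O) := by
  obtain ⟨W, hW⟩ := hF
  exact ⟨W, fun O O' h => by simp only [hW O O' h]⟩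

theorem comp₂ {F : Oracle → α} {G : Oracle → β} (hF : FinDep F) (hG : FinDep G) (g : α → β → γ) :
    FinDep fun O => g (F O) (G O) := by
  classical
  obtain ⟨W, hW⟩ := hF
  obtain ⟨W', hW'⟩ := hG
  refine ⟨W ∪ W', fun O O' h => ?_⟩
  simp only [Finset.mem_union] at h
  simp only [hW O O' fun q hq => h q (.inl hq), hW' O O' fun q hq => h q (.inr hq)]

/-- Only the finitely many restrictions to `W` matter. In `bind` this leaves finitely many
intermediate values, whose supports can be united. -/
theorem finite_range {F : Oracle → α} (hF : FinDep F) : (Set.range F).Finite := by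
  classical
  obtain ⟨W, hW⟩ := hF
  let ex : (W → Bool) → Oracle := fun a s => if h : s ∈ W then a ⟨s, h⟩ else false
  refine (Set.finite_range fun a : W → Bool => F (ex a)).subset ?_
  rintro _ ⟨O, rfl⟩
  exact ⟨fun s => O s, hW _ _ fun q hq => by simp [ex, hq]⟩

theorem finsetBind {ι : Type*} (s : Finset ι) {F : ι → Oracle → α} (hF : ∀ i ∈ s, FinDep (F i)) :
    ∃ W : Finset (List Bool), ∀ i ∈ s, ∀ O O' : Oracle, (∀ q ∈ W, O q = O' q) → F i O = F i O' := by
  classical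
  choose! W hW using hF
  refine ⟨s.biUnion W, fun i hi O O' h => hW i hi O O' fun q hq => h q ?_⟩
  exact Finset.mem_biUnion.2 ⟨i, hi, hq⟩

theorem bind {F : Oracle → α} {G : α → Oracle → β} (hF : FinDep F) (hG : ∀ a, FinDep (G a)) :
    FinDep fun O => G (F O) O := by
  classical
  obtain ⟨W, hW⟩ := finsetBind hF.finite_range.toFinset (F := G) fun a _ => hG a
  obtain ⟨W', hW'⟩ := hF
  refine ⟨W ∪ W', fun O O' h => ?_⟩
  simp only [Finset.mem_union] at h
  simp only [hW' O O' fun q hq => h q (.inr hq)]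
  exact hW _ (by simp) _ _ fun q hq => h q (.inl hq)

open Classical in
theorem filter {ι : Type*} (s : Finset ι) {F : ι → Oracle → Prop}
    (hF : ∀ i ∈ s, FinDep (F i)) : FinDep fun O => s.filter fun i => F i O := by
  obtain ⟨W, hW⟩ := finsetBind s hF
  refine ⟨W, fun O O' h => Finset.filter_congr fun i hi => ?_⟩
  rw [hW i hi _ _ h]

theorem list_map {ι : Type*} (l : List ι) {F : ι → Oracle → α} (hF : ∀ i, FinDep (F i)) :
    FinDep fun O => l.map fun i => F i O := by
  induction l with
  | nil => exact const _
  | cons i l ih => exact (hF i).comp₂ ih (· :: ·)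

theorem trace {α : Type} (T : QueryTree α) : FinDep fun O => T.trace O := by
  induction T with
  | done a => exact const _
  | ask q next ih => 
    exact ((apply q).bind (G := fun b O => (next b).trace O) ih).comp (q :: ·)

theorem eval {α : Type} (T : QueryTree α) : FinDep fun O => T.eval O := by
  induction T with
  | done a => exact const _
  | ask q next ih => exact (apply q).bind (G := fun b O => (next b).eval O) ih

end FinDep

/-! ### Uniformly random oracles with finite support -/

/-- The extension of a finite oracle by `false`. -/
def extendOracle (W : Finset (List Bool)) (a : W → Bool) : Oracle :=
  fun s => if h : s ∈ W then a ⟨s, h⟩ else false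

open Classical in
/-- The probability of an event for an oracle that is uniformly random on `W` and vanishes
elsewhere. -/
noncomputable def pr (W : Finset (List Bool)) (E : Oracle → Prop) : ℝ :=
  (Finset.univ.filter fun a : W → Bool => E (extendOracle W a)).card / 2 ^ W.card

variable {W : Finset (List Bool)}

open Classical in
theorem pr_mono {E F : Oracle → Prop} (h : ∀ O, E O → F O) : pr W E ≤ pr W F := by
  unfold pr
  gcongr
  exact h _

theorem pr_eq_zero {E : Oracle → Prop} (h : ∀ O, ¬ E O) : pr W E = 0 := by
  simp [pr, h]

open Classical in
theorem pr_or_le (E F : Oracle → Prop) : pr W (fun O => E O ∨ F O) ≤ pr W E + pr W F := by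
  unfold pr
  rw [← add_div]
  gcongr
  have := Finset.card_union_le (Finset.univ.filter fun a : W → Bool => E (extendOracle W a))
    (Finset.univ.filter fun a : W → Bool => F (extendOracle W a))
  rw [← Finset.filter_or] at this
  rw [← Nat.cast_add, Nat.cast_le]
  convert this

theorem pr_exists_le {ι : Type*} (s : Finset ι) (E : ι → Oracle → Prop) :
    pr W (fun O => ∃ i ∈ s, E i O) ≤ ∑ i ∈ s, pr W (E i) := by
  classical
  induction s using Finset.induction_on with
  | empty => simp [pr]
  | insert i s hi ih =>
    rw [Finset.sum_insert hi]
    refine le_trans ?_ ((pr_or_le _ _).trans (add_le_add le_rfl ih))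
    exact pr_mono fun O => by simp

theorem pr_exists_le_card_mul {ι : Type*} (s : Finset ι) (E : ι → Oracle → Prop) (ε : ℝ)
    (h : ∀ i ∈ s, pr W (E i) ≤ ε) : pr W (fun O => ∃ i ∈ s, E i O) ≤ s.card * ε :=
  (pr_exists_le s E).trans ((Finset.sum_le_card_nsmul s _ ε h).trans_eq (by simp))

open Classical in
theorem pr_eq_sum (E : Oracle → Prop) :
    pr W E * 2 ^ W.card = ∑ a : W → Bool, if E (extendOracle W a) then (1 : ℝ) else 0 := by
  simp [pr]

open Classical in
theorem extendOracle_piecewise (B : Set (List Bool)) (a b : W → Bool) :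
    B.piecewise (extendOracle W a) (extendOracle W b) =
      extendOracle W (fun s => if s.1 ∈ B then a s else b s) := by
  ext s
  by_cases hs : s ∈ B <;> simp [hs, extendOracle]

open Classical in
/-- Resampling a random oracle on a set that is determined by its values elsewhere. -/
theorem pr_le_of_resample {E : Oracle → Prop} (B : Oracle → Set (List Bool))
    (hB : ∀ O O' : Oracle, (∀ s ∉ B O, O' s = O s) → B O' = B O) (ε : ℝ)
    (h : ∀ O, pr W (fun O' => E ((B O).piecewise O' O)) ≤ ε) : pr W E ≤ ε := by
  let mix : (W → Bool) → (W → Bool) → (W → Bool) → W → Bool := fun c a b s =>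
    if s.1 ∈ B (extendOracle W c) then a s else b s
  have hmix : ∀ a b, B (extendOracle W (mix a b a)) = B (extendOracle W a) := by
    intro a b
    rw [← extendOracle_piecewise]
    exact hB _ _ fun s hs => Set.piecewise_eq_of_notMem _ _ _ hs
  -- `Φ` swaps two independent oracles on the set determined by the first one. By `hmix` the new
  -- first oracle determines the same set, so swapping again undoes this. Thus `Φ` is a bijection,
  -- and the first oracle has the same distribution as its resampled version.
  let Φ : (W → Bool) × (W → Bool) → (W → Bool) × (W → Bool) := fun p =>
    (mix p.1 p.2 p.1, mix p.1 p.1 p.2)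
  have hΦ : Function.Involutive Φ := by
    rintro ⟨a, b⟩
    have hm := hmix a b
    refine Prod.ext ?_ ?_ <;> ext s <;>
    · simp only [Φ]
      change (if s.1 ∈ B (extendOracle W (mix a b a)) then _ else _) = _
      rw [hm]
      by_cases hs : s.1 ∈ B (extendOracle W a) <;> simp [mix, hs]
  have key : ∑ p : (W → Bool) × (W → Bool), (if E (extendOracle W p.1) then (1 : ℝ) else 0) =
      ∑ p : (W → Bool) × (W → Bool), if E ((B (extendOracle W p.1)).piecewise
        (extendOracle W p.2) (extendOracle W p.1)) then (1 : ℝ) else 0 := by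
    rw [← Equiv.sum_comp hΦ.toPerm]
    refine Finset.sum_congr rfl fun p _ => ?_
    rw [extendOracle_piecewise]
    rfl
  have hcard : (Fintype.card (W → Bool) : ℝ) = 2 ^ W.card := by simp
  have h2 : (0 : ℝ) < 2 ^ W.card := by positivity
  have hL : ∑ p : (W → Bool) × (W → Bool), (if E (extendOracle W p.1) then (1 : ℝ) else 0) =
      2 ^ W.card * (pr W E * 2 ^ W.card) := by
    rw [Fintype.sum_prod_type, pr_eq_sum, Finset.mul_sum]
    refine Finset.sum_congr rfl fun a _ => ?_
    refine (Finset.sum_const (if E (extendOracle W a) then (1 : ℝ) else 0)).trans ?_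
    rw [Finset.card_univ, nsmul_eq_mul, hcard]
  rw [hL, Fintype.sum_prod_type] at key
  have h3 : ∑ a : W → Bool, pr W (fun O' => E ((B (extendOracle W a)).piecewise O'
      (extendOracle W a))) * 2 ^ W.card ≤ 2 ^ W.card * (ε * 2 ^ W.card) := by
    refine (Finset.sum_le_card_nsmul _ _ (ε * 2 ^ W.card) fun a _ => ?_).trans_eq ?_
    · gcongr
      exact h _
    · rw [Finset.card_univ, nsmul_eq_mul, hcard]
  simp only [pr_eq_sum] at h3
  rw [← key] at h3
  exact le_of_mul_le_mul_right (le_of_mul_le_mul_left h3 h2) h2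

/-- The probability that a random oracle has prescribed values on a set. -/
theorem pr_prescribed_le (A : Finset (List Bool)) (hA : A ⊆ W) (c : List Bool → Bool) :
    pr W (fun O => ∀ s ∈ A, O s = c s) ≤ 1 / 2 ^ A.card := by
  classical
  unfold pr
  rw [div_le_div_iff₀ (by positivity) (by positivity), one_mul]
  have h1 : (Finset.univ.filter fun a : W → Bool => ∀ s ∈ A, extendOracle W a s = c s) ⊆
      Fintype.piFinset fun s : W => if s.1 ∈ A then {c s} else Finset.univ := by
    intro a ha
    simp only [Finset.mem_filter, Finset.mem_univ, true_and] at ha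
    rw [Fintype.mem_piFinset]
    intro s
    by_cases hs : s.1 ∈ A
    · simpa [hs, extendOracle] using ha s hs
    · simp [hs]
  -- The box has one choice at each point of `A` and two elsewhere.
  have h2 : (Fintype.piFinset fun s : W => if s.1 ∈ A then {c s} else Finset.univ).card *
      2 ^ A.card = 2 ^ W.card := by
    rw [Fintype.card_piFinset]
    have : ∀ s : W, (if s.1 ∈ A then {c s} else (Finset.univ : Finset Bool)).card =
        if s.1 ∈ A then 1 else 2 := fun s => by split_ifs <;> simp
    simp only [this]
    rw [Finset.univ_eq_attach, Finset.prod_attach W fun s => if s ∈ A then 1 else 2,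
      Finset.prod_ite, Finset.prod_const_one, one_mul, Finset.prod_const, ← pow_add]
    congr 1
    rw [← Finset.card_union_of_disjoint]
    · congr 1
      ext s
      simp only [Finset.mem_union, Finset.mem_filter]
      exact ⟨fun h => h.elim (·.1) (hA ·), fun h => by tauto⟩
    · rw [Finset.disjoint_left]
      intro s hs
      simp only [Finset.mem_filter] at hs
      exact hs.2
  calc _ ≤ (((Fintype.piFinset fun s : W => if s.1 ∈ A then {c s} else Finset.univ).card *
      2 ^ A.card : ℕ) : ℝ) := by
        push_cast
        gcongr
    _ = 2 ^ W.card := by rw [h2]; norm_num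

/-! ### Finding collisions of random functions -/

/-- The values of the oracle on `s`, `s1`, `s11`, …, `s1ᵏ⁻¹`. -/
def hash (k : ℕ) (O : Oracle) (s : List Bool) : List Bool :=
  (List.range k).map fun i => O (s ++ List.replicate i true)

theorem hash_congr {k : ℕ} {O O' : Oracle} {s : List Bool}
    (h : ∀ i < k, O (s ++ List.replicate i true) = O' (s ++ List.replicate i true)) :
    hash k O s = hash k O' s :=
  List.map_congr_left fun i hi => h i (List.mem_range.1 hi)

theorem pr_hash_eq_le (k : ℕ) (s v : List Bool)
    (hW : ∀ i < k, s ++ List.replicate i true ∈ W) :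
    pr W (fun O => hash k O s = v) ≤ 1 / 2 ^ k := by
  classical
  have hinj : Function.Injective fun i : ℕ => s ++ List.replicate i true := by
    intro i j h
    simpa using congrArg List.length h
  have h := pr_prescribed_le ((Finset.range k).image fun i => s ++ List.replicate i true)
    (W := W) (by
      intro t ht
      obtain ⟨i, hi, rfl⟩ := Finset.mem_image.1 ht
      -- The string `s 1ⁱ` determines `i` by its length, so this prescribes the bit of index `i` of
      -- `v` there.
      exact hW i (Finset.mem_range.1 hi)) (fun t => v.getD (t.length - s.length) false)
  rw [Finset.card_image_of_injective _ hinj, Finset.card_range] at h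
  refine le_trans (pr_mono ?_) h
  rintro O rfl t ht
  obtain ⟨i, hi, rfl⟩ := Finset.mem_image.1 ht
  have hi := Finset.mem_range.1 hi
  simp [hash, hi]

/-- The strings that have the same prefix of length `m` as the entry of index `j` of `L`; the
empty set if an earlier entry has the same prefix. -/
def freshBlock (m j : ℕ) (L : List (List Bool)) : Set (List Bool) :=
  {s | ∃ q, L[j]? = some q ∧ (∀ q' ∈ L.take j, q'.take m ≠ q.take m) ∧ s.take m = q.take m}

theorem exists_first_index {m : ℕ} {L : List (List Bool)} {κ : List Bool} (h : κ ∈ L)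
    (hκ : κ.length = m) : ∃ j < L.length, ∃ q, L[j]? = some q ∧ q.take m = κ ∧
      ∀ q' ∈ L.take j, q'.take m ≠ κ := by
  induction L with
  | nil => simp at h
  | cons a L ih =>
    by_cases ha : a.take m = κ
    · exact ⟨0, by simp, a, by simp, ha, by simp⟩
    · rcases List.mem_cons.1 h with rfl | h
      · simp [← hκ] at ha
      · obtain ⟨j, hj, q, h1, h2, h3⟩ := ih h
        exact ⟨j + 1, by simpa using hj, q, by simpa using h1, h2, by simpa [ha] using h3⟩

-- Deferred decisions: if no earlier query has the prefix of the query `q'` of index `j`, then the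
-- values on the block of `q'` are still undetermined, while `q'` itself and the hash of the earlier
-- prefix are already fixed. Resampling the block, the new hash hits the fixed value with
-- probability at most `2⁻ᵏ`.
open Classical in
theorem pr_collision_at_le {α : Type} (m k i j : ℕ) (hij : i < j) (T : QueryTree α)
    (hW : ∀ s : List Bool, s.length = m → ∀ i < k, s ++ List.replicate i true ∈ W) :
    pr W (fun O => ∃ q q', (T.trace O)[i]? = some q ∧ (T.trace O)[j]? = some q' ∧
      (∀ p ∈ (T.trace O).take j, p.take m ≠ q'.take m) ∧ (q.take m).length = m ∧
      (q'.take m).length = m ∧ hash k O (q.take m) = hash k O (q'.take m)) ≤ 1 / 2 ^ k := by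
  -- None of the first `j` queries lies in the fresh block, so a change of the oracle there affects
  -- neither them nor the query of index `j`.
  have htake : ∀ O O' : Oracle,
      (∀ s ∉ freshBlock m j ((T.trace O).take (j + 1)), O' s = O s) →
      (T.trace O').take (j + 1) = (T.trace O).take (j + 1) := by
    intro O O' h
    refine QueryTree.take_trace_congr T j fun p hp => (h p ?_).symm
    rintro ⟨q, hq, hfresh, hpq⟩
    rw [List.take_take, min_eq_left (Nat.le_succ j)] at hfresh
    exact hfresh p hp hpq
  refine pr_le_of_resample (fun O => freshBlock m j ((T.trace O).take (j + 1)))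
    (fun O O' h => by simp only [htake O O' h]) _ fun O => ?_
  set B := freshBlock m j ((T.trace O).take (j + 1)) with hB
  have htr : ∀ O', (T.trace (B.piecewise O' O)).take (j + 1) = (T.trace O).take (j + 1) :=
    fun O' => htake O _ fun s hs => Set.piecewise_eq_of_notMem _ _ _ hs
  have hget : ∀ O', ∀ l ≤ j, (T.trace (B.piecewise O' O))[l]? = (T.trace O)[l]? := by
    intro O' l hl
    have := congrArg (·[l]?) (htr O')
    simpa [List.getElem?_take, Nat.lt_succ_of_le hl] using this
  have htk : ∀ O', (T.trace (B.piecewise O' O)).take j = (T.trace O).take j := by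
    intro O'
    have := congrArg (List.take j) (htr O')
    simpa [List.take_take] using this
  simp only [hget _ i hij.le, hget _ j le_rfl, htk]
  by_cases hex : ∃ q q', (T.trace O)[i]? = some q ∧ (T.trace O)[j]? = some q' ∧
      (∀ p ∈ (T.trace O).take j, p.take m ≠ q'.take m) ∧ (q.take m).length = m ∧
      (q'.take m).length = m
  · obtain ⟨q, q', h1, h2, h3, h4, h5⟩ := hex
    refine le_trans (pr_mono ?_) (pr_hash_eq_le k (q'.take m) (hash k O (q.take m)) (hW _ h5))
    rintro O' ⟨p, p', g1, g2, -, -, -, g6⟩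
    obtain rfl : q = p := Option.some.inj (h1.symm.trans g1)
    obtain rfl : q' = p' := Option.some.inj (h2.symm.trans g2)
    have hB' : ∀ s, s ∈ B ↔ s.take m = q'.take m := by
      intro s
      constructor
      · rintro ⟨r, hr, -, hs⟩
        rw [List.getElem?_take_of_lt (Nat.lt_succ_self j), h2] at hr
        rw [hs, Option.some.inj hr]
      · intro hs
        refine ⟨q', by rw [List.getElem?_take_of_lt (Nat.lt_succ_self j), h2], ?_, hs⟩
        simpa [List.take_take] using h3
    have e1 : hash k (B.piecewise O' O) (q'.take m) = hash k O' (q'.take m) :=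
      hash_congr fun l _ => Set.piecewise_eq_of_mem _ _ _ ((hB' _).2 (by
        rw [List.take_append_of_le_length h5.ge, List.take_take, min_self]))
    -- The two prefixes differ because `q` occurs before index `j`, so the hash of the earlier one
    -- is not resampled.
    have e2 : hash k (B.piecewise O' O) (q.take m) = hash k O (q.take m) :=
      hash_congr fun l _ => Set.piecewise_eq_of_notMem _ _ _ fun hmem => by
        rw [hB', List.take_append_of_le_length h4.ge, List.take_take, min_self] at hmem
        refine h3 q ?_ hmem
        rw [List.mem_iff_getElem?]
        exact ⟨i, by rw [List.getElem?_take_of_lt hij, h1]⟩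
    rw [← e1, ← e2, g6]
  · rw [pr_eq_zero]
    · positivity
    · rintro O' ⟨q, q', h1, h2, h3, h4, h5, -⟩
      exact hex ⟨q, q', h1, h2, h3, h4, h5⟩

/-- A computation with few oracle queries is unlikely to find a collision. -/
theorem pr_find_collision_le (m k D : ℕ) (T : QueryTree (List Bool × List Bool))
    (hT : ∀ O, (T.trace O).length ≤ D)
    (hW : ∀ s : List Bool, s.length = m → ∀ i < k, s ++ List.replicate i true ∈ W) :
    pr W (fun O => (T.eval O).1.length = m ∧ (T.eval O).2.length = m ∧
      (T.eval O).1 ≠ (T.eval O).2 ∧ hash k O (T.eval O).1 = hash k O (T.eval O).2) ≤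
      (D + 2) ^ 2 / 2 ^ k := by
  -- The claimed collision is queried at the end, so that both prefixes occur in the trace. This
  -- accounts for `D + 2` instead of `D`.
  let T' : QueryTree Unit := T.bind fun p => .ask p.1 fun _ => .ask p.2 fun _ => .done ()
  have htr : ∀ O, T'.trace O = T.trace O ++ [(T.eval O).1, (T.eval O).2] := fun O => by
    simp [T', QueryTree.trace_bind, QueryTree.trace]
  have hlen : ∀ O, (T'.trace O).length ≤ D + 2 := fun O => by
    rw [htr]
    simpa using hT O
  -- The union bound runs over the positions at which the two prefixes first occur. The later of the
  -- two supplies the fresh block.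
  let E : ℕ × ℕ → Oracle → Prop := fun ij O => ij.1 < ij.2 ∧ ∃ q q',
      (T'.trace O)[ij.1]? = some q ∧ (T'.trace O)[ij.2]? = some q' ∧
      (∀ p ∈ (T'.trace O).take ij.2, p.take m ≠ q'.take m) ∧ (q.take m).length = m ∧
      (q'.take m).length = m ∧ hash k O (q.take m) = hash k O (q'.take m)
  have hE : ∀ ij, pr W (E ij) ≤ 1 / 2 ^ k := by
    intro ij
    by_cases h : ij.1 < ij.2
    · exact (pr_mono fun O h => h.2).trans (pr_collision_at_le m k ij.1 ij.2 h T' hW)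
    · rw [pr_eq_zero]
      · positivity
      · exact fun O hO => h hO.1
  have h1 := pr_exists_le_card_mul (Finset.range (D + 2) ×ˢ Finset.range (D + 2)) E _
    fun ij _ => hE ij
  refine (pr_mono ?_).trans (h1.trans_eq ?_)
  · rintro O ⟨l1, l2, hne, hh⟩
    have m1 : (T.eval O).1 ∈ T'.trace O := by simp [htr]
    have m2 : (T.eval O).2 ∈ T'.trace O := by simp [htr]
    obtain ⟨i, hi, q, a1, a2, a3⟩ := exists_first_index m1 l1
    obtain ⟨j, hj, q', b1, b2, b3⟩ := exists_first_index m2 l2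
    have hl := hlen O
    rcases lt_trichotomy i j with h | h | h
    · refine ⟨(i, j), by simp; omega, h, q, q', a1, b1, by rwa [b2], by rw [a2, l1],
        by rw [b2, l2], by rw [a2, b2, hh]⟩
    · subst h
      rw [a1] at b1
      exact absurd (a2.symm.trans ((congrArg (List.take m) (Option.some.inj b1)).trans b2)) hne
    · refine ⟨(j, i), by simp; omega, h, q', q, b1, a1, by rwa [a2], by rw [b2, l2],
        by rw [a2, l1], by rw [a2, b2, hh]⟩
  · simp
    ring

/-! ### Unique readability and sizes of the encodings -/

theorem encNat_append_inj {a b : ℕ} {s t : List Bool} (h : encNat a ++ s = encNat b ++ t) :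
    a = b ∧ s = t := by
  induction a generalizing b with
  | zero => cases b <;> simp_all [encNat, List.replicate_succ]
  | succ a ih =>
    cases b with
    | zero => simp [encNat, List.replicate_succ] at h
    | succ b =>
      have := @ih b (by simpa [encNat, List.replicate_succ] using h)
      simpa using this

theorem encList_cons {α : Type} (enc : α → List Bool) (a : α) (l : List α) :
    encList enc (a :: l) = true :: (enc a ++ encList enc l) := by
  simp [encList]

theorem encList_append_inj {α : Type} {enc : α → List Bool}
    (henc : ∀ a b s t, enc a ++ s = enc b ++ t → a = b ∧ s = t) {l l' : List α} {s t : List Bool}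
    (h : encList enc l ++ s = encList enc l' ++ t) : l = l' ∧ s = t := by
  induction l generalizing l' with
  | nil => cases l' <;> simp_all [encList]
  | cons a l ih =>
    cases l' with
    | nil => simp [encList] at h
    | cons b l' =>
      simp only [encList_cons, List.cons_append, List.cons.injEq, true_and,
        List.append_assoc] at h
      obtain ⟨rfl, h1⟩ := henc _ _ _ _ h
      simpa using ih h1

theorem Gate.code_append_inj (a b : Gate) (s t : List Bool) (h : a.code ++ s = b.code ++ t) :
    a = b ∧ s = t := by
  cases a <;> cases b <;> simp only [Gate.code, List.cons_append, List.nil_append,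
    List.append_assoc, List.cons.injEq, reduceCtorEq, false_and, and_false, true_and] at h
  · simpa using h
  · obtain ⟨rfl, h1⟩ := encNat_append_inj h
    obtain ⟨rfl, h2⟩ := encNat_append_inj h1
    simpa using h2
  · obtain ⟨rfl, h1⟩ := encList_append_inj (fun _ _ _ _ => encNat_append_inj) h
    simpa using h1

theorem Circuit.code_append_inj {C D : Circuit} {s t : List Bool}
    (h : C.code ++ s = D.code ++ t) : C = D ∧ s = t := by
  obtain ⟨n, gs, os⟩ := C
  obtain ⟨n', gs', os'⟩ := D
  simp only [Circuit.code, List.append_assoc] at h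
  obtain ⟨rfl, h1⟩ := encNat_append_inj h
  obtain ⟨rfl, h2⟩ := encList_append_inj Gate.code_append_inj h1
  obtain ⟨rfl, h3⟩ := encList_append_inj (fun _ _ _ _ => encNat_append_inj) h2
  simpa using h3

theorem Circuit.code_injective : Function.Injective Circuit.code := fun C D h =>
  (Circuit.code_append_inj (s := []) (t := []) (by simpa using h)).1

theorem length_le_length_encList {α : Type} (enc : α → List Bool) (l : List α) :
    l.length ≤ (encList enc l).length := by
  induction l with
  | nil => simp
  | cons a l ih =>
    rw [encList_cons]
    simp
    omega

theorem Circuit.inputs_add_length_gates_le (C : Circuit) :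
    C.inputs + C.gates.length + C.outputs.length ≤ C.code.length := by
  have h1 := length_le_length_encList Gate.code C.gates
  have h2 := length_le_length_encList encNat C.outputs
  simp [Circuit.code, encNat]
  omega

theorem length_encList_singleton (s : List Bool) :
    (encList (fun b => [b]) s).length = 2 * s.length + 1 := by
  induction s with
  | nil => simp [encList]
  | cons a l ih =>
    rw [encList_cons]
    simp [ih]
    omega

theorem length_encStrings (l : List (List Bool)) :
    (encStrings l).length = (l.map fun s => 2 * s.length + 2).sum + 1 := by
  induction l with
  | nil => simp [encStrings, encList]
  | cons a l ih =>
    rw [encStrings, encList_cons]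
    simp only [List.length_cons, List.length_append, length_encList_singleton, List.map_cons,
      List.sum_cons]
    rw [encStrings] at ih
    omega

theorem length_le_length_encStrings (l : List (List Bool)) : l.length ≤ (encStrings l).length :=
  length_le_length_encList _ l

theorem length_le_length_encStrings_of_mem {l : List (List Bool)} {s : List Bool} (h : s ∈ l) :
    s.length ≤ (encStrings l).length := by
  rw [length_encStrings]
  have := List.single_le_sum (l := l.map fun s => 2 * s.length + 2) (by simp) _
    (List.mem_map_of_mem h)
  omega

theorem encStrings_injective : Function.Injective encStrings := fun l l' h =>
  (encList_append_inj (enc := encList fun b => [b]) (s := []) (t := []) (fun _ _ _ _ h1 =>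
    encList_append_inj (enc := fun b => [b]) (fun _ _ _ _ h2 => by simpa using h2) h1)
    (by simpa [encStrings] using h)).1

/-! ### Evaluation of circuits as a query computation -/

/-- The evaluation of a gate. The result is the extended list of wire values. -/
def Gate.evalTree (w : List Bool) : Gate → QueryTree (List Bool)
  | .const b => .done (w ++ [b])
  | .nand i j => .done (w ++ [!(wire w i && wire w j)])
  | .oracle args => .ask (args.map (wire w)) fun b => .done (w ++ [b])

/-- The evaluation of a list of gates. The result is the extended list of wire values. -/
def gatesTree : List Gate → List Bool → QueryTree (List Bool)
  | [], w => .done w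
  | g :: gs, w => (g.evalTree w).bind (gatesTree gs)

/-- The evaluation of a circuit. -/
def Circuit.evalTree (C : Circuit) (x : List Bool) : QueryTree (List Bool) :=
  (gatesTree C.gates x).bind fun w => .done (C.outputs.map (wire w))

theorem Gate.eval_evalTree (O : Oracle) (w : List Bool) (g : Gate) :
    (g.evalTree w).eval O = w ++ [g.eval O w] := by
  cases g <;> rfl

theorem eval_gatesTree (O : Oracle) (gs : List Gate) (w : List Bool) :
    (gatesTree gs w).eval O = gs.foldl (fun w g => w ++ [g.eval O w]) w := by
  induction gs generalizing w with
  | nil => rfl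
  | cons g gs ih => rw [gatesTree, QueryTree.eval_bind, Gate.eval_evalTree, ih, List.foldl_cons]

theorem Circuit.eval_evalTree (O : Oracle) (C : Circuit) (x : List Bool) :
    (C.evalTree x).eval O = C.eval O x := by
  rw [evalTree, QueryTree.eval_bind, eval_gatesTree]
  rfl

theorem length_trace_gatesTree_le (O : Oracle) (gs : List Gate) (w : List Bool) :
    ((gatesTree gs w).trace O).length ≤ gs.length := by
  induction gs generalizing w with
  | nil => simp [gatesTree, QueryTree.trace]
  | cons g gs ih =>
    rw [gatesTree, QueryTree.trace_bind, List.length_append, List.length_cons, add_comm]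
    refine add_le_add (ih _) ?_
    cases g <;> simp [Gate.evalTree, QueryTree.trace]

theorem Circuit.length_trace_evalTree_le (O : Oracle) (C : Circuit) (x : List Bool) :
    ((C.evalTree x).trace O).length ≤ C.code.length := by
  have h1 := C.inputs_add_length_gates_le
  have h2 := length_trace_gatesTree_le O C.gates x
  rw [evalTree, QueryTree.trace_bind]
  simp [QueryTree.trace]
  omega

theorem Circuit.length_eval (O : Oracle) (C : Circuit) (x : List Bool) :
    (C.eval O x).length = C.outputs.length := by
  simp [Circuit.eval]

/-! ### The random instances -/

theorem wire_append_left {w w' : List Bool} {i : ℕ} (h : i < w.length) :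
    wire (w ++ w') i = wire w i := by
  simp [wire, List.getElem?_append_left h]

theorem map_wire_range (x w : List Bool) : (List.range x.length).map (wire (x ++ w)) = x := by
  apply List.ext_getElem
  · simp
  · intro i h1 h2
    simp [wire, List.getElem?_append_left h2, List.getElem?_eq_getElem h2]

/-- The gates read only wires of `w`, so the values appended by earlier gates do not matter. -/
theorem foldl_oracle_gates (O : Oracle) (w : List Bool) (args : ℕ → List ℕ) (k : ℕ)
    (h : ∀ i < k, ∀ a ∈ args i, a < w.length) :
    ((List.range k).map fun i => Gate.oracle (args i)).foldl (fun w g => w ++ [g.eval O w]) w =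
      w ++ (List.range k).map fun i => O ((args i).map (wire w)) := by
  induction k with
  | zero => simp
  | succ k ih =>
    rw [List.range_succ, List.map_append, List.foldl_append, ih fun i hi => h i (by omega)]
    simp only [List.map_cons, List.map_nil, List.foldl_cons, List.foldl_nil, List.map_append,
      Gate.eval, List.append_assoc, List.append_cancel_left_eq, List.cons.injEq, and_true]
    congr 1
    exact List.map_congr_left fun a ha => wire_append_left (h k (by omega) a ha)

theorem map_wire_outputs (w v : List Bool) (m : ℕ) (hm : w.length = m) :
    ((List.range v.length).map fun i => m + i).map (wire (w ++ v)) = v := by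
  subst hm
  apply List.ext_getElem
  · simp
  · intro i h1 h2
    simp [wire, h2]

theorem eval_randomF (O : Oracle) (n : ℕ) (x : List Bool) (hx : x.length = n) :
    (randomF n).eval O x = hash (n - 1) O (false :: x) := by
  -- The wires `n` and `n + 1` carry the constants `0` and `1`, so the arguments of the gate spell
  -- `0 x 1ⁱ`.
  have hw : ∀ i, (n :: List.range n ++ List.replicate i (n + 1)).map (wire (x ++ [false, true])) =
      (false :: x) ++ List.replicate i true := by
    intro i
    subst hx
    simp [map_wire_range, wire]
  have hc : ∀ w b, (Gate.const b).eval O w = b := fun _ _ => rfl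
  rw [Circuit.eval, randomF]
  simp only [List.foldl_cons, hc, List.append_assoc, List.cons_append, List.nil_append]
  rw [foldl_oracle_gates]
  · simp only [← List.cons_append, hw]
    have := map_wire_outputs (x ++ [false, true]) (hash (n - 1) O (false :: x)) (n + 2) (by simp [hx])
    simpa [hash] using this
  · intro i _ a ha
    simp only [List.mem_append, List.mem_cons, List.mem_range, List.mem_replicate] at ha
    simp
    omega

theorem eval_randomG (O : Oracle) (n : ℕ) (x : List Bool) (hx : x.length = 3 * n) :
    (randomG n).eval O x = hash (n - 1) O (true :: x) := by
  have hw : ∀ i, ((3 * n + 1) :: List.range (3 * n) ++ List.replicate i (3 * n + 1)).map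
      (wire (x ++ [false, true])) = (true :: x) ++ List.replicate i true := by
    intro i
    rw [← hx]
    simp [map_wire_range, wire]
  have hc : ∀ w b, (Gate.const b).eval O w = b := fun _ _ => rfl
  rw [Circuit.eval, randomG]
  simp only [List.foldl_cons, hc, List.append_assoc, List.cons_append, List.nil_append]
  rw [foldl_oracle_gates]
  · simp only [← List.cons_append, hw]
    have := map_wire_outputs (x ++ [false, true]) (hash (n - 1) O (true :: x)) (3 * n + 2)
      (by simp [hx])
    simpa [hash] using this
  · intro i _ a ha
    simp only [List.mem_append, List.mem_cons, List.mem_range, List.mem_replicate] at ha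
    simp
    omega

theorem isNestedInstance_random {n : ℕ} (hn : 1 ≤ n) :
    IsNestedInstance (randomF n) (randomG n) := by
  simp [IsNestedInstance, randomF, randomG]
  omega

/-- Unique readability recovers the two circuits from the string. For `n ≥ 1` they form an instance,
so the empty string is not accepted by default. -/
theorem nestedCollision_randomInstance {O : Oracle} {n : ℕ} (hn : 1 ≤ n) {t : List Bool}
    (h : NestedCollision O (randomInstance n) t) : ∃ x y u v : List Bool, t = x ++ y ++ u ++ v ∧
      (x.length = n ∧ y.length = n ∧ u.length = n ∧ v.length = n) ∧
      (x ≠ y ∧ hash (n - 1) O (false :: x) = hash (n - 1) O (false :: y)) ∧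
      (u ≠ v ∧ hash (n - 1) O (true :: (x ++ y ++ u)) = hash (n - 1) O (true :: (x ++ y ++ v))) := by
  rcases h with ⟨F, G, hs, -, x, y, u, v, rfl, ⟨hx, hy, hu, hv⟩, ⟨h1, h2⟩, h3, h4⟩ | ⟨h, -⟩
  · obtain ⟨rfl, hG⟩ := Circuit.code_append_inj hs
    obtain rfl := Circuit.code_injective hG
    have e : (randomF n).inputs = n := rfl
    rw [e] at hx hy hu hv
    rw [eval_randomF _ _ _ hx, eval_randomF _ _ _ hy] at h2
    rw [eval_randomG _ _ _ (by simp; omega), eval_randomG _ _ _ (by simp; omega)] at h4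
    exact ⟨x, y, u, v, rfl, ⟨hx, hy, hu, hv⟩, ⟨h1, h2⟩, h3, h4⟩
  · exact absurd ⟨_, _, rfl, isNestedInstance_random hn⟩ h

/-! ### Bit strings of a given length, and the pigeonhole principle -/

/-- The bit strings of length `n`. -/
noncomputable def boolLists (n : ℕ) : Finset (List Bool) := (List.finite_length_eq Bool n).toFinset

@[simp] theorem mem_boolLists {n : ℕ} {x : List Bool} : x ∈ boolLists n ↔ x.length = n := by
  simp [boolLists]

theorem card_boolLists (n : ℕ) : (boolLists n).card = 2 ^ n := by
  classical
  have : boolLists n = Finset.univ.image (List.Vector.toList : List.Vector Bool n → _) := by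
    ext x
    simp only [mem_boolLists, Finset.mem_image, Finset.mem_univ, true_and]
    exact ⟨fun h => ⟨⟨x, h⟩, rfl⟩, fun ⟨v, hv⟩ => hv ▸ v.2⟩
  rw [this, Finset.card_image_of_injective _ List.Vector.toList_injective]
  simp

/-- The output is one bit shorter than the input, so any set of more than half of the inputs already
outnumbers the outputs. The version for subsets is what produces collisions that avoid nested
queries. -/
theorem exists_collision_mem {C : Circuit} (O : Oracle) (hC : C.IsCollisionInstance)
    {A : Finset (List Bool)} (hA : A ⊆ boolLists C.inputs) (hcard : 2 ^ C.inputs < 2 * A.card) :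
    ∃ x ∈ A, ∃ y ∈ A, IsCollision O C x y := by
  have h1 : (boolLists C.outputs.length).card < A.card := by
    rw [card_boolLists]
    rw [← hC, pow_succ] at hcard
    omega
  obtain ⟨x, hx, y, hy, hne, h⟩ := Finset.exists_ne_map_eq_of_card_lt_of_maps_to h1
    (f := C.eval O) fun x _ => by simp [Circuit.length_eval]
  exact ⟨x, hx, y, hy, mem_boolLists.1 (hA hx), mem_boolLists.1 (hA hy), hne, h⟩

theorem exists_isCollision {C : Circuit} (O : Oracle) (hC : C.IsCollisionInstance) :
    ∃ x y, IsCollision O C x y := by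
  obtain ⟨x, -, y, -, h⟩ := exists_collision_mem O hC (subset_refl _) (by
    rw [card_boolLists]
    have : 0 < 2 ^ C.inputs := by positivity
    omega)
  exact ⟨x, y, h⟩

theorem collision_total (O : Oracle) (s : List Bool) : ∃ t, Collision O s t := by
  by_cases h : ∃ C : Circuit, s = C.code ∧ C.IsCollisionInstance
  · obtain ⟨C, hs, hC⟩ := h
    obtain ⟨x, y, hxy⟩ := exists_isCollision O hC
    exact ⟨_, .inl ⟨C, hs, hC, x, y, rfl, hxy⟩⟩
  · exact ⟨_, .inr ⟨h, rfl⟩⟩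

/-! ### The distribution of a random oracle on finitely many strings -/

-- The marginal of the product measure on the finite set `W` is uniform on `W → Bool`. This
-- transfers the counting estimates to the random oracle.
open Classical in
theorem randomOracle_eq_pr {W : Finset (List Bool)} {E : Oracle → Prop}
    (hE : ∀ O O' : Oracle, (∀ q ∈ W, O q = O' q) → E O = E O') :
    randomOracle {O | E O} = ENNReal.ofReal (pr W E) := by
  have h1 : {O | E O} = W.restrict ⁻¹' {a | E (extendOracle W a)} := by
    ext O
    simp only [Set.mem_ofPred_eq, Set.mem_preimage]
    rw [hE O (extendOracle W (W.restrict O)) fun q hq => by simp [extendOracle, hq]]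
  have hb : ∀ b : Bool, (PMF.uniformOfFintype Bool).toMeasure {b} = 2⁻¹ := fun b => by
    rw [PMF.toMeasure_apply_singleton _ _ (measurableSet_singleton b)]
    simp
  rw [h1, ← Measure.map_apply (Finset.measurable_restrict W) (Set.toFinite _).measurableSet,
    randomOracle, Measure.infinitePi_map_restrict]
  have h2 : {a : W → Bool | E (extendOracle W a)} =
      ((Finset.univ.filter fun a : W → Bool => E (extendOracle W a)) : Finset (W → Bool)) := by
    ext a
    simp
  rw [h2, ← sum_measure_singleton]
  simp only [Measure.pi_singleton, hb, Finset.prod_const, Finset.sum_const, Finset.card_univ,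
    Fintype.card_coe, pr]
  rw [ENNReal.ofReal_div_of_pos (by positivity), ENNReal.ofReal_natCast,
    ENNReal.ofReal_pow (by norm_num), ENNReal.ofReal_ofNat, div_eq_mul_inv, ENNReal.inv_pow,
    nsmul_eq_mul]

/-! ### Queries that involve a collision of the outer function -/

/-- The queries `1 x y r` such that `(x, y)` is a collision of the random function
`{0,1}ⁿ → {0,1}ⁿ⁻¹`. -/
def nestedQueries (n : ℕ) (O : Oracle) : Set (List Bool) :=
  {q | (q.head? = some true ∧ (q.tail.take n).length = n ∧ ((q.tail.drop n).take n).length = n ∧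
      q.tail.take n ≠ (q.tail.drop n).take n) ∧
    hash (n - 1) O (false :: q.tail.take n) = hash (n - 1) O (false :: (q.tail.drop n).take n)}

/-- Every nested query starts with `1`, but whether a string is nested depends on oracle values at
strings starting with `0`. So the set is determined by the oracle outside of it, as resampling
requires. -/
theorem nestedQueries_congr {n : ℕ} {O O' : Oracle}
    (h : ∀ s ∉ nestedQueries n O, O' s = O s) : nestedQueries n O' = nestedQueries n O := by
  have : ∀ s, hash (n - 1) O' (false :: s) = hash (n - 1) O (false :: s) := fun s =>
    hash_congr fun i _ => h _ (by simp [nestedQueries])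
  simp only [nestedQueries, this]

theorem mem_nestedQueries {n : ℕ} {O : Oracle} {x y : List Bool} (r : List Bool)
    (hx : x.length = n) (hy : y.length = n) (hne : x ≠ y)
    (h : hash (n - 1) O (false :: x) = hash (n - 1) O (false :: y)) :
    true :: (x ++ y ++ r) ∈ nestedQueries n O := by
  have h1 : (x ++ (y ++ r)).take n = x := by rw [List.take_append_of_le_length hx.ge, ← hx, List.take_length]
  have h2 : ((x ++ (y ++ r)).drop n).take n = y := by
    rw [← hx, List.drop_left, hx, ← hy, List.take_left]
  simp only [nestedQueries, List.append_assoc, Set.mem_ofPred_eq, List.tail_cons, h1, h2]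
  exact ⟨⟨rfl, hx, hy, hne⟩, h⟩

/-- The computation makes no query that involves a collision of the outer function. -/
def Avoids {α : Type} (n : ℕ) (O : Oracle) (T : QueryTree α) : Prop :=
  ∀ q ∈ T.trace O, q ∉ nestedQueries n O

/-- A computation that avoids the nested queries never reads a changed value, so its trace and its
result stay the same. -/
theorem Avoids.congr {α : Type} {n : ℕ} {O O' : Oracle} {T : QueryTree α} (hT : Avoids n O T)
    (h : ∀ s ∉ nestedQueries n O, O' s = O s) : Avoids n O' T ∧ T.eval O' = T.eval O := by
  obtain ⟨h1, h2⟩ := QueryTree.trace_eval_congr T fun q hq => (h q (hT q hq)).symm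
  refine ⟨fun q hq => ?_, h2⟩
  rw [nestedQueries_congr h]
  exact hT q (h1 ▸ hq)

theorem avoids_congr_iff {α : Type} {n : ℕ} {O O' : Oracle} (T : QueryTree α)
    (h : ∀ s ∉ nestedQueries n O, O' s = O s) : Avoids n O' T ↔ Avoids n O T := by
  refine ⟨fun h' => (h'.congr fun s hs => ?_).1, fun h' => (h'.congr h).1⟩
  rw [nestedQueries_congr h] at hs
  exact (h s hs).symm

/-- A nested query displays a collision of the outer function. Stopping before the query of index
`j` and reading the collision off it gives a collision finder. The union bound over `j < D`
contributes the factor `D`. -/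
theorem pr_not_avoids_le {α : Type} {W : Finset (List Bool)} (n D : ℕ) (T : QueryTree α)
    (hT : ∀ O, (T.trace O).length ≤ D)
    (hW : ∀ s : List Bool, s.length = n + 1 → ∀ i < n - 1, s ++ List.replicate i true ∈ W) :
    pr W (fun O => ¬ Avoids n O T) ≤ D * ((D + 2) ^ 2 / 2 ^ (n - 1)) := by
  let T' : ℕ → QueryTree (List Bool × List Bool) := fun j => (T.nthQuery j).bind fun o =>
    .done (false :: (o.getD []).tail.take n, false :: ((o.getD []).tail.drop n).take n)
  have hT' : ∀ j O, ((T' j).trace O).length ≤ D := by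
    intro j O
    simp only [T', QueryTree.trace_bind, QueryTree.trace, List.append_nil]
    exact (QueryTree.length_trace_nthQuery_le O T j).trans (hT O)
  have h := pr_exists_le_card_mul (W := W) (Finset.range D) _ _ fun j _ =>
    pr_find_collision_le (n + 1) (n - 1) D (T' j) (hT' j) hW
  rw [Finset.card_range] at h
  refine le_trans (pr_mono fun O hO => ?_) h
  simp only [Avoids, not_forall, not_not] at hO
  obtain ⟨q, hq, ⟨-, h1, h2, h3⟩, h4⟩ := hO
  obtain ⟨j, hj, hjq⟩ := List.mem_iff_getElem.1 hq
  refine ⟨j, Finset.mem_range.2 (hj.trans_le (hT O)), ?_⟩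
  have he : (T' j).eval O = (false :: q.tail.take n, false :: (q.tail.drop n).take n) := by
    simp only [T', QueryTree.eval_bind, QueryTree.eval, QueryTree.eval_nthQuery,
      List.getElem?_eq_getElem hj, hjq, Option.getD_some]
  rw [he]
  exact ⟨by simpa using h1, by simpa using h2, by simpa using h3, h4⟩

open Classical in
/-- Markov's inequality for the number of elements of `S` with a property. -/
theorem pr_half_le {ι : Type*} {W : Finset (List Bool)} (S : Finset ι) (hS : S.Nonempty)
    (H : ι → Oracle → Prop) (ε : ℝ) (h : ∀ i ∈ S, pr W (H i) ≤ ε) :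
    pr W (fun O => S.card ≤ 2 * (S.filter fun i => H i O).card) ≤ 2 * ε := by
  have hpos : (0 : ℝ) < S.card := by exact_mod_cast hS.card_pos
  have h2 : (0 : ℝ) < 2 ^ W.card := by positivity
  -- Double counting of the pairs of an oracle and an element of `S` with the property.
  have h1 : S.card * (pr W (fun O => S.card ≤ 2 * (S.filter fun i => H i O).card) * 2 ^ W.card) ≤
      ∑ a : W → Bool, 2 * ∑ i ∈ S, if H i (extendOracle W a) then (1 : ℝ) else 0 := by
    rw [pr_eq_sum, Finset.mul_sum]
    refine Finset.sum_le_sum fun a _ => ?_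
    rw [Finset.sum_boole]
    split_ifs with hc
    · rw [mul_one]
      exact_mod_cast hc
    · simp
  rw [← Finset.mul_sum, Finset.sum_comm] at h1
  simp only [← pr_eq_sum] at h1
  have h3 : ∑ i ∈ S, pr W (H i) * 2 ^ W.card ≤ S.card • (ε * 2 ^ W.card) :=
    Finset.sum_le_card_nsmul _ _ _ fun i hi => by
      gcongr
      exact h i hi
  rw [nsmul_eq_mul] at h3
  have h4 := h1.trans (mul_le_mul_of_nonneg_left h3 (by norm_num : (0 : ℝ) ≤ 2))
  rw [← mul_assoc, mul_left_comm, ← mul_assoc, ← mul_assoc] at h4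
  refine le_of_mul_le_mul_left ?_ hpos
  refine le_of_mul_le_mul_right ?_ h2
  nlinarith

/-! ### A solver that reveals nothing about the inner functions -/

/-- The pair `(x, y)` is a collision of `C`, and the evaluations of `C` on `x` and `y` make no query
that involves a collision of the outer function. -/
def IsGoodCollision (n : ℕ) (O : Oracle) (C : Circuit) (x y : List Bool) : Prop :=
  IsCollision O C x y ∧ Avoids n O (C.evalTree x) ∧ Avoids n O (C.evalTree y)

theorem IsGoodCollision.congr {n : ℕ} {O O' : Oracle} {C : Circuit} {x y : List Bool}
    (hC : IsGoodCollision n O C x y) (h : ∀ s ∉ nestedQueries n O, O' s = O s) :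
    IsGoodCollision n O' C x y := by
  obtain ⟨⟨h1, h2, h3, h4⟩, h5, h6⟩ := hC
  obtain ⟨a1, a2⟩ := h5.congr h
  obtain ⟨b1, b2⟩ := h6.congr h
  rw [Circuit.eval_evalTree, Circuit.eval_evalTree] at a2 b2
  exact ⟨⟨h1, h2, h3, by rw [a2, b2, h4]⟩, a1, b1⟩

/-- `t` is a good collision for the instance `s` of `Collision`. -/
def IsGoodAnswer (n : ℕ) (O : Oracle) (s t : List Bool) : Prop :=
  ∃ C : Circuit, s = C.code ∧ C.IsCollisionInstance ∧ ∃ x y, t = x ++ y ∧ IsGoodCollision n O C x y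

theorem isGoodAnswer_congr {n : ℕ} {O O' : Oracle} (h : ∀ s ∉ nestedQueries n O, O' s = O s) :
    IsGoodAnswer n O' = IsGoodAnswer n O := by
  ext s t
  constructor
  · rintro ⟨C, hs, hC, x, y, ht, hxy⟩
    refine ⟨C, hs, hC, x, y, ht, hxy.congr fun s hs => ?_⟩
    rw [nestedQueries_congr h] at hs
    exact (h s hs).symm
  · rintro ⟨C, hs, hC, x, y, ht, hxy⟩
    exact ⟨C, hs, hC, x, y, ht, hxy.congr h⟩

open Classical in
/-- A canonical good answer; the empty string if there is none. -/
noncomputable def goodAnswer (n : ℕ) (O : Oracle) (s : List Bool) : List Bool :=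
  if h : ∃ t, IsGoodAnswer n O s t then h.choose else []

/-- The choice depends only on the predicate of being a good answer, which is literally the same for
both oracles. Hence the chosen answer itself is the same, not just its existence. -/
theorem goodAnswer_congr {n : ℕ} {O O' : Oracle} (h : ∀ s ∉ nestedQueries n O, O' s = O s) :
    goodAnswer n O' = goodAnswer n O := by
  unfold goodAnswer
  rw [isGoodAnswer_congr h]

open Classical in
/-- The solver that gives a good answer whenever there is one. -/
noncomputable def goodSolver (n : ℕ) (O : Oracle) (s : List Bool) : List Bool :=
  if (∃ t, IsGoodAnswer n O s t) ∨ ¬ ∃ C : Circuit, s = C.code ∧ C.IsCollisionInstance then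
    goodAnswer n O s else (collision_total O s).choose

theorem solves_goodSolver (n : ℕ) (O : Oracle) : Solves (goodSolver n O) (Collision O) := by
  intro s
  unfold goodSolver
  split_ifs with h
  · by_cases hex : ∃ t, IsGoodAnswer n O s t
    · rw [goodAnswer, dif_pos hex]
      obtain ⟨C, hs, hC, x, y, ht, hxy⟩ := hex.choose_spec
      exact .inl ⟨C, hs, hC, x, y, ht, hxy.1⟩
    · rw [goodAnswer, dif_neg hex]
      exact .inr ⟨h.resolve_left hex, rfl⟩
  · exact (collision_total O s).choose_spec

open Classical in
/-- If `s` is an instance of `Collision`, then the evaluation of its circuit makes a query that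
involves a collision of the outer function for less than half of the inputs. -/
def MostlyAvoids (n : ℕ) (O : Oracle) (s : List Bool) : Prop :=
  ∀ C : Circuit, s = C.code → C.IsCollisionInstance →
    2 * ((boolLists C.inputs).filter fun x => ¬ Avoids n O (C.evalTree x)).card < 2 ^ C.inputs

open Classical in
theorem mostlyAvoids_congr {n : ℕ} {O O' : Oracle} (h : ∀ s ∉ nestedQueries n O, O' s = O s)
    (s : List Bool) : MostlyAvoids n O' s ↔ MostlyAvoids n O s := by
  have : ∀ C : Circuit, ((boolLists C.inputs).filter fun x => ¬ Avoids n O' (C.evalTree x)) =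
      (boolLists C.inputs).filter fun x => ¬ Avoids n O (C.evalTree x) := fun C =>
    Finset.filter_congr fun x _ => not_congr (avoids_congr_iff _ h)
  simp only [MostlyAvoids, this]

/-- More than half of the inputs have evaluations without nested queries, so the pigeonhole
principle finds a good collision among them. The default of the solver, an arbitrary collision, is
then not used. -/
theorem MostlyAvoids.goodSolver_eq {n : ℕ} {O : Oracle} {s : List Bool} (h : MostlyAvoids n O s) :
    goodSolver n O s = goodAnswer n O s := by
  classical
  rw [goodSolver, if_pos]
  by_cases hs : ∃ C : Circuit, s = C.code ∧ C.IsCollisionInstance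
  · left
    obtain ⟨C, rfl, hC⟩ := hs
    have h1 := h C rfl hC
    have h2 := Finset.card_filter_add_card_filter_not (s := boolLists C.inputs)
      fun x => ¬ Avoids n O (C.evalTree x)
    rw [card_boolLists] at h2
    obtain ⟨x, hx, y, hy, hxy⟩ := exists_collision_mem O hC
      (Finset.filter_subset (fun x => ¬ ¬ Avoids n O (C.evalTree x)) (boolLists C.inputs)) (by omega)
    simp only [Finset.mem_filter, not_not] at hx hy
    exact ⟨_, C, rfl, hC, x, y, rfl, hxy, hx.2, hy.2⟩
  · exact .inr hs

/-! ### The success probability of non-adaptive reductions -/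

/-- Neither the preprocessing nor most of the evaluations of the submitted circuits make queries
that involve a collision of the outer function. -/
def BlackBoxReduction.IsGood (T : BlackBoxReduction) (n : ℕ) (O : Oracle) : Prop :=
  Avoids n O T ∧ ∀ s ∈ (QueryTree.eval O T).1, MostlyAvoids n O s

/-- The reduction finds a nested collision if the queries are answered by good collisions. -/
def BlackBoxReduction.GoodSuccess (T : BlackBoxReduction) (n : ℕ) (O : Oracle) : Prop :=
  ∃ x y u v : List Bool,
    ((QueryTree.eval O T).2 ((QueryTree.eval O T).1.map (goodAnswer n O))).eval O =
      x ++ y ++ u ++ v ∧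
    (x.length = n ∧ y.length = n ∧ u.length = n ∧ v.length = n) ∧
    (x ≠ y ∧ hash (n - 1) O (false :: x) = hash (n - 1) O (false :: y)) ∧
    (u ≠ v ∧ hash (n - 1) O (true :: (x ++ y ++ u)) = hash (n - 1) O (true :: (x ++ y ++ v)))

/-- Success means success for every solver, in particular for the good one. On the good event its
answers to the submitted queries are the canonical good answers. -/
theorem BlackBoxReduction.success_subset (T : BlackBoxReduction) {n : ℕ} (hn : 1 ≤ n) :
    T.Success n ⊆ {O | ¬ T.IsGood n O ∨ T.IsGood n O ∧ T.GoodSuccess n O} := by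
  intro O hO
  by_cases hg : T.IsGood n O
  · refine .inr ⟨hg, ?_⟩
    have h1 := nestedCollision_randomInstance hn (hO _ (solves_goodSolver n O))
    rw [BlackBoxReduction.output,
      List.map_congr_left fun s hs => (hg.2 s hs).goodSolver_eq] at h1
    exact h1
  · exact .inl hg

variable {W : Finset (List Bool)}

/-- The preprocessing accounts for the first summand. For the second one, the submitted circuits and
their numbers of inputs depend on the oracle, whereas Markov's inequality needs a fixed set of
inputs. So the union bound runs over the position `i < q` in the list and the number of inputs `m ≤
q`. For fixed `i`, `m` and input `x`, preprocessing and evaluation together make at most `2q`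
queries. -/
theorem BlackBoxReduction.pr_not_isGood_le (T : BlackBoxReduction) (n q : ℕ) (hT : T.Bounded q)
    (hW : ∀ s : List Bool, s.length = n + 1 → ∀ i < n - 1, s ++ List.replicate i true ∈ W) :
    pr W (fun O => ¬ T.IsGood n O) ≤ q * ((q + 2) ^ 2 / 2 ^ (n - 1)) +
      (q * (q + 1)) * (2 * ((2 * q) * ((2 * q + 2) ^ 2 / 2 ^ (n - 1)))) := by
  classical
  have hq : ∀ O, (QueryTree.trace O T).length ≤ q := fun O =>
    (QueryTree.length_trace_le O T).trans hT.1
  have hmem : ∀ O, ∀ s ∈ (QueryTree.eval O T).1, s.length ≤ q := fun O s hs =>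
    (length_le_length_encStrings_of_mem hs).trans (hT.2 O).1
  -- Decoding the circuit is free in the query model. The chosen circuit is the right one because
  -- codes are injective.
  let eT : ℕ → ℕ → List Bool → List (List Bool) → QueryTree (List Bool) := fun i m x l =>
    if h : ∃ C : Circuit, l[i]? = some C.code ∧ C.inputs = m then h.choose.evalTree x
    else .done []
  have heT : ∀ i m x l (C : Circuit), l[i]? = some C.code → C.inputs = m →
      eT i m x l = C.evalTree x := by
    intro i m x l C h1 h2
    have h : ∃ C : Circuit, l[i]? = some C.code ∧ C.inputs = m := ⟨C, h1, h2⟩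
    simp only [eT, dif_pos h]
    rw [Circuit.code_injective (Option.some.inj (h.choose_spec.1.symm.trans h1))]
  let T' : ℕ → ℕ → List Bool → QueryTree (List Bool) := fun i m x => QueryTree.bind T fun p =>
    eT i m x p.1
  have hT' : ∀ i m x O, ((T' i m x).trace O).length ≤ 2 * q := by
    intro i m x O
    simp only [T', QueryTree.trace_bind, List.length_append]
    have h1 := hq O
    suffices ((eT i m x (QueryTree.eval O T).1).trace O).length ≤ q by omega
    simp only [eT]
    split_ifs with h
    · refine (Circuit.length_trace_evalTree_le _ _ _).trans (hmem O _ ?_)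
      exact List.mem_of_getElem? h.choose_spec.1
    · simp [QueryTree.trace]
  have h1 := pr_exists_le_card_mul (W := W) (Finset.range q ×ˢ Finset.range (q + 1)) _ _
    fun im _ => pr_half_le (boolLists im.2) (by
      rw [← Finset.card_pos, card_boolLists]; positivity) _ _ fun x _ =>
      pr_not_avoids_le n (2 * q) (T' im.1 im.2 x) (hT' _ _ _) hW
  have h2 := pr_not_avoids_le n q T hq hW
  rw [Finset.card_product, Finset.card_range, Finset.card_range] at h1
  push_cast at h1
  refine le_trans (pr_mono fun O hO => ?_) ((pr_or_le _ _).trans (add_le_add h2 h1))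
  by_cases hA : Avoids n O T
  · right
    have : ∃ s ∈ (QueryTree.eval O T).1, ¬ MostlyAvoids n O s := by
      by_contra! hcon
      exact hO ⟨hA, hcon⟩
    obtain ⟨s, hs, hs'⟩ := this
    simp only [MostlyAvoids, not_forall, not_lt] at hs'
    obtain ⟨C, rfl, hC, hcard⟩ := hs'
    obtain ⟨i, hi, his⟩ := List.mem_iff_getElem.1 hs
    have hC' := (C.inputs_add_length_gates_le).trans (hmem O _ hs)
    refine ⟨(i, C.inputs), ?_, ?_⟩
    · have := (length_le_length_encStrings (QueryTree.eval O T).1).trans (hT.2 O).1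
      simp only [Finset.mem_product, Finset.mem_range]
      omega
    · rw [card_boolLists]
      refine hcard.trans (Nat.mul_le_mul_left 2 (Finset.card_le_card ?_))
      intro x hx
      simp only [Finset.mem_filter] at hx ⊢
      refine ⟨hx.1, fun hx' => hx.2 fun p hp => hx' p ?_⟩
      simp only [T', QueryTree.trace_bind]
      rw [heT _ _ _ _ C (by rw [List.getElem?_eq_getElem hi, his]) rfl]
      exact List.mem_append_right _ hp
  · exact .inl hA

/-- Fix the oracle outside of the nested queries. On the good event this determines the submitted
queries and the canonical answers, hence also the postprocessing as a query tree. With the outside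
values hard-wired, that tree must find a collision of a fresh random function with at most `q`
queries. -/
theorem BlackBoxReduction.pr_goodSuccess_le (T : BlackBoxReduction) (n q : ℕ) (hT : T.Bounded q)
    (hW : ∀ s : List Bool, s.length = 3 * n + 1 → ∀ i < n - 1, s ++ List.replicate i true ∈ W) :
    pr W (fun O => T.IsGood n O ∧ T.GoodSuccess n O) ≤ (q + 2) ^ 2 / 2 ^ (n - 1) := by
  classical
  refine pr_le_of_resample (nestedQueries n) (fun O O' h => nestedQueries_congr h) _ fun O => ?_
  have hagree : ∀ O', ∀ s ∉ nestedQueries n O, (nestedQueries n O).piecewise O' O s = O s :=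
    fun O' s hs => Set.piecewise_eq_of_notMem _ _ _ hs
  by_cases hg : T.IsGood n O
  · let P := (QueryTree.eval O T).2 ((QueryTree.eval O T).1.map (goodAnswer n O))
    -- The output `x y u v` is rearranged to the pair `1 x y u`, `1 x y v` of strings of length `3n
    -- + 1`, which is a collision of a single random function.
    let P' : QueryTree (List Bool × List Bool) := (P.fixOutside (nestedQueries n O) O).bind
      fun t => .done (true :: t.take (3 * n), true :: (t.take (2 * n) ++ t.drop (3 * n)))
    have hP' : ∀ O', (P'.trace O').length ≤ q := by
      intro O'
      simp only [P', QueryTree.trace_bind, QueryTree.trace, List.append_nil]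
      exact ((QueryTree.length_trace_fixOutside_le _ _ _ _).trans
        (QueryTree.length_trace_le _ _)).trans ((hT.2 O).2 _)
    refine le_trans (pr_mono fun O' hO' => ?_)
      (pr_find_collision_le (3 * n + 1) (n - 1) q P' hP' hW)
    obtain ⟨-, x, y, u, v, ht, ⟨hx, hy, hu, hv⟩, ⟨hxy, hf⟩, huv, hgg⟩ := hO'
    have hB := nestedQueries_congr (hagree O')
    rw [(hg.1.congr (hagree O')).2, goodAnswer_congr (hagree O')] at ht
    have ht' : (P.fixOutside (nestedQueries n O) O).eval O' = x ++ y ++ u ++ v := by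
      rw [QueryTree.eval_fixOutside]
      convert ht
    have he : P'.eval O' = (true :: (x ++ y ++ u), true :: (x ++ y ++ v)) := by
      simp only [P', QueryTree.eval_bind, QueryTree.eval, ht']
      have e1 : (x ++ y ++ u ++ v).take (3 * n) = x ++ y ++ u :=
        List.take_left' (by simp; omega)
      have e2 : (x ++ y ++ u ++ v).drop (3 * n) = v := List.drop_left' (by simp; omega)
      have e3 : (x ++ y ++ u ++ v).take (2 * n) = x ++ y := by
        rw [List.append_assoc]
        exact List.take_left' (by simp; omega)
      rw [e1, e2, e3]
    have hin : ∀ r, true :: (x ++ y ++ r) ∈ nestedQueries n O := fun r => by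
      rw [← hB]
      exact mem_nestedQueries r hx hy hxy hf
    -- As `(x, y)` is a collision of the outer function, all strings `1 x y r` are nested. So the
    -- hash values concerned come entirely from the resampled oracle.
    have hh : ∀ r, hash (n - 1) ((nestedQueries n O).piecewise O' O) (true :: (x ++ y ++ r)) =
        hash (n - 1) O' (true :: (x ++ y ++ r)) := fun r => hash_congr fun i _ =>
      Set.piecewise_eq_of_mem _ _ _ (by
        have := hin (r ++ List.replicate i true)
        simpa using this)
    rw [he]
    refine ⟨by simp; omega, by simp; omega, by simpa using huv, ?_⟩
    rw [← hh, ← hh]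
    convert hgg
  -- The good event is itself invariant under resampling, so it cannot occur if it fails for `O`.
  · rw [pr_eq_zero]
    · positivity
    · rintro O' ⟨⟨h1, h2⟩, -⟩
      rw [avoids_congr_iff _ (hagree O')] at h1
      refine hg ⟨h1, fun s hs => ?_⟩
      rw [← (h1.congr (hagree O')).2] at hs
      exact (mostlyAvoids_congr (hagree O') s).1 (h2 s hs)

/-! ### The events depend on finitely many oracle bits -/

theorem FinDep.hash (k : ℕ) (s : List Bool) : FinDep fun O => hash k O s :=
  FinDep.list_map _ fun i => FinDep.apply (s ++ List.replicate i true)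

theorem FinDep.mem_nestedQueries (n : ℕ) (q : List Bool) :
    FinDep fun O => q ∈ nestedQueries n O :=
  (FinDep.hash (n - 1) _).comp₂ (FinDep.hash (n - 1) _) fun a b =>
    (q.head? = some true ∧ (q.tail.take n).length = n ∧ ((q.tail.drop n).take n).length = n ∧
      q.tail.take n ≠ (q.tail.drop n).take n) ∧ a = b

theorem FinDep.list_forall {ι : Type*} (l : List ι) {F : ι → Oracle → Prop}
    (hF : ∀ i, FinDep (F i)) : FinDep fun O => ∀ i ∈ l, F i O := by
  convert (FinDep.list_map l hF).comp fun l' => ∀ p ∈ l', p using 2 with O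
  simp only [List.forall_mem_map]

theorem FinDep.avoids {α : Type} (n : ℕ) (T : QueryTree α) : FinDep fun O => Avoids n O T :=
  (FinDep.trace T).bind (G := fun l O => ∀ q ∈ l, q ∉ nestedQueries n O) fun l =>
    FinDep.list_forall l fun q => (FinDep.mem_nestedQueries n q).comp Not

theorem FinDep.mostlyAvoids (n : ℕ) (s : List Bool) : FinDep fun O => MostlyAvoids n O s := by
  classical
  by_cases hs : ∃ C : Circuit, s = C.code
  · obtain ⟨C, rfl⟩ := hs
    convert (FinDep.filter (boolLists C.inputs) (F := fun x O => ¬ Avoids n O (C.evalTree x))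
      fun x _ => (FinDep.avoids n _).comp Not).comp fun A => C.IsCollisionInstance →
        2 * A.card < 2 ^ C.inputs using 2 with O
    refine ⟨fun h hC => by convert h C rfl hC, fun h D hD hC => ?_⟩
    obtain rfl := Circuit.code_injective hD
    convert h hC
  · convert FinDep.const True with O
    exact iff_true_intro fun C hC => absurd ⟨C, hC⟩ hs

/-- For a code `s` the good answers are determined by the finite set of good pairs of inputs. For
other strings there are none. -/
theorem FinDep.goodAnswer (n : ℕ) (s : List Bool) : FinDep fun O => goodAnswer n O s := by
  classical
  suffices FinDep fun O => IsGoodAnswer n O s from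
    this.comp fun P => if h : ∃ t, P t then h.choose else []
  by_cases hs : ∃ C : Circuit, s = C.code
  · obtain ⟨C, rfl⟩ := hs
    have h := (FinDep.filter (boolLists C.inputs ×ˢ boolLists C.inputs)
      (F := fun p O => IsGoodCollision n O C p.1 p.2) fun p _ => ?_).comp fun A t =>
        C.IsCollisionInstance ∧ ∃ p ∈ A, t = p.1 ++ p.2
    · convert h using 2 with O
      ext t
      constructor
      · rintro ⟨D, hD, hC, x, y, ht, hxy⟩
        obtain rfl := Circuit.code_injective hD
        exact ⟨hC, (x, y), by simp [hxy.1.1, hxy.1.2.1, hxy], ht⟩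
      · rintro ⟨hC, p, hp, ht⟩
        exact ⟨C, rfl, hC, _, _, ht, (Finset.mem_filter.1 hp).2⟩
    · have h1 := (FinDep.eval (C.evalTree p.1)).comp₂ (FinDep.eval (C.evalTree p.2)) fun a b =>
        p.1.length = C.inputs ∧ p.2.length = C.inputs ∧ p.1 ≠ p.2 ∧ a = b
      have h2 := (FinDep.avoids n (C.evalTree p.1)).comp₂ (FinDep.avoids n (C.evalTree p.2)) And
      simp only [Circuit.eval_evalTree] at h1
      exact h1.comp₂ h2 And
  · refine ⟨∅, fun O O' _ => ?_⟩
    ext t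
    exact ⟨fun ⟨C, hC, _⟩ => absurd ⟨C, hC⟩ hs, fun ⟨C, hC, _⟩ => absurd ⟨C, hC⟩ hs⟩

theorem FinDep.isGood (T : BlackBoxReduction) (n : ℕ) : FinDep fun O => T.IsGood n O :=
  (FinDep.avoids n T).comp₂ (G := fun O => ∀ s ∈ (QueryTree.eval O T).1, MostlyAvoids n O s)
    ((FinDep.eval T).bind (G := fun p O => ∀ s ∈ p.1, MostlyAvoids n O s) fun p =>
      FinDep.list_forall p.1 fun s => FinDep.mostlyAvoids n s) And

theorem FinDep.goodSuccess (T : BlackBoxReduction) (n : ℕ) : FinDep fun O => T.GoodSuccess n O := by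
  have h1 : FinDep fun O =>
      ((QueryTree.eval O T).2 ((QueryTree.eval O T).1.map (PWPPTuring.goodAnswer n O))).eval O :=
    (FinDep.eval T).bind (G := fun p O => (p.2 (p.1.map (PWPPTuring.goodAnswer n O))).eval O)
      fun p => (FinDep.list_map p.1 (FinDep.goodAnswer n)).bind
        (G := fun a O => (p.2 a).eval O) fun a => FinDep.eval _
  refine h1.bind (G := fun t O => ∃ x y u v : List Bool, t = x ++ y ++ u ++ v ∧
    (x.length = n ∧ y.length = n ∧ u.length = n ∧ v.length = n) ∧
    (x ≠ y ∧ PWPPTuring.hash (n - 1) O (false :: x) = PWPPTuring.hash (n - 1) O (false :: y)) ∧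
    (u ≠ v ∧ PWPPTuring.hash (n - 1) O (true :: (x ++ y ++ u)) =
      PWPPTuring.hash (n - 1) O (true :: (x ++ y ++ v)))) fun t => ?_
  by_cases ht : ∃ x y u v : List Bool, t = x ++ y ++ u ++ v ∧
    (x.length = n ∧ y.length = n ∧ u.length = n ∧ v.length = n)
  · obtain ⟨x, y, u, v, rfl, hx, hy, hu, hv⟩ := ht
    have h := ((FinDep.hash (n - 1) (false :: x)).comp₂ (FinDep.hash (n - 1) (false :: y))
      fun a b => x ≠ y ∧ a = b).comp₂ ((FinDep.hash (n - 1) (true :: (x ++ y ++ u))).comp₂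
        (FinDep.hash (n - 1) (true :: (x ++ y ++ v))) fun a b => u ≠ v ∧ a = b) And
    convert h using 2 with O
    refine ⟨?_, fun h => ⟨x, y, u, v, rfl, ⟨hx, hy, hu, hv⟩, h⟩⟩
    rintro ⟨x', y', u', v', h1, ⟨hx', hy', hu', hv'⟩, h⟩
    obtain ⟨h2, rfl⟩ := List.append_inj h1 (by simp; omega)
    obtain ⟨h3, rfl⟩ := List.append_inj h2 (by simp; omega)
    obtain ⟨rfl, rfl⟩ := List.append_inj h3 (by omega)
    exact h
  · convert FinDep.const False with O
    exact iff_false_intro fun ⟨x, y, u, v, h1, h2, _⟩ => ht ⟨x, y, u, v, h1, h2⟩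

theorem BlackBoxReduction.success_le (T : BlackBoxReduction) {n : ℕ} (hn : 1 ≤ n) (q : ℕ)
    (hT : T.Bounded q) :
    randomOracle (T.Success n) ≤ ENNReal.ofReal (18 * (q + 2) ^ 5 / 2 ^ (n - 1)) := by
  classical
  obtain ⟨W₀, hW₀⟩ : FinDep fun O => ¬ T.IsGood n O ∨ T.IsGood n O ∧ T.GoodSuccess n O :=
    (FinDep.isGood T n).comp₂ (FinDep.goodSuccess T n) fun a b => ¬ a ∨ a ∧ b
  let blocks : ℕ → Finset (List Bool) := fun m => (boolLists m ×ˢ Finset.range (n - 1)).image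
    fun p => p.1 ++ List.replicate p.2 true
  have hblocks : ∀ m, ∀ s : List Bool, s.length = m → ∀ i < n - 1,
      s ++ List.replicate i true ∈ blocks m := fun m s hs i hi =>
    Finset.mem_image.2 ⟨(s, i), by simp [hs, hi], rfl⟩
  -- The finite oracle must cover the support of the event and all strings hashed by the outer and
  -- the inner function.
  let W := W₀ ∪ (blocks (n + 1) ∪ blocks (3 * n + 1))
  refine (measure_mono (T.success_subset hn)).trans ?_
  rw [randomOracle_eq_pr (W := W) fun O O' h => hW₀ O O' fun q hq =>
    h q (Finset.mem_union_left _ hq)]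
  refine ENNReal.ofReal_le_ofReal ((pr_or_le _ _).trans ?_)
  have h1 := T.pr_not_isGood_le (W := W) n q hT fun s hs i hi => Finset.mem_union_right _
    (Finset.mem_union_left _ (hblocks _ s hs i hi))
  have h2 := T.pr_goodSuccess_le (W := W) n q hT fun s hs i hi => Finset.mem_union_right _
    (Finset.mem_union_right _ (hblocks _ s hs i hi))
  refine (add_le_add h1 h2).trans ?_
  have h0 : (0 : ℝ) < 2 ^ (n - 1) := by positivity
  have hq : (0 : ℝ) ≤ q := Nat.cast_nonneg q
  -- The middle term is `16 q² (q + 1)³`, and each of the other two is at most `(q + 2)⁵`; hence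
  -- `18`.
  have : (q * (q + 2) ^ 2 + (q * (q + 1)) * (2 * ((2 * q) * (2 * q + 2) ^ 2)) + (q + 2) ^ 2 : ℝ) ≤
      18 * (q + 2) ^ 5 := by
    generalize (q : ℝ) = r at hq
    ring_nf
    have := pow_nonneg hq 2
    have := pow_nonneg hq 3
    have := pow_nonneg hq 4
    have := pow_nonneg hq 5
    linarith
  calc _ = (q * (q + 2) ^ 2 + (q * (q + 1)) * (2 * ((2 * q) * (2 * q + 2) ^ 2)) + (q + 2) ^ 2 : ℝ) /
      2 ^ (n - 1) := by ring
    _ ≤ _ := by gcongr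

/-! ### Negligible success probability -/

theorem tendsto_polynomial_div_two_pow (p : Polynomial ℕ) :
    Tendsto (fun n : ℕ => ((p.eval n : ℕ) : ℝ) / 2 ^ n) atTop (𝓝 0) := by
  induction p using Polynomial.induction_on' with
  | add p q hp hq => simpa [add_div] using hp.add hq
  | monomial k a =>
    have := (tendsto_pow_const_div_const_pow_of_one_lt k (one_lt_two (α := ℝ))).const_mul (a : ℝ)
    simpa [mul_div_assoc] using this

theorem negligible_success (q : Polynomial ℕ) (T : ℕ → BlackBoxReduction)
    (hT : ∀ n, (T n).Bounded (q.eval n)) : Negligible fun n => randomOracle ((T n).Success n) := by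
  intro c
  -- The constant `36` is `2 · 18`, since `2ⁿ⁻¹` is replaced by `2ⁿ`.
  have h := ENNReal.tendsto_ofReal (tendsto_polynomial_div_two_pow
    (Polynomial.X ^ c * (36 * (q + 2) ^ 5)))
  rw [ENNReal.ofReal_zero] at h
  refine tendsto_of_tendsto_of_tendsto_of_le_of_le' tendsto_const_nhds h
    (Eventually.of_forall fun _ => zero_le) ?_
  filter_upwards [eventually_ge_atTop 1] with n hn
  refine (mul_le_mul_right ((T n).success_le hn _ (hT n)) _).trans_eq ?_
  rw [← ENNReal.ofReal_natCast n, ← ENNReal.ofReal_pow (by positivity),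
    ← ENNReal.ofReal_mul (by positivity)]
  congr 1
  obtain ⟨m, rfl⟩ := Nat.exists_eq_add_of_le' hn
  simp
  ring

/-- The measure of the intersection is at most each single success probability, and these tend to
zero. -/
theorem measure_iInter_success (q : Polynomial ℕ) (T : ℕ → BlackBoxReduction)
    (hT : ∀ n, (T n).Bounded (q.eval n)) : randomOracle (⋂ n, (T n).Success n) = 0 := by
  have h := negligible_success q T hT 0
  simp only [pow_zero, one_mul] at h
  exact le_antisymm (ge_of_tendsto' h fun n => measure_mono (Set.iInter_subset _ n)) zero_le

/-! ### Polynomial bounds -/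

/-- A cofinal family of polynomial bounds. -/
noncomputable def polyBound (c : ℕ) : Polynomial ℕ := Polynomial.C c * (Polynomial.X + 1) ^ c

@[simp] theorem eval_polyBound (c n : ℕ) : (polyBound c).eval n = c * (n + 1) ^ c := by
  simp [polyBound]

theorem polyBound_mono (c : ℕ) {m n : ℕ} (h : m ≤ n) :
    (polyBound c).eval m ≤ (polyBound c).eval n := by
  simp only [eval_polyBound]
  gcongr

theorem exists_polyBound (p : Polynomial ℕ) : ∃ c, ∀ n, p.eval n ≤ (polyBound c).eval n := by
  simp only [eval_polyBound]
  induction p using Polynomial.induction_on' with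
  | add p q hp hq =>
    obtain ⟨a, ha⟩ := hp
    obtain ⟨b, hb⟩ := hq
    refine ⟨a + b, fun n => ?_⟩
    rw [Polynomial.eval_add, add_mul]
    have h1 : (n + 1) ^ a ≤ (n + 1) ^ (a + b) := Nat.pow_le_pow_right (by omega) (by omega)
    have h2 : (n + 1) ^ b ≤ (n + 1) ^ (a + b) := Nat.pow_le_pow_right (by omega) (by omega)
    exact add_le_add ((ha n).trans (Nat.mul_le_mul_left _ h1))
      ((hb n).trans (Nat.mul_le_mul_left _ h2))
  | monomial k a =>
    refine ⟨a + k, fun n => ?_⟩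
    rw [Polynomial.eval_monomial]
    refine Nat.mul_le_mul (by omega) ?_
    exact (Nat.pow_le_pow_left (by omega) k).trans (Nat.pow_le_pow_right (by omega) (by omega))

/-! ### Programs as query computations -/

/-- The execution of at most `k` steps of a stack of programs as a query computation. -/
def simulate : ℕ → List (Prog Unit) → Store → QueryTree Store
  | _, [], σ => .done σ
  | 0, _ :: _, σ => .done σ
  | k + 1, .skip :: K, σ => simulate k K σ
  | k + 1, .push r b :: K, σ => simulate k K (Function.update σ r (b :: σ r))
  | k + 1, .pop r :: K, σ => simulate k K (Function.update σ r (σ r).tail)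
  | k + 1, .seq P Q :: K, σ => simulate k (P :: Q :: K) σ
  | k + 1, .branch r P Q R :: K, σ =>
    match σ r with
    | [] => simulate k (P :: K) σ
    | false :: _ => simulate k (Q :: K) σ
    | true :: _ => simulate k (R :: K) σ
  | k + 1, .loop r P :: K, σ =>
    match σ r with
    | [] => simulate k K σ
    | _ :: _ => simulate k (P :: .loop r P :: K) σ
  | k + 1, .query _ r :: K, σ => .ask (σ r) fun b => simulate k K (Function.update σ r [b])

theorem simulate_nil (k : ℕ) (σ : Store) : simulate k [] σ = .done σ := by
  cases k <;> rfl

theorem depth_simulate_le (k : ℕ) (K : List (Prog Unit)) (σ : Store) :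
    (simulate k K σ).depth ≤ k := by
  induction k generalizing K σ with
  | zero => cases K <;> simp [simulate, QueryTree.depth]
  | succ k ih =>
    match K with
    | [] => simp [simulate, QueryTree.depth]
    | .skip :: K => exact (ih _ _).trans (Nat.le_succ _)
    | .push r b :: K => exact (ih _ _).trans (Nat.le_succ _)
    | .pop r :: K => exact (ih _ _).trans (Nat.le_succ _)
    | .seq P Q :: K => exact (ih _ _).trans (Nat.le_succ _)
    | .branch r P Q R :: K =>
      simp only [simulate]
      split <;> exact (ih _ _).trans (Nat.le_succ _)
    | .loop r P :: K =>
      simp only [simulate]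
      split <;> exact (ih _ _).trans (Nat.le_succ _)
    | .query i r :: K =>
      simp only [simulate, QueryTree.depth]
      exact Nat.succ_le_succ (max_le (ih _ _) (ih _ _))

/-- Unpacking a sequential composition costs the simulation one step but costs the machine nothing.
The strict bound `s < 2 * t` leaves room for that step in the induction. The continuation `K` and
the spare fuel `k` are arbitrary so that simulations compose. -/
theorem Runs.exists_simulate {O : Oracle} {P : Prog Unit} {σ σ' : Store} {t : ℕ}
    {log : List (Unit × List Bool)} (h : Runs (fun _ q => [O q]) P σ t log σ') :
    ∃ s < 2 * t, ∀ K k, (simulate (s + k) (P :: K) σ).eval O = (simulate k K σ').eval O := by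
  induction h with
  | skip σ => exact ⟨1, by omega, fun K k => by rw [add_comm]; rfl⟩
  | push σ r b => exact ⟨1, by omega, fun K k => by rw [add_comm]; rfl⟩
  | pop σ r => exact ⟨1, by omega, fun K k => by rw [add_comm]; rfl⟩
  | seq _ _ ih1 ih2 =>
    obtain ⟨s, hs, h⟩ := ih1
    obtain ⟨s', hs', h'⟩ := ih2
    refine ⟨s + s' + 1, by omega, fun K k => ?_⟩
    rw [show s + s' + 1 + k = (s + (s' + k)) + 1 by ring, simulate, h, h']
  | branchNil hr _ ih =>
    obtain ⟨s, hs, h⟩ := ih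
    refine ⟨s + 1, by omega, fun K k => ?_⟩
    rw [show s + 1 + k = (s + k) + 1 by ring, simulate, hr, h]
  | @branchFalse r _ _ _ σ _ _ _ hr _ ih =>
    obtain ⟨s, hs, h⟩ := ih
    refine ⟨s + 1, by omega, fun K k => ?_⟩
    rw [show s + 1 + k = (s + k) + 1 by ring, simulate]
    cases hσ : σ r with
    | nil => simp [hσ] at hr
    | cons a l =>
      obtain rfl : a = false := by simpa [hσ] using hr
      exact h K k
  | @branchTrue r _ _ _ σ _ _ _ hr _ ih =>
    obtain ⟨s, hs, h⟩ := ih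
    refine ⟨s + 1, by omega, fun K k => ?_⟩
    rw [show s + 1 + k = (s + k) + 1 by ring, simulate]
    cases hσ : σ r with
    | nil => simp [hσ] at hr
    | cons a l =>
      obtain rfl : a = true := by simpa [hσ] using hr
      exact h K k
  | loopNil hr =>
    refine ⟨1, by omega, fun K k => ?_⟩
    rw [add_comm, simulate, hr]
  | @loopCons r _ σ _ _ _ _ _ _ hr _ _ ih1 ih2 =>
    obtain ⟨s, hs, h⟩ := ih1
    obtain ⟨s', hs', h'⟩ := ih2
    refine ⟨s + s' + 1, by omega, fun K k => ?_⟩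
    rw [show s + s' + 1 + k = (s + (s' + k)) + 1 by ring, simulate]
    cases hσ : σ r with
    | nil => exact absurd hσ hr
    | cons a l =>
      dsimp only
      rw [h, h']
  | query σ i r => exact ⟨1, by omega, fun K k => by rw [add_comm]; rfl⟩

theorem Runs.eval_simulate {O : Oracle} {P : Prog Unit} {σ σ' : Store} {t : ℕ}
    {log : List (Unit × List Bool)} (h : Runs (fun _ q => [O q]) P σ t log σ') {k : ℕ}
    (hk : t ≤ k) : (simulate (2 * k) [P] σ).eval O = σ' := by
  obtain ⟨s, hs, h'⟩ := h.exists_simulate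
  obtain ⟨m, hm⟩ := Nat.exists_eq_add_of_le (show s ≤ 2 * k by omega)
  rw [hm, h', simulate_nil]
  rfl

/-- A push lengthens a register by one, and the cost of a query includes the length of the answer.
-/
theorem Runs.length_le {ι : Type} {ora : ι → List Bool → List Bool} {P : Prog ι} {σ σ' : Store}
    {t : ℕ} {log : List (ι × List Bool)} (h : Runs ora P σ t log σ') {M : ℕ}
    (hM : ∀ r, (σ r).length ≤ M) (r : ℕ) : (σ' r).length ≤ M + t := by
  induction h generalizing M r with
  | skip σ => exact (hM r).trans (by omega)
  | push σ s b =>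
    by_cases hr : r = s
    · subst hr
      simpa using hM r
    · simpa [hr] using (hM r).trans (Nat.le_succ _)
  | pop σ s =>
    by_cases hr : r = s
    · subst hr
      have := hM r
      simp
      omega
    · simpa [hr] using (hM r).trans (Nat.le_succ _)
  | seq _ _ ih1 ih2 => exact (ih2 (ih1 hM) r).trans (by omega)
  | branchNil _ _ ih => exact (ih hM r).trans (by omega)
  | branchFalse _ _ ih => exact (ih hM r).trans (by omega)
  | branchTrue _ _ ih => exact (ih hM r).trans (by omega)
  | loopNil _ => exact (hM r).trans (by omega)
  | loopCons _ _ _ ih1 ih2 => exact (ih2 (ih1 hM) r).trans (by omega)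
  | query σ i s =>
    by_cases hr : r = s
    · subst hr
      simp
      omega
    · simpa [hr] using (hM r).trans (by omega)

theorem countable_prog : Countable (Prog Unit) := by
  -- The programs of nesting depth at most `n`.
  let S : ℕ → Set (Prog Unit) := fun n => Nat.rec ∅ (fun _ A =>
    {.skip} ∪ Set.range (fun p : ℕ × Bool => .push p.1 p.2) ∪ Set.range .pop ∪
      Set.image2 .seq A A ∪ (fun p : ℕ × Prog Unit × Prog Unit × Prog Unit =>
        .branch p.1 p.2.1 p.2.2.1 p.2.2.2) '' (Set.univ ×ˢ A ×ˢ A ×ˢ A) ∪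
      Set.image2 .loop Set.univ A ∪ Set.range (.query ())) n
  have hS : ∀ n, (S n).Countable := by
    intro n
    induction n with
    | zero => exact Set.countable_empty
    | succ n ih =>
      exact ((((((Set.countable_singleton _).union (Set.countable_range _)).union
        (Set.countable_range _)).union (ih.image2 ih _)).union
        ((Set.countable_univ.prod (ih.prod (ih.prod ih))).image _)).union
        (Set.countable_univ.image2 ih _)).union (Set.countable_range _)
  have hmono : Monotone S := monotone_nat_of_le_succ fun n => by
    induction n with
    | zero => exact Set.empty_subset _
    | succ n ih =>
      exact Set.union_subset_union_left _ (Set.union_subset_union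
        (Set.union_subset_union (Set.union_subset_union_right _ (Set.image2_subset ih ih))
          (Set.image_mono (Set.prod_mono subset_rfl (Set.prod_mono ih (Set.prod_mono ih ih)))))
        (Set.image2_subset subset_rfl ih))
  have hmem : ∀ P : Prog Unit, ∃ n, P ∈ S n := by
    intro P
    induction P with
    | skip => exact ⟨1, by simp [S]⟩
    | push r b => exact ⟨1, by simp [S]⟩
    | pop r => exact ⟨1, by simp [S]⟩
    | query i r => exact ⟨1, by simp [S]⟩
    | seq P Q h1 h2 =>
      obtain ⟨a, ha⟩ := h1
      obtain ⟨b, hb⟩ := h2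
      exact ⟨a + b + 1, .inl (.inl (.inl (.inr ⟨P, hmono (by omega) ha, Q, hmono (by omega) hb,
        rfl⟩)))⟩
    | branch r P Q R h1 h2 h3 =>
      obtain ⟨a, ha⟩ := h1
      obtain ⟨b, hb⟩ := h2
      obtain ⟨c, hc⟩ := h3
      exact ⟨a + b + c + 1, .inl (.inl (.inr ⟨(r, P, Q, R), ⟨trivial, hmono (by omega) ha,
        hmono (by omega) hb, hmono (by omega) hc⟩, rfl⟩))⟩
    | loop r P h1 =>
      obtain ⟨a, ha⟩ := h1
      exact ⟨a + 1, .inl (.inr ⟨r, trivial, P, ha, rfl⟩)⟩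
  rw [← Set.countable_univ_iff]
  exact (Set.countable_iUnion hS).mono fun P _ => Set.mem_iUnion.2 (hmem P)

/-! ### The size of the random instances -/

theorem length_encList_le {α : Type} (enc : α → List Bool) (l : List α) (M : ℕ)
    (h : ∀ a ∈ l, (enc a).length ≤ M) : (encList enc l).length ≤ l.length * (M + 1) + 1 := by
  induction l with
  | nil => simp [encList]
  | cons a l ih =>
    have h1 := h a (by simp)
    have h2 := ih fun b hb => h b (by simp [hb])
    rw [encList_cons]
    simp only [List.length_cons, List.length_append, add_mul]
    omega

/-- A common bound for both random circuits: `m` is the parameter of the instance and `n` the number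
of inputs, which is `m` or `3m`. -/
theorem length_code_random_le (n m k : ℕ) (hk : k ≤ m) (hn : n ≤ 3 * m)
    (args : ℕ → List ℕ) (hargs : ∀ i < k, (args i).length ≤ 4 * m + 1 ∧
      ∀ a ∈ args i, a ≤ 3 * m + 1) (C : Circuit) (hC : C = ⟨n, [.const false, .const true] ++
        (List.range k).map fun i => .oracle (args i), (List.range k).map fun i => n + 2 + i⟩) :
    C.code.length ≤ 50 * (m + 1) ^ 3 := by
  have h1 : (encList Gate.code C.gates).length ≤
      (k + 2) * ((4 * m + 1) * (3 * m + 3) + 3 + 1) + 1 := by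
    refine (length_encList_le _ _ ((4 * m + 1) * (3 * m + 3) + 3) ?_).trans (by
      simp [hC])
    intro g hg
    simp only [hC, List.mem_append, List.mem_cons, List.not_mem_nil, or_false, List.mem_map,
      List.mem_range] at hg
    rcases hg with (rfl | rfl) | ⟨i, hi, rfl⟩
    · simp [Gate.code]
    · simp [Gate.code]
    · have := length_encList_le encNat (args i) (3 * m + 2) fun a ha => by
        have := (hargs i hi).2 a ha
        simp [encNat]
        omega
      have h2 : (args i).length * (3 * m + 2 + 1) ≤ (4 * m + 1) * (3 * m + 3) :=
        Nat.mul_le_mul_right (3 * m + 2 + 1) (hargs i hi).1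
      simp only [Gate.code, List.length_append, List.length_cons, List.length_nil]
      omega
  have h2 : (encList encNat C.outputs).length ≤ k * (4 * m + 3 + 1) + 1 := by
    refine (length_encList_le _ _ (4 * m + 3) ?_).trans (by simp [hC])
    intro a ha
    simp only [hC, List.mem_map, List.mem_range] at ha
    obtain ⟨i, hi, rfl⟩ := ha
    simp [encNat]
    omega
  have h3 : C.code.length = n + 1 + (encList Gate.code C.gates).length +
      (encList encNat C.outputs).length := by
    simp [Circuit.code, encNat, hC]
    omega
  have h4 : (k + 2) * ((4 * m + 1) * (3 * m + 3) + 3 + 1) ≤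
      (m + 2) * ((4 * m + 1) * (3 * m + 3) + 3 + 1) := Nat.mul_le_mul_right _ (by omega)
  have h5 : k * (4 * m + 3 + 1) ≤ m * (4 * m + 3 + 1) := Nat.mul_le_mul_right _ hk
  have h6 : 3 * m + 1 + ((m + 2) * ((4 * m + 1) * (3 * m + 3) + 3 + 1) + 1) +
      (m * (4 * m + 3 + 1) + 1) ≤ 50 * (m + 1) ^ 3 := by
    ring_nf
    have := Nat.zero_le (m ^ 2)
    have := Nat.zero_le (m ^ 3)
    omega
  omega

theorem length_randomInstance_le (n : ℕ) : (randomInstance n).length ≤ 100 * (n + 1) ^ 3 := by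
  have h1 := length_code_random_le n n (n - 1) (by omega) (by omega)
    (fun i => n :: List.range n ++ List.replicate i (n + 1)) (fun i hi => by
      refine ⟨by simp; omega, fun a ha => ?_⟩
      simp only [List.mem_append, List.mem_cons, List.mem_range, List.mem_replicate] at ha
      omega) (randomF n) rfl
  have h2 := length_code_random_le (3 * n) n (n - 1) (by omega) (by omega)
    (fun i => (3 * n + 1) :: List.range (3 * n) ++ List.replicate i (3 * n + 1)) (fun i hi => by
      refine ⟨by simp; omega, fun a ha => ?_⟩
      simp only [List.mem_append, List.mem_cons, List.mem_range, List.mem_replicate] at ha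
      omega) (randomG n) rfl
  rw [randomInstance, List.length_append]
  omega

/-! ### Polynomial-time reductions as black-box reductions -/

theorem Collision.length_le {O : Oracle} {s t : List Bool} (h : Collision O s t) :
    t.length ≤ 2 * s.length := by
  rcases h with ⟨C, rfl, -, x, y, rfl, hx, hy, -⟩ | ⟨-, rfl⟩
  · have := C.inputs_add_length_gates_le
    simp only [List.length_append]
    omega
  · simp

theorem QueryTree.depth_bind_done {α β : Type} (T : QueryTree α) (f : α → β) :
    (T.bind fun a => .done (f a)).depth = T.depth := by
  induction T with
  | done a => rfl
  | ask q next ih => simp [bind, depth, ih]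

/-- The black-box reduction at instance `x` given by the programs `P` and `Q`, where `D` decodes
the list of search queries from the output of `P`, and `E` encodes the list of answers
for `Q`. -/
noncomputable def programReduction (D : List Bool → List (List Bool))
    (E : List (List Bool) → List Bool) (P Q : Prog Unit) (x : List Bool) (k B k' A : ℕ) :
    BlackBoxReduction :=
  (simulate (2 * k) [P] (load [x])).bind fun σ => .done
    -- The size bounds must hold for every oracle and all answers, but the programs are known to
    -- obey theirs only relative to the oracle for which they form a reduction. Hence the
    -- truncations.
    (if (encStrings (D (σ 0))).length ≤ B then D (σ 0) else [], fun answers =>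
      if (E answers).length ≤ A then
        (simulate (2 * k') [Q] (load [x, E answers])).bind fun σ' => .done (σ' 0)
      else .done [])

theorem programReduction_bounded (D : List Bool → List (List Bool))
    (E : List (List Bool) → List Bool) (P Q : Prog Unit) (x : List Bool) (k B k' A q : ℕ)
    (hq : 2 * k ≤ q) (hq' : 2 * k' ≤ q) (hB : B ≤ q) (h1 : 1 ≤ q) :
    (programReduction D E P Q x k B k' A).Bounded q := by
  refine ⟨?_, fun O => ⟨?_, fun answers => ?_⟩⟩
  · rw [programReduction, QueryTree.depth_bind_done]
    exact (depth_simulate_le _ _ _).trans hq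
  · simp only [programReduction, QueryTree.eval_bind, QueryTree.eval]
    split_ifs with h
    · exact h.trans hB
    · simpa [encStrings, encList] using h1
  · simp only [programReduction, QueryTree.eval_bind, QueryTree.eval]
    split_ifs with h
    · rw [QueryTree.depth_bind_done]
      exact (depth_simulate_le _ _ _).trans hq'
    · simp [QueryTree.depth]

/-- The size of the random instances, the size of the search queries, the size of the answers and
the running time of the postprocessing for programs with time bounds `polyBound c` and
`polyBound d`. -/
noncomputable def instanceBound : Polynomial ℕ := 100 * (Polynomial.X + 1) ^ 3

/-- A bound for the size of the search queries. -/
noncomputable def queryBound (c : ℕ) : Polynomial ℕ :=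
  -- The inner sum bounds the length of the output of the first program. A single string of length
  -- `ℓ` has an encoding of length `2ℓ + 3`, which is the worst case used here.
  2 * (instanceBound + (polyBound c).comp instanceBound) + 3

/-- A bound for the running time of the postprocessing. -/
noncomputable def postBound (c d : ℕ) : Polynomial ℕ :=
  (polyBound d).comp (instanceBound + 2 * queryBound c)

/-- The black-box reductions given by two programs with polynomial time bounds. -/
noncomputable def polyReduction (D : List Bool → List (List Bool))
    (E : List (List Bool) → List Bool) (P Q : Prog Unit) (c d n : ℕ) : BlackBoxReduction :=
  programReduction D E P Q (randomInstance n) (((polyBound c).comp instanceBound).eval n)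
    ((queryBound c).eval n) ((postBound c d).eval n) (2 * (queryBound c).eval n)

theorem measure_polyReduction (D : List Bool → List (List Bool))
    (E : List (List Bool) → List Bool) (P Q : Prog Unit) (c d : ℕ) :
    randomOracle (⋂ n, (polyReduction D E P Q c d n).Success n) = 0 := by
  refine measure_iInter_success (2 * (polyBound c).comp instanceBound + 2 * postBound c d +
    queryBound c + 1) _ fun n => programReduction_bounded _ _ _ _ _ _ _ _ _ _ ?_ ?_ ?_ ?_ <;>
  · simp only [Polynomial.eval_add, Polynomial.eval_mul, Polynomial.eval_ofNat,
      Polynomial.eval_one]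
    omega

/-- A reduction computed by two polynomial-time programs solves the random instances. -/
theorem mem_success_polyReduction {O : Oracle} {D : List Bool → List (List Bool)}
    {E : List (List Bool) → List Bool} {f : List Bool → List Bool}
    {g : List Bool → List Bool → List Bool} {P Q : Prog Unit} {c d : ℕ}
    (hP : ∀ x, ∃ t log σ, Runs (fun _ q => [O q]) P (load [x]) t log σ ∧ σ 0 = f x ∧
      t ≤ (polyBound c).eval x.length)
    (hQ : ∀ x y, ∃ t log σ, Runs (fun _ q => [O q]) Q (load [x, y]) t log σ ∧ σ 0 = g x y ∧
      t ≤ (polyBound d).eval (x.length + y.length))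
    (hD : ∀ x, (encStrings (D (f x))).length ≤ 2 * (f x).length + 3)
    (hE : ∀ x S, Solves S (Collision O) → (E ((D (f x)).map S)).length ≤
      2 * (encStrings (D (f x))).length)
    (hred : ∀ S, Solves S (Collision O) → ∀ x,
      NestedCollision O x (g x (E ((D (f x)).map S)))) (n : ℕ) :
    O ∈ (polyReduction D E P Q c d n).Success n := by
  intro S hS
  have hx : (randomInstance n).length ≤ instanceBound.eval n := by
    simpa [instanceBound] using length_randomInstance_le n
  obtain ⟨t, log, σ, h1, h2, h3⟩ := hP (randomInstance n)
  have ht : t ≤ ((polyBound c).comp instanceBound).eval n := by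
    rw [Polynomial.eval_comp]
    exact h3.trans (polyBound_mono c hx)
  have hσ : (σ 0).length ≤ (randomInstance n).length + t := h1.length_le (fun r => by
    cases r <;> simp [load]) 0
  have hB : (encStrings (D (f (randomInstance n)))).length ≤ (queryBound c).eval n := by
    refine (hD _).trans ?_
    rw [h2] at hσ
    simp only [queryBound, Polynomial.eval_add, Polynomial.eval_mul, Polynomial.eval_ofNat]
    omega
  have hA := (hE (randomInstance n) S hS).trans (Nat.mul_le_mul_left 2 hB)
  obtain ⟨t', log', σ', h1', h2', h3'⟩ := hQ (randomInstance n)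
    (E ((D (f (randomInstance n))).map S))
  have ht' : t' ≤ (postBound c d).eval n := by
    refine h3'.trans ?_
    rw [postBound, Polynomial.eval_comp]
    refine polyBound_mono d ?_
    simp only [Polynomial.eval_add, Polynomial.eval_mul, Polynomial.eval_ofNat]
    omega
  rw [BlackBoxReduction.output]
  simp only [polyReduction, programReduction, QueryTree.eval_bind, QueryTree.eval,
    h1.eval_simulate ht, h2, if_pos hB, if_pos hA, h1'.eval_simulate ht', h2']
  exact hred S hS _

/-- There are countably many quadruples `(P, Q, c, d)`, and for each of them success on all random
instances is a null event. -/
theorem ae_not_reduction (D : List Bool → List (List Bool)) (E : List (List Bool) → List Bool) :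
    ∀ᵐ O ∂randomOracle, ∀ P Q c d, ∃ n, O ∉ (polyReduction D E P Q c d n).Success n := by
  have := countable_prog
  simp only [ae_all_iff]
  intro P Q c d
  have h := measure_polyReduction D E P Q c d
  rw [ae_iff]
  convert h using 2
  ext O
  simp

theorem length_encStrings_map_le {O : Oracle} {S : List Bool → List Bool}
    (hS : Solves S (Collision O)) (l : List (List Bool)) :
    (encStrings (l.map S)).length ≤ 2 * (encStrings l).length := by
  induction l with
  | nil => simp [encStrings, encList]
  | cons s l ih =>
    have := (hS s).length_le
    rw [length_encStrings] at ih ⊢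
    rw [length_encStrings] at ih ⊢
    simp only [List.map_cons, List.sum_cons]
    omega

/-- The list of queries is decoded by an arbitrary left inverse of the encoding. Black-box
reductions are limited in queries only, so the decoding need not be efficient. -/
theorem ae_not_nonAdaptiveReducible :
    ∀ᵐ O ∂randomOracle, ¬ NonAdaptiveReducible O (NestedCollision O) (Collision O) := by
  filter_upwards [ae_not_reduction (Function.invFun encStrings) encStrings] with O hO
  rintro ⟨f, g, ⟨P, p, hP⟩, ⟨Q, q, hQ⟩, hred⟩
  obtain ⟨c, hc⟩ := exists_polyBound p
  obtain ⟨d, hd⟩ := exists_polyBound q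
  obtain ⟨n, hn⟩ := hO P Q c d
  have hinv : ∀ l, Function.invFun encStrings (encStrings l) = l :=
    Function.leftInverse_invFun encStrings_injective
  refine hn (mem_success_polyReduction (f := fun x => encStrings (f x)) (g := g) ?_ ?_ ?_ ?_ ?_ n)
  · intro x
    obtain ⟨t, log, σ, h1, h2, h3⟩ := hP x
    exact ⟨t, log, σ, h1, h2, h3.trans (hc _)⟩
  · intro x y
    obtain ⟨t, log, σ, h1, h2, h3⟩ := hQ x y
    exact ⟨t, log, σ, h1, h2, h3.trans (hd _)⟩
  · intro x
    rw [hinv]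
    omega
  · intro x S hS
    rw [hinv]
    exact length_encStrings_map_le hS _
  · intro S hS x
    rw [hinv]
    exact hred S hS x

/-- A many-one reduction is treated as a list of one query with the bare answer. Handling it
directly avoids programming the encodings of one-element lists. -/
theorem ae_not_manyOneReducible :
    ∀ᵐ O ∂randomOracle, ¬ ManyOneReducible O (NestedCollision O) (Collision O) := by
  filter_upwards [ae_not_reduction (fun s => [s]) (fun l => l.headD [])] with O hO
  rintro ⟨f, g, ⟨P, p, hP⟩, ⟨Q, q, hQ⟩, hred⟩
  obtain ⟨c, hc⟩ := exists_polyBound p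
  obtain ⟨d, hd⟩ := exists_polyBound q
  obtain ⟨n, hn⟩ := hO P Q c d
  refine hn (mem_success_polyReduction (f := f) (g := g) ?_ ?_ ?_ ?_ ?_ n)
  · intro x
    obtain ⟨t, log, σ, h1, h2, h3⟩ := hP x
    exact ⟨t, log, σ, h1, h2, h3.trans (hc _)⟩
  · intro x y
    obtain ⟨t, log, σ, h1, h2, h3⟩ := hQ x y
    exact ⟨t, log, σ, h1, h2, h3.trans (hd _)⟩
  · intro x
    simp [length_encStrings]
  · intro x S hS
    have := (hS (f x)).length_le
    simp [length_encStrings]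
    omega
  · intro S hS x
    exact hred _ _ (hS _)

/-! ### Execution of programs within a time bound -/

section Exec

variable {ι : Type} {ora : ι → List Bool → List Bool} {i₀ : ι}

/-- The program `P` transforms `σ` into `σ'` within `T` steps, and queries only the oracle `i₀`. -/
def Exec (ora : ι → List Bool → List Bool) (i₀ : ι) (P : Prog ι) (σ : Store) (T : ℕ)
    (σ' : Store) : Prop :=
  ∃ t ≤ T, ∃ log, Runs ora P σ t log σ' ∧ ∀ e ∈ log, e.1 = i₀

namespace Exec

variable {P Q R : Prog ι} {σ σ' σ'' : Store} {T T' : ℕ}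

theorem mono (h : Exec ora i₀ P σ T σ') (hT : T ≤ T') : Exec ora i₀ P σ T' σ' := by
  obtain ⟨t, ht, log, h⟩ := h
  exact ⟨t, ht.trans hT, log, h⟩

theorem skip (σ : Store) : Exec ora i₀ .skip σ 1 σ := ⟨1, le_rfl, [], .skip σ, by simp⟩

theorem push (σ : Store) (r : ℕ) (b : Bool) :
    Exec ora i₀ (.push r b) σ 1 (Function.update σ r (b :: σ r)) :=
  ⟨1, le_rfl, [], .push σ r b, by simp⟩

theorem pop (σ : Store) (r : ℕ) :
    Exec ora i₀ (.pop r) σ 1 (Function.update σ r (σ r).tail) :=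
  ⟨1, le_rfl, [], .pop σ r, by simp⟩

theorem query (σ : Store) (r : ℕ) :
    Exec ora i₀ (.query i₀ r) σ (1 + (σ r).length + (ora i₀ (σ r)).length)
      (Function.update σ r (ora i₀ (σ r))) :=
  ⟨_, le_rfl, _, .query σ i₀ r, by simp⟩

theorem seq (h : Exec ora i₀ P σ T σ') (h' : Exec ora i₀ Q σ' T' σ'') :
    Exec ora i₀ (.seq P Q) σ (T + T') σ'' := by
  obtain ⟨t, ht, log, h, hl⟩ := h
  obtain ⟨t', ht', log', h', hl'⟩ := h'
  refine ⟨t + t', by omega, _, .seq h h', fun e he => ?_⟩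
  exact (List.mem_append.1 he).elim (hl e) (hl' e)

theorem branchNil {r : ℕ} (hr : σ r = []) (h : Exec ora i₀ P σ T σ') :
    Exec ora i₀ (.branch r P Q R) σ (T + 1) σ' := by
  obtain ⟨t, ht, log, h, hl⟩ := h
  exact ⟨t + 1, by omega, log, .branchNil hr h, hl⟩

theorem branchFalse {r : ℕ} {l : List Bool} (hr : σ r = false :: l) (h : Exec ora i₀ Q σ T σ') :
    Exec ora i₀ (.branch r P Q R) σ (T + 1) σ' := by
  obtain ⟨t, ht, log, h, hl⟩ := h
  exact ⟨t + 1, by omega, log, .branchFalse (by simp [hr]) h, hl⟩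

theorem branchTrue {r : ℕ} {l : List Bool} (hr : σ r = true :: l) (h : Exec ora i₀ R σ T σ') :
    Exec ora i₀ (.branch r P Q R) σ (T + 1) σ' := by
  obtain ⟨t, ht, log, h, hl⟩ := h
  exact ⟨t + 1, by omega, log, .branchTrue (by simp [hr]) h, hl⟩

theorem loopNil {r : ℕ} (hr : σ r = []) : Exec ora i₀ (.loop r P) σ 1 σ :=
  ⟨1, le_rfl, [], .loopNil hr, by simp⟩

theorem loopCons {r : ℕ} (hr : σ r ≠ []) (h : Exec ora i₀ P σ T σ')
    (h' : Exec ora i₀ (.loop r P) σ' T' σ'') : Exec ora i₀ (.loop r P) σ (T + T' + 1) σ'' := by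
  obtain ⟨t, ht, log, h, hl⟩ := h
  obtain ⟨t', ht', log', h', hl'⟩ := h'
  refine ⟨t + t' + 1, by omega, _, .loopCons hr h h', fun e he => ?_⟩
  exact (List.mem_append.1 he).elim (hl e) (hl' e)

end Exec

/-! ### Macro instructions -/

/-- Pushes the bits of a list, the first one first. -/
def pushList (d : ℕ) : List Bool → Prog ι
  | [] => .skip
  | b :: l => .seq (.push d b) (pushList d l)

/-- Empties the register `r`. -/
def clearProg (r : ℕ) : Prog ι := .loop r (.pop r)

/-- Moves the content of the register `r` to the top of the register `d`, bit by bit, and replaces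
every bit `b` by the bits `φ b`. -/
def pourProg (φ : Bool → List Bool) (r d : ℕ) : Prog ι :=
  .loop r (.seq (.branch r .skip (pushList d (φ false)) (pushList d (φ true))) (.pop r))

/-- Moves the content of the register `r` to the top of the registers `a` and `d`, bit by bit. -/
def forkProg (r a d : ℕ) : Prog ι :=
  .loop r (.seq (.branch r .skip (.seq (.push a false) (.push d false))
    (.seq (.push a true) (.push d true))) (.pop r))

/-- Pushes a bit to `f` for every difference of the contents of the registers `a` and `b`, and
empties them. -/
def diffProg (a b f : ℕ) : Prog ι :=
  .seq (.loop a (.seq (.branch a .skip (.branch b (.push f true) .skip (.push f true))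
      (.branch b (.push f true) (.push f true) .skip)) (.seq (.pop a) (.pop b))))
    (.seq (.branch b .skip (.push f true) (.push f true)) (clearProg b))

/-- The number of bits that `diffProg` pushes. -/
def diffCount : List Bool → List Bool → ℕ
  | [], [] => 0
  | [], _ :: _ => 1
  | _ :: l, [] => diffCount l [] + 1
  | a :: l, b :: l' => diffCount l l' + if a = b then 0 else 1

theorem diffCount_eq_zero {l l' : List Bool} : diffCount l l' = 0 ↔ l = l' := by
  induction l generalizing l' with
  | nil => cases l' <;> simp [diffCount]
  | cons a l ih =>
    cases l' with
    | nil => simp [diffCount]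
    | cons b l' => simp [diffCount, ih, and_comm]

theorem diffCount_le (l l' : List Bool) : diffCount l l' ≤ l.length + 1 := by
  induction l generalizing l' with
  | nil => cases l' <;> simp [diffCount]
  | cons a l ih =>
    cases l' with
    | nil =>
      have := ih []
      simp only [diffCount, List.length_cons]
      omega
    | cons b l' =>
      have := ih l'
      simp only [diffCount, List.length_cons]
      split_ifs <;> omega

theorem exec_pushList (σ : Store) (d : ℕ) (l : List Bool) :
    Exec ora i₀ (pushList d l) σ (l.length + 1) (Function.update σ d (l.reverse ++ σ d)) := by
  induction l generalizing σ with
  | nil => simpa [pushList] using Exec.skip σ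
  | cons b l ih =>
    have h := ((Exec.push σ d b).seq (ih _)).mono (T' := (b :: l).length + 1) (by simp; omega)
    simpa [pushList] using h

theorem exec_clear (σ : Store) (r : ℕ) :
    Exec ora i₀ (clearProg r) σ (2 * (σ r).length + 1) (Function.update σ r []) := by
  generalize hl : σ r = l
  induction l generalizing σ with
  | nil =>
    have : Function.update σ r [] = σ := by simp [← hl]
    rw [this]
    exact (Exec.loopNil hl).mono (by simp)
  | cons b l ih =>
    have h := Exec.loopCons (by simp [hl]) (Exec.pop σ r) (ih (Function.update σ r (σ r).tail)
      (by simp [hl]))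
    rw [Function.update_idem] at h
    exact h.mono (by simp; omega)

theorem exec_pour (φ : Bool → List Bool) {r d : ℕ} (hrd : r ≠ d) (σ : Store) :
    Exec ora i₀ (pourProg φ r d) σ
      ((σ r).length * ((φ false).length + (φ true).length + 4) + 1)
      (Function.update (Function.update σ d (((σ r).flatMap φ).reverse ++ σ d)) r []) := by
  generalize hl : σ r = l
  induction l generalizing σ with
  | nil =>
    have : Function.update (Function.update σ d ((([] : List Bool).flatMap φ).reverse ++ σ d)) r []
        = σ := by
      funext s
      by_cases hs : s = r
      · simp [hs, hl]
      · simp [hs]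
    rw [this]
    exact (Exec.loopNil hl).mono (by simp)
  | cons b l ih =>
    have h1 : Exec ora i₀ (.branch r .skip (pushList d (φ false)) (pushList d (φ true))) σ
        ((φ b).length + 1 + 1) (Function.update σ d ((φ b).reverse ++ σ d)) := by
      cases b
      · exact Exec.branchFalse hl (exec_pushList σ d _)
      · exact Exec.branchTrue hl (exec_pushList σ d _)
    have h := Exec.loopCons (by simp [hl]) (h1.seq (Exec.pop _ r)) (ih _ (by simp [hrd, hl]))
    have e : ∀ v w : List Bool, Function.update (Function.update (Function.update
        (Function.update σ d v) r w) d (((l.flatMap φ).reverse) ++ v)) r [] =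
        Function.update (Function.update σ d ((l.flatMap φ).reverse ++ v)) r [] := by
      intro v w
      funext s
      by_cases hs : s = r
      · simp [hs]
      · by_cases hs' : s = d
        · subst hs'
          simp [hs]
        · simp [hs, hs']
    simp only [Function.update_of_ne hrd, Function.update_of_ne hrd.symm, Function.update_self,
      e] at h
    have e' : (l.flatMap φ).reverse ++ ((φ b).reverse ++ σ d) =
        ((b :: l).flatMap φ).reverse ++ σ d := by simp
    rw [e'] at h
    refine Exec.mono h ?_
    have : (φ b).length ≤ (φ false).length + (φ true).length := by cases b <;> omega
    rw [List.length_cons, Nat.add_mul]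
    omega

theorem exec_fork {r a d : ℕ} (hra : r ≠ a) (hrd : r ≠ d) (had : a ≠ d) (σ : Store) :
    Exec ora i₀ (forkProg r a d) σ ((σ r).length * 5 + 1)
      (Function.update (Function.update (Function.update σ a ((σ r).reverse ++ σ a)) d
        ((σ r).reverse ++ σ d)) r []) := by
  generalize hl : σ r = l
  induction l generalizing σ with
  | nil =>
    have : Function.update (Function.update (Function.update σ a (([] : List Bool).reverse ++ σ a))
        d (([] : List Bool).reverse ++ σ d)) r [] = σ := by
      funext s
      by_cases hs : s = r
      · simp [hs, hl]
      · simp [hs]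
    rw [this]
    exact (Exec.loopNil hl).mono (by simp)
  | cons b l ih =>
    have h1 : Exec ora i₀ (.branch r .skip (.seq (.push a false) (.push d false))
        (.seq (.push a true) (.push d true))) σ 3
        (Function.update (Function.update σ a (b :: σ a)) d (b :: σ d)) := by
      cases b
      · have h := Exec.branchFalse (P := .skip) (R := .seq (.push a true) (.push d true)) hl
          ((Exec.push (ora := ora) (i₀ := i₀) σ a false).seq (Exec.push _ d false))
        rwa [Function.update_of_ne had.symm] at h
      · have h := Exec.branchTrue (P := .skip) (Q := .seq (.push a false) (.push d false)) hl
          ((Exec.push (ora := ora) (i₀ := i₀) σ a true).seq (Exec.push _ d true))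
        rwa [Function.update_of_ne had.symm] at h
    have h := Exec.loopCons (by simp [hl]) (h1.seq (Exec.pop _ r)) (ih _ (by simp [hrd, hra, hl]))
    refine Exec.mono (T := 3 + 1 + (l.length * 5 + 1) + 1) ?_ (by simp; omega)
    rw [forkProg]
    convert h using 1
    funext s
    by_cases hs : s = r
    · simp [hs]
    · by_cases hs' : s = d
      · subst hs'
        simp [hs]
      · by_cases hs'' : s = a
        · subst hs''
          simp [hs, hs']
        · simp [hs, hs', hs'']

theorem exec_diff {a b f : ℕ} (hab : a ≠ b) (haf : a ≠ f) (hbf : b ≠ f) (σ : Store) :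
    Exec ora i₀ (diffProg a b f) σ ((σ a).length * 6 + 2 * (σ b).length + 4)
      (Function.update (Function.update (Function.update σ f
        (List.replicate (diffCount (σ a) (σ b)) true ++ σ f)) a []) b []) := by
  -- Here `l'` is what remains in `b` when `a` is exhausted. The loop counts all differences except
  -- the one that a non-empty `l'` stands for, which is added by the final branch.
  suffices h : ∀ l : List Bool, ∀ σ : Store, σ a = l → ∃ l' : List Bool,
      l'.length ≤ (σ b).length ∧
      Exec ora i₀ (.loop a (.seq (.branch a .skip (.branch b (.push f true) .skip (.push f true))
        (.branch b (.push f true) (.push f true) .skip)) (.seq (.pop a) (.pop b)))) σ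
        (l.length * 6 + 1) (Function.update (Function.update (Function.update σ a []) b l') f
          (List.replicate (diffCount l (σ b) - diffCount [] l') true ++ σ f)) ∧
      diffCount [] l' ≤ diffCount l (σ b) by
    obtain ⟨l', hl', h1, h2⟩ := h _ σ rfl
    have h3 : Exec ora i₀ (.branch b .skip (.push f true) (.push f true))
        (Function.update (Function.update (Function.update σ a []) b l') f
          (List.replicate (diffCount (σ a) (σ b) - diffCount [] l') true ++ σ f)) 2
        (Function.update (Function.update (Function.update σ a []) b l') f
          (List.replicate (diffCount (σ a) (σ b)) true ++ σ f)) := by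
      cases l' with
      | nil =>
        refine Exec.branchNil (by simp [hbf]) ?_
        simpa [diffCount] using Exec.skip _
      | cons c l' =>
        have e : List.replicate (diffCount (σ a) (σ b)) true ++ σ f =
            true :: (List.replicate (diffCount (σ a) (σ b) - diffCount [] (c :: l')) true ++ σ f) := by
          simp only [diffCount] at h2 ⊢
          obtain ⟨k, hk⟩ := Nat.exists_eq_add_of_le' h2
          simp [hk, List.replicate_succ]
        have h := Exec.push (ora := ora) (i₀ := i₀) (Function.update (Function.update
          (Function.update σ a []) b (c :: l')) f (List.replicate (diffCount (σ a) (σ b) -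
            diffCount [] (c :: l')) true ++ σ f)) f true
        rw [Function.update_self, Function.update_idem, ← e] at h
        cases c
        · exact Exec.branchFalse (l := l') (by simp [hbf]) h
        · exact Exec.branchTrue (l := l') (by simp [hbf]) h
    have h := (h1.seq (h3.seq (exec_clear _ b)))
    have e : Function.update (Function.update (Function.update (Function.update σ a []) b l') f
          (List.replicate (diffCount (σ a) (σ b)) true ++ σ f)) b [] =
        Function.update (Function.update (Function.update σ f
        (List.replicate (diffCount (σ a) (σ b)) true ++ σ f)) a []) b [] := by
      funext s
      by_cases hs : s = b
      · simp [hs]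
      · by_cases hs' : s = a
        · subst hs'
          simp [hs, haf]
        · by_cases hs'' : s = f
          · subst hs''
            simp [hs, hs']
          · simp [hs, hs', hs'']
    rw [e] at h
    refine Exec.mono h ?_
    simp [hbf]
    omega
  intro l
  induction l with
  | nil =>
    intro σ hσ
    refine ⟨σ b, le_rfl, ?_, le_rfl⟩
    have : Function.update (Function.update (Function.update σ a []) b (σ b)) f
        (List.replicate (diffCount [] (σ b) - diffCount [] (σ b)) true ++ σ f) = σ := by
      funext s
      by_cases hs : s = f
      · simp [hs]
      · by_cases hs' : s = b
        · subst hs'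
          simp [hs]
        · by_cases hs'' : s = a
          · subst hs''
            simp [hs, hs', hσ]
          · simp [hs, hs', hs'']
    rw [this]
    exact (Exec.loopNil hσ).mono (by omega)
  | cons c l ih =>
    intro σ hσ
    -- The number of bits, `0` or `1`, pushed in this iteration.
    let k := diffCount (c :: l) (σ b) - diffCount l (σ b).tail
    have hk : diffCount (c :: l) (σ b) = k + diffCount l (σ b).tail ∧ (k = 0 ∨ k = 1) := by
      simp only [k]
      cases σ b with
      | nil =>
        simp only [diffCount, List.tail_nil]
        omega
      | cons d l' =>
        simp only [diffCount, List.tail_cons]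
        split_ifs <;> omega
    have h1 : Exec ora i₀ (.branch a .skip (.branch b (.push f true) .skip (.push f true))
        (.branch b (.push f true) (.push f true) .skip)) σ 3
        (Function.update σ f (List.replicate k true ++ σ f)) := by
      have hp : Exec ora i₀ (.push f true) σ 1
          (Function.update σ f (List.replicate 1 true ++ σ f)) := Exec.push σ f true
      have hs : Exec ora i₀ .skip σ 1 (Function.update σ f (List.replicate 0 true ++ σ f)) := by
        simpa using Exec.skip σ
      cases hb : σ b with
      | nil =>
        have : k = 1 := by simp [k, hb, diffCount]
        rw [this]
        cases c
        · exact Exec.branchFalse hσ (Exec.branchNil hb hp)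
        · exact Exec.branchTrue hσ (Exec.branchNil hb hp)
      | cons d l' =>
        cases c <;> cases d
        · have : k = 0 := by simp [k, hb, diffCount]
          rw [this]
          exact Exec.branchFalse hσ (Exec.branchFalse hb hs)
        · have : k = 1 := by simp [k, hb, diffCount]
          rw [this]
          exact Exec.branchFalse hσ (Exec.branchTrue hb hp)
        · have : k = 1 := by simp [k, hb, diffCount]
          rw [this]
          exact Exec.branchTrue hσ (Exec.branchFalse hb hp)
        · have : k = 0 := by simp [k, hb, diffCount]
          rw [this]
          exact Exec.branchTrue hσ (Exec.branchTrue hb hs)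
    have h2 := h1.seq ((Exec.pop _ a).seq (Exec.pop _ b))
    obtain ⟨l', hl', h3, h4⟩ := ih _ (by simp [hab, haf, hσ] :
      (Function.update (Function.update (Function.update σ f (List.replicate k true ++ σ f)) a
        ((Function.update σ f (List.replicate k true ++ σ f)) a).tail) b
        ((Function.update (Function.update σ f (List.replicate k true ++ σ f)) a
        ((Function.update σ f (List.replicate k true ++ σ f)) a).tail) b).tail) a = l)
    simp only [Function.update_self, Function.update_of_ne hab.symm, Function.update_of_ne hbf,
      Function.update_of_ne haf, Function.update_of_ne haf.symm, Function.update_of_ne hbf.symm]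
      at h2 h3 h4 hl'
    refine ⟨l', hl'.trans (by simp), ?_, by omega⟩
    have h := Exec.loopCons (by simp [hσ]) h2 h3
    have h5 := h.mono (T' := (c :: l).length * 6 + 1) (by simp; omega)
    convert h5 using 1
    have hlen : diffCount (c :: l) (σ b) - diffCount [] l' =
        (diffCount l (σ b).tail - diffCount [] l') + k := by omega
    rw [hlen]
    funext s
    by_cases hs : s = f
    · subst hs
      simp only [Function.update_self]
      rw [List.replicate_add, List.append_assoc]
    · by_cases hs' : s = b
      · subst hs'
        simp [hs]
      · by_cases hs'' : s = a
        · subst hs''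
          simp [hs, hs']
        · simp [hs, hs', hs'']

end Exec

/-! ### Loop-free programs over macro instructions -/

/-- Loop-free programs over macro instructions. The register `12` is an auxiliary register for
`dup`. -/
inductive Cmd : Type
  | skip
  | push (r : ℕ) (b : Bool)
  | pop (r : ℕ)
  | clear (r : ℕ)
  | query (r : ℕ)
  | pour (φ : Bool → List Bool) (r d : ℕ)
  | dup (r d : ℕ)
  | diff (a b f : ℕ)
  | seq (c c' : Cmd)
  | branch (r : ℕ) (onNil onFalse onTrue : Cmd)

namespace Cmd

/-- The register-machine program. -/
def toProg {ι : Type} (i₀ : ι) : Cmd → Prog ι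
  | skip => .skip
  | push r b => .push r b
  | pop r => .pop r
  | clear r => clearProg r
  | query r => .query i₀ r
  | pour φ r d => pourProg φ r d
  | dup r d => .seq (forkProg r 12 d) (pourProg (fun b => [b]) 12 r)
  | diff a b f => diffProg a b f
  | seq c c' => .seq (c.toProg i₀) (c'.toProg i₀)
  | branch r c c' c'' => .branch r (c.toProg i₀) (c'.toProg i₀) (c''.toProg i₀)

/-- The effect on the list of the contents of the registers. -/
def run (O : Oracle) : Cmd → List (List Bool) → List (List Bool)
  | skip, l => l
  | push r b, l => l.set r (b :: l.getD r [])
  | pop r, l => l.set r (l.getD r []).tail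
  | clear r, l => l.set r []
  | query r, l => l.set r [O (l.getD r [])]
  | pour φ r d, l => (l.set d (((l.getD r []).flatMap φ).reverse ++ l.getD d [])).set r []
  | dup r d, l => ((l.set d ((l.getD r []).reverse ++ l.getD d [])).set r
      ((l.getD 12 []).reverse ++ l.getD r [])).set 12 []
  | diff a b f, l => ((l.set f (List.replicate (diffCount (l.getD a []) (l.getD b [])) true ++
      l.getD f [])).set a []).set b []
  | seq c c', l => c'.run O (c.run O l)
  | branch r c c' c'', l => 
    match l.getD r [] with
    | [] => c.run O l
    | false :: _ => c'.run O l
    | true :: _ => c''.run O l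

/-- A bound for the running time. -/
def cost (O : Oracle) : Cmd → List (List Bool) → ℕ
  | skip, _ => 1
  | push _ _, _ => 1
  | pop _, _ => 1
  | clear r, l => 2 * (l.getD r []).length + 1
  | query r, l => (l.getD r []).length + 2
  | pour φ r _, l => (l.getD r []).length * ((φ false).length + (φ true).length + 4) + 1
  | dup r _, l => (l.getD r []).length * 11 + (l.getD 12 []).length * 6 + 2
  | diff a b _, l => (l.getD a []).length * 6 + 2 * (l.getD b []).length + 4
  | seq c c', l => c.cost O l + c'.cost O (c.run O l)
  | branch r c c' c'', l =>
    match l.getD r [] with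
    | [] => c.cost O l + 1
    | false :: _ => c'.cost O l + 1
    | true :: _ => c''.cost O l + 1

/-- The program uses only registers below `N`, and the arguments of macro instructions are
distinct. -/
def Ok (N : ℕ) : Cmd → Bool
  | skip => true
  | push r _ => r < N
  | pop r => r < N
  | clear r => r < N
  | query r => r < N
  | pour _ r d => r < N && d < N && r != d
  | dup r d => r < N && d < N && 12 < N && r != 12 && r != d && d != 12
  | diff a b f => a < N && b < N && f < N && a != b && a != f && b != f
  | seq c c' => c.Ok N && c'.Ok N
  | branch r c c' c'' => decide (r < N) && c.Ok N && c'.Ok N && c''.Ok N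

theorem length_run (O : Oracle) (c : Cmd) (l : List (List Bool)) : (c.run O l).length = l.length := by
  induction c generalizing l with
  | seq c c' h h' => rw [run, h', h]
  | branch r c c' c'' h h' h'' =>
    simp only [run]
    split
    · exact h l
    · exact h' l
    · exact h'' l
  | _ => simp [run]

end Cmd

theorem update_load {l : List (List Bool)} {i : ℕ} (h : i < l.length) (v : List Bool) :
    Function.update (load l) i v = load (l.set i v) := by
  ext j
  by_cases hj : j = i
  · subst hj
    simp [load, h]
  · simp [load, hj, List.getElem?_set_ne (Ne.symm hj)]

/-- Programs are verified by symbolic evaluation of `Cmd.run` on explicit lists, which this turns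
into executions of the machine. The list must contain all registers used, because `List.set` ignores
positions out of range while a register update does not. -/
theorem Cmd.exec {ι : Type} {ora : ι → List Bool → List Bool} {i₀ : ι} {O : Oracle}
    (hO : ∀ q, ora i₀ q = [O q]) (c : Cmd) {N : ℕ} (hc : c.Ok N = true) (l : List (List Bool))
    (hl : N ≤ l.length) :
    Exec ora i₀ (c.toProg i₀) (load l) (c.cost O l) (load (c.run O l)) := by
  induction c generalizing l with
  | skip => exact Exec.skip _
  | push r b =>
    simp only [Ok, decide_eq_true_eq] at hc
    rw [run, ← update_load (by omega)]
    exact Exec.push _ r b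
  | pop r =>
    simp only [Ok, decide_eq_true_eq] at hc
    rw [run, ← update_load (by omega)]
    exact Exec.pop _ r
  | clear r =>
    simp only [Ok, decide_eq_true_eq] at hc
    rw [run, ← update_load (by omega)]
    exact exec_clear _ r
  | query r =>
    simp only [Ok, decide_eq_true_eq] at hc
    rw [run, ← update_load (by omega), ← hO]
    refine (Exec.query _ r).mono ?_
    rw [hO]
    simp only [cost, load, List.length_cons, List.length_nil]
    omega
  | pour φ r d =>
    simp only [Ok, Bool.and_eq_true, decide_eq_true_eq, bne_iff_ne] at hc
    rw [run, ← update_load (by simp; omega), ← update_load (by omega)]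
    exact exec_pour φ hc.2 _
  | dup r d =>
    simp only [Ok, Bool.and_eq_true, decide_eq_true_eq, bne_iff_ne] at hc
    obtain ⟨⟨⟨⟨⟨h1, h2⟩, h3⟩, h4⟩, h5⟩, h6⟩ := hc
    have h := (exec_fork (ora := ora) (i₀ := i₀) h4 h5 (Ne.symm h6) (load l)).seq
      (exec_pour (fun b => [b]) (Ne.symm h4) _)
    rw [run, ← update_load (by simp; omega), ← update_load (by simp; omega),
      ← update_load (by omega)]
    have h' := h.mono (T' := (dup r d).cost O l) (by
      simp [cost, Ne.symm h6, Ne.symm h4, load]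
      omega)
    simp only [toProg]
    convert h' using 1
    funext s
    by_cases hs : s = 12
    · simp [hs]
    · by_cases hs' : s = r
      · subst hs'
        simp [hs, Ne.symm h6, Ne.symm h4, load]
      · by_cases hs'' : s = d
        · subst hs''
          simp [hs, hs', load]
        · simp [hs, hs', hs'']
  | diff a b f =>
    simp only [Ok, Bool.and_eq_true, decide_eq_true_eq, bne_iff_ne] at hc
    obtain ⟨⟨⟨⟨⟨h1, h2⟩, h3⟩, h4⟩, h5⟩, h6⟩ := hc
    rw [run, ← update_load (by simp; omega), ← update_load (by simp; omega),
      ← update_load (by omega)]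
    exact exec_diff h4 h5 h6 _
  | seq c c' h h' =>
    simp only [Ok, Bool.and_eq_true] at hc
    exact (h hc.1 l hl).seq (h' hc.2 _ (by rwa [length_run]))
  | branch r c c' c'' h h' h'' =>
    simp only [Ok, Bool.and_eq_true, decide_eq_true_eq] at hc
    obtain ⟨⟨⟨-, h1⟩, h2⟩, h3⟩ := hc
    simp only [run, cost, toProg]
    split
    · exact Exec.branchNil ‹_› (h h1 l hl)
    · exact Exec.branchFalse ‹_› (h' h2 l hl)
    · exact Exec.branchTrue ‹_› (h'' h3 l hl)

/-! ### Scanning and evaluating the description of a circuit -/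

/-- The state of the scanner that reads the description of a circuit bit by bit and evaluates the
circuit. Except for `n` and `t`, the strings are stored in reversed order.

The modes are: `0` reading the number of inputs, `1` expecting a gate or the end of the list of
gates, `2` expecting a gate, `3` reading the bit of a constant gate, `4` expecting a gate other than
a constant, `5` and `6` reading the arguments of a `NAND` gate, `7` expecting an argument of an
oracle gate or the end of the list of arguments, `8` reading an argument of an oracle gate, `9`
expecting an output or the end of the list of outputs, `10` reading an output, `11` reading the
rest. -/
structure Scan where
  /-- the mode -/
  mode : ℕ
  /-- the number of inputs in unary -/
  n : List Bool
  /-- the inputs that have not been used so far -/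
  t : List Bool
  /-- the inputs that have been used so far -/
  xR : List Bool
  /-- the values of the wires -/
  wR : List Bool
  /-- the values of the wires from the one with the current index on -/
  tmp : List Bool
  /-- the current oracle query -/
  qR : List Bool
  /-- the value of the first argument of a `NAND` gate -/
  a : List Bool
  /-- the outputs -/
  outR : List Bool
  /-- the descriptions of gates and outputs, with all wire numbers increased -/
  hR : List Bool
  /-- the rest of the string after the description of the circuit -/
  restR : List Bool

namespace Scan

/-- The start state for the string of inputs `t`. -/
def start (t : List Bool) : Scan := ⟨0, [], t, [], [], [], [], [], [], [], []⟩

/-- The first bit of `tmp`. -/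
def top (S : Scan) : Bool := S.tmp.headD false

/-- The transition function. The copied wire numbers are increased by the length of `sh`. -/
def step (O : Oracle) (sh : List Bool) (S : Scan) (b : Bool) : Scan :=
  match S.mode, b with
  | 0, true =>
    match S.t with
    | [] => { S with n := true :: S.n }
    | c :: t => { S with n := true :: S.n, t := t, xR := c :: S.xR, wR := c :: S.wR }
  | 0, false => { S with mode := 1 }
  | 1, true => { S with mode := 2, hR := true :: S.hR }
  | 1, false => { S with mode := 9, hR := false :: S.hR }
  | 2, true => { S with mode := 4, hR := true :: S.hR }
  | 2, false => { S with mode := 3, hR := false :: S.hR }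
  | 3, b => { S with mode := 1, wR := b :: S.wR, hR := b :: S.hR }
  | 4, true => { S with mode := 7, hR := true :: S.hR }
  -- To look up a wire, `tmp` starts as the list of all wire values, and every `1` of the unary
  -- index removes one of them, so the wanted value ends up first. Copying `sh` in front of the
  -- index adds the shift to the wire number.
  | 4, false => { S with mode := 5, tmp := S.wR.reverse, hR := sh.reverse ++ false :: S.hR }
  | 5, true => { S with tmp := S.tmp.tail, hR := true :: S.hR }
  | 5, false => { S with
      mode := 6, a := [S.top], tmp := S.wR.reverse, hR := sh.reverse ++ false :: S.hR }
  | 6, true => { S with tmp := S.tmp.tail, hR := true :: S.hR }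
  | 6, false => { S with
      mode := 1, wR := (!(S.a.headD false && S.top)) :: S.wR, a := [], tmp := [],
      hR := false :: S.hR }
  | 7, true => { S with mode := 8, tmp := S.wR.reverse, hR := sh.reverse ++ true :: S.hR }
  | 7, false => { S with
      mode := 1, wR := O S.qR.reverse :: S.wR, qR := [], tmp := [], hR := false :: S.hR }
  | 8, true => { S with tmp := S.tmp.tail, hR := true :: S.hR }
  | 8, false => { S with mode := 7, qR := S.top :: S.qR, tmp := [], hR := false :: S.hR }
  | 9, true => { S with mode := 10, tmp := S.wR.reverse, hR := sh.reverse ++ true :: S.hR }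
  | 9, false => { S with mode := 11, hR := false :: S.hR }
  | 10, true => { S with tmp := S.tmp.tail, hR := true :: S.hR }
  | 10, false => { S with mode := 9, outR := S.top :: S.outR, tmp := [], hR := false :: S.hR }
  | _, b => { S with restR := b :: S.restR }

/-- The contents of the registers: `src` is the string to be read, and `e` are the contents of the
registers that the scanner does not use. -/
def regs (S : Scan) (src sh : List Bool) (e : List (List Bool)) : List (List Bool) :=
  -- The commands address these by position: `0` source, `1` mode in unary, `2` to `11` the strings
  -- of the state, `12` the auxiliary register of `dup`, `13` the shift.
  src :: List.replicate S.mode true :: S.n :: S.t :: S.xR :: S.wR :: S.tmp :: S.qR :: S.a ::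
    S.outR :: S.hR :: S.restR :: [] :: sh :: e

/-- All strings have length at most `M`. -/
def Le (S : Scan) (M : ℕ) : Prop :=
  S.mode ≤ 11 ∧ S.n.length ≤ M ∧ S.t.length ≤ M ∧ S.xR.length ≤ M ∧ S.wR.length ≤ M ∧
    S.tmp.length ≤ M ∧ S.qR.length ≤ M ∧ S.a.length ≤ M ∧ S.outR.length ≤ M ∧ S.hR.length ≤ M ∧
    S.restR.length ≤ M

theorem Le.step {S : Scan} {M : ℕ} (h : S.Le M) (O : Oracle) (sh : List Bool) (b : Bool) :
    (S.step O sh b).Le (M + (sh.length + 1)) := by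
  obtain ⟨mode, n, t, xR, wR, tmp, qR, a, outR, hR, restR⟩ := S
  obtain ⟨h1, h2, h3, h4, h5, h6, h7, h8, h9, h10, h11⟩ := h
  dsimp only at h1 h2 h3 h4 h5 h6 h7 h8 h9 h10 h11
  interval_cases mode <;> cases b
  pick_goal 2
  · cases t
    · simp only [Scan.step, Le, List.length_cons]
      omega
    · simp only [List.length_cons] at h3
      simp only [Scan.step, Le, List.length_cons]
      omega
  all_goals
    simp only [Scan.step, Le, List.length_cons, List.length_nil, List.length_reverse,
      List.length_append, List.length_tail]
    omega

theorem Le.foldl {S : Scan} {M : ℕ} (h : S.Le M) (O : Oracle) (sh src : List Bool) :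
    (src.foldl (Scan.step O sh) S).Le (M + src.length * (sh.length + 1)) := by
  induction src generalizing S M with
  | nil => simpa using h
  | cons b src ih =>
    have := ih (h.step O sh b)
    rwa [add_assoc, add_comm (sh.length + 1), ← Nat.succ_mul] at this

end Scan

/-! ### The program of the scanner -/

namespace Cmd

/-- Pushes `k` ones to the register `r`. -/
def ones (r : ℕ) : ℕ → Cmd
  | 0 => skip
  | k + 1 => seq (push r true) (ones r k)

theorem run_ones (O : Oracle) (r k : ℕ) (l : List (List Bool)) (h : r < l.length) :
    (ones r k).run O l = l.set r (List.replicate k true ++ l.getD r []) := by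
  induction k generalizing l with
  | zero => simp [ones, run, h]
  | succ k ih =>
    rw [ones, run, run, ih _ (by simpa using h)]
    simp [h, List.replicate_succ', List.append_assoc]

theorem cost_ones (O : Oracle) (r k : ℕ) (l : List (List Bool)) : (ones r k).cost O l = k + 1 := by
  induction k generalizing l with
  | zero => rfl
  | succ k ih =>
    rw [ones, cost, cost, ih]
    omega

/-- Removes the number in unary in the register `1` and executes the command with this index. -/
def dispatch : List Cmd → Cmd
  | [] => skip
  | c :: cs => branch 1 c skip (seq (pop 1) (dispatch cs))

/-- Removes a bit from the register `0` and branches on it. -/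
def bit (c c' : Cmd) : Cmd := branch 0 skip (seq (pop 0) c) (seq (pop 0) c')

/-- Starts to look up a wire. -/
def startIndex (b : Bool) : Cmd := seq (push 10 b) (seq (clear 6) (seq (dup 5 6) (dup 13 10)))

/-- Continues to look up a wire of higher index. -/
def nextIndex (mode : ℕ) : Cmd := seq (pop 6) (seq (push 10 true) (ones 1 mode))

/-- Pushes the first bit of the register `6` to the register `r`. -/
def copyTop (r : ℕ) : Cmd := branch 6 (push r false) (push r false) (push r true)

theorem run_copyTop (O : Oracle) (r : ℕ) (l : List (List Bool)) :
    (copyTop r).run O l = l.set r ((l.getD 6 []).headD false :: l.getD r []) := by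
  simp only [copyTop, run]
  generalize l.getD 6 [] = v
  rcases v with _ | ⟨_ | _, v⟩ <;> rfl

theorem cost_copyTop (O : Oracle) (r : ℕ) (l : List (List Bool)) : (copyTop r).cost O l = 2 := by
  simp only [copyTop, cost]
  generalize l.getD 6 [] = v
  rcases v with _ | ⟨_ | _, v⟩ <;> rfl

/-- Pushes the `NAND` of the first bits of the registers `8` and `6` to the register `5`. -/
def pushNand : Cmd :=
  branch 8 (push 5 true) (push 5 true) (branch 6 (push 5 true) (push 5 true) (push 5 false))

theorem run_pushNand (O : Oracle) (l : List (List Bool)) :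
    pushNand.run O l = l.set 5
      ((!((l.getD 8 []).headD false && (l.getD 6 []).headD false)) :: l.getD 5 []) := by
  simp only [pushNand, run]
  generalize l.getD 8 [] = v, l.getD 6 [] = v'
  rcases v with _ | ⟨_ | _, v⟩ <;> rcases v' with _ | ⟨_ | _, v'⟩ <;> rfl

theorem cost_pushNand_le (O : Oracle) (l : List (List Bool)) : pushNand.cost O l ≤ 3 := by
  simp only [pushNand, cost]
  generalize l.getD 8 [] = v, l.getD 6 [] = v'
  rcases v with _ | ⟨_ | _, v⟩ <;> rcases v' with _ | ⟨_ | _, v'⟩ <;> simp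

/-- Pushes the value of the wire that has been looked up to the register `r`. -/
def useIndex (r : ℕ) : Cmd := seq (push 10 false) (seq (copyTop r) (clear 6))

/-- One step of the scanner. -/
def scanStep : Cmd := dispatch [
  -- The entry of index `k` handles mode `k`, and the first argument of `bit` is for the bit `0`.
  -- The dispatch has erased the old mode, so each branch writes the new one with `ones 1`.
  bit (ones 1 1) (seq (push 2 true) (branch 3 skip
    (seq (pop 3) (seq (push 4 false) (push 5 false))) (seq (pop 3) (seq (push 4 true) (push 5 true))))),
  bit (seq (push 10 false) (ones 1 9)) (seq (push 10 true) (ones 1 2)),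
  bit (seq (push 10 false) (ones 1 3)) (seq (push 10 true) (ones 1 4)),
  bit (seq (push 5 false) (seq (push 10 false) (ones 1 1)))
    (seq (push 5 true) (seq (push 10 true) (ones 1 1))),
  bit (seq (startIndex false) (ones 1 5)) (seq (push 10 true) (ones 1 7)),
  bit (seq (clear 8) (seq (copyTop 8) (seq (startIndex false) (ones 1 6)))) (nextIndex 5),
  bit (seq (push 10 false) (seq pushNand (seq (clear 8) (seq (clear 6) (ones 1 1)))))
    (nextIndex 6),
  bit (seq (push 10 false) (seq (clear 6) (seq (pour (fun b => [b]) 7 6) (seq (query 6)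
    (seq (copyTop 5) (seq (clear 6) (ones 1 1)))))))
    (seq (startIndex true) (ones 1 8)),
  bit (seq (useIndex 7) (ones 1 7)) (nextIndex 8),
  bit (seq (push 10 false) (ones 1 11)) (seq (startIndex true) (ones 1 10)),
  bit (seq (useIndex 9) (ones 1 9)) (nextIndex 10),
  bit (seq (push 11 false) (ones 1 11)) (seq (push 11 true) (ones 1 11))]

theorem ok_scanStep : scanStep.Ok 14 = true := by decide

end Cmd

namespace Scan

set_option maxHeartbeats 1000000 in
theorem run_scanStep (O : Oracle) (S : Scan) (hS : S.mode ≤ 11) (b : Bool) (src sh : List Bool)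
    (e : List (List Bool)) :
    Cmd.scanStep.run O (S.regs (b :: src) sh e) = (S.step O sh b).regs src sh e := by
  obtain ⟨mode, n, t, xR, wR, tmp, qR, a, outR, hR, restR⟩ := S
  dsimp only at hS
  interval_cases mode <;> cases b <;>
  first
  | (simp [Scan.step, regs, Cmd.scanStep, Cmd.dispatch, Cmd.bit, Cmd.run, Cmd.startIndex,
      Cmd.nextIndex, Cmd.run_ones, List.replicate_succ, Cmd.run_copyTop, Cmd.run_pushNand,
      Cmd.useIndex, top]; done)
  | (cases t with
     | nil => simp [Scan.step, regs, Cmd.scanStep, Cmd.dispatch, Cmd.bit, Cmd.run]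
     | cons c t => cases c <;>
        simp [Scan.step, regs, Cmd.scanStep, Cmd.dispatch, Cmd.bit, Cmd.run])

theorem cost_scanStep_le (O : Oracle) {S : Scan} {M : ℕ} (hS : S.Le M) (b : Bool)
    (src sh : List Bool) (e : List (List Bool)) :
    Cmd.scanStep.cost O (S.regs (b :: src) sh e) ≤ 40 * M + 40 * sh.length + 100 := by
  obtain ⟨mode, n, t, xR, wR, tmp, qR, a, outR, hR, restR⟩ := S
  obtain ⟨h1, h2, h3, h4, h5, h6, h7, h8, h9, h10, h11⟩ := hS
  dsimp only at h1 h2 h3 h4 h5 h6 h7 h8 h9 h10 h11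
  interval_cases mode <;> cases b
  pick_goal 2
  · rcases t with _ | ⟨_ | _, t⟩ <;>
      simp [regs, Cmd.scanStep, Cmd.dispatch, Cmd.bit, Cmd.run, Cmd.cost]
  all_goals simp [regs, Cmd.scanStep, Cmd.dispatch, Cmd.bit, Cmd.run, Cmd.startIndex,
      Cmd.nextIndex, List.replicate_succ, Cmd.run_copyTop, Cmd.run_pushNand, Cmd.useIndex, Cmd.cost,
      Cmd.cost_ones, Cmd.cost_copyTop]
  all_goals first
    | omega
    | have := Cmd.cost_pushNand_le O (src :: [] :: n :: t :: xR :: wR :: tmp :: qR :: a :: outR ::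
        (false :: hR) :: restR :: [] :: sh :: e)
      omega

end Scan

/-! ### Correctness of the scanner -/

/-- Increases all wire numbers by `s`. -/
def Gate.shift (s : ℕ) : Gate → Gate
  | .const b => .const b
  | .nand i j => .nand (s + i) (s + j)
  | .oracle args => .oracle (args.map (s + ·))

/-- The values of all wires of the circuit on the input `x`. -/
def Circuit.wires (C : Circuit) (O : Oracle) (x : List Bool) : List Bool :=
  C.gates.foldl (fun w g => w ++ [g.eval O w]) x

/-- The description of the gates and outputs of the circuit, with all wire numbers increased by
`s`. -/
def Circuit.shiftedBody (C : Circuit) (s : ℕ) : List Bool :=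
  encList Gate.code (C.gates.map (Gate.shift s)) ++ encList encNat (C.outputs.map (s + ·))

theorem encList_nil {α : Type} (enc : α → List Bool) : encList enc [] = [false] := rfl

theorem encNat_succ (k : ℕ) : encNat (k + 1) = true :: encNat k := rfl

theorem headD_drop (w : List Bool) (i : ℕ) : (w.drop i).headD false = wire w i := by
  rw [wire, List.headD_eq_head?_getD, List.head?_drop, List.getD_eq_getElem?_getD]

namespace Scan

variable {O : Oracle} {n t xR wR tmp qR a outR hR restR r sh : List Bool} {s : ℕ}

theorem foldl_inputs (k : ℕ) :
    (encNat k ++ r).foldl (step O sh) ⟨0, n, t, xR, wR, tmp, qR, a, outR, hR, restR⟩ =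
      r.foldl (step O sh) ⟨1, List.replicate k true ++ n, t.drop k, (t.take k).reverse ++ xR,
        (t.take k).reverse ++ wR, tmp, qR, a, outR, hR, restR⟩ := by
  induction k generalizing n t xR wR with
  | zero => simp [encNat, step]
  | succ k ih =>
    rw [encNat_succ, List.cons_append, List.foldl_cons]
    cases t with
    | nil =>
      simp only [step]
      rw [ih]
      simp [List.replicate_succ']
    | cons c t =>
      simp only [step]
      rw [ih]
      simp [List.replicate_succ']

/-- The four modes treat the ones of a unary number alike. They differ at the terminating `0`, which
is therefore left unread. -/
theorem foldl_index {m : ℕ} (hm : m = 5 ∨ m = 6 ∨ m = 8 ∨ m = 10) (i : ℕ) :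
    (encNat i ++ r).foldl (step O sh) ⟨m, n, t, xR, wR, tmp, qR, a, outR, hR, restR⟩ =
      (false :: r).foldl (step O sh) ⟨m, n, t, xR, wR, tmp.drop i, qR, a, outR,
        List.replicate i true ++ hR, restR⟩ := by
  induction i generalizing tmp hR with
  | zero => simp [encNat]
  | succ i ih =>
    have : step O sh ⟨m, n, t, xR, wR, tmp, qR, a, outR, hR, restR⟩ true =
        ⟨m, n, t, xR, wR, tmp.tail, qR, a, outR, true :: hR, restR⟩ := by
      rcases hm with rfl | rfl | rfl | rfl <;> rfl
    rw [encNat_succ, List.cons_append, List.foldl_cons, this, ih]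
    simp [List.replicate_succ']

theorem reverse_encNat_add (i : ℕ) (l : List Bool) : (encNat (s + i)).reverse ++ l =
    false :: (List.replicate i true ++ (List.replicate s true ++ l)) := by
  rw [encNat, ← List.append_assoc (List.replicate i true), List.replicate_append_replicate,
    add_comm s i]
  simp

theorem foldl_args (args : List ℕ) :
    (encList encNat args ++ r).foldl (step O (List.replicate s true))
        ⟨7, n, t, xR, wR, [], qR, a, outR, hR, restR⟩ =
      r.foldl (step O (List.replicate s true)) ⟨1, n, t, xR,
        O (qR.reverse ++ args.map (wire wR.reverse)) :: wR, [], [], a, outR,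
        (encList encNat (args.map (s + ·))).reverse ++ hR, restR⟩ := by
  induction args generalizing qR hR with
  | nil => simp [encList_nil, step]
  | cons i args ih =>
    rw [encList_cons, List.cons_append, List.append_assoc, List.foldl_cons]
    simp only [step]
    rw [foldl_index (by simp), List.foldl_cons]
    simp only [step, top, headD_drop]
    rw [ih]
    simp [encList_cons, reverse_encNat_add]

theorem foldl_gate (g : Gate) :
    (true :: (g.code ++ r)).foldl (step O (List.replicate s true))
        ⟨1, n, t, xR, wR, [], [], [], outR, hR, restR⟩ =
      r.foldl (step O (List.replicate s true)) ⟨1, n, t, xR, g.eval O wR.reverse :: wR, [], [], [],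
        outR, (g.shift s).code.reverse ++ true :: hR, restR⟩ := by
  cases g with
  | const b => simp [Gate.code, step, Gate.eval, Gate.shift]
  | nand i j =>
    simp only [Gate.code, List.cons_append, List.nil_append, List.foldl_cons, step,
      List.append_assoc]
    rw [foldl_index (by simp), List.foldl_cons]
    simp only [step, top, headD_drop]
    rw [foldl_index (by simp), List.foldl_cons]
    simp only [step, top, headD_drop]
    simp [Gate.eval, Gate.shift, reverse_encNat_add]
  | oracle args =>
    simp only [Gate.code, List.cons_append, List.nil_append, List.foldl_cons, step]
    rw [foldl_args]
    simp [Gate.eval, Gate.shift]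

theorem foldl_gates (gates : List Gate) :
    (encList Gate.code gates ++ r).foldl (step O (List.replicate s true))
        ⟨1, n, t, xR, wR, [], [], [], outR, hR, restR⟩ =
      r.foldl (step O (List.replicate s true)) ⟨9, n, t, xR,
        (gates.foldl (fun w g => w ++ [g.eval O w]) wR.reverse).reverse, [], [], [],
        outR, (encList Gate.code (gates.map (Gate.shift s))).reverse ++ hR, restR⟩ := by
  induction gates generalizing wR hR with
  | nil => simp [encList_nil, step]
  | cons g gates ih =>
    rw [encList_cons, List.cons_append, List.append_assoc, foldl_gate, ih]
    simp [encList_cons]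

theorem foldl_outputs (outs : List ℕ) :
    (encList encNat outs ++ r).foldl (step O (List.replicate s true))
        ⟨9, n, t, xR, wR, [], [], [], outR, hR, restR⟩ =
      r.foldl (step O (List.replicate s true)) ⟨11, n, t, xR, wR, [], [], [],
        (outs.map (wire wR.reverse)).reverse ++ outR,
        (encList encNat (outs.map (s + ·))).reverse ++ hR, restR⟩ := by
  induction outs generalizing outR hR with
  | nil => simp [encList_nil, step]
  | cons i outs ih =>
    rw [encList_cons, List.cons_append, List.append_assoc, List.foldl_cons]
    simp only [step]
    rw [foldl_index (by simp), List.foldl_cons]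
    simp only [step, top, headD_drop]
    rw [ih]
    simp [encList_cons, reverse_encNat_add]

theorem foldl_rest (rest : List Bool) :
    rest.foldl (step O sh) ⟨11, n, t, xR, wR, tmp, qR, a, outR, hR, restR⟩ =
      ⟨11, n, t, xR, wR, tmp, qR, a, outR, hR, rest.reverse ++ restR⟩ := by
  induction rest generalizing restR with
  | nil => simp
  | cons b rest ih => simp [step, ih]

/-- The final state of the scanner on a string that starts with the description of a circuit. -/
theorem foldl_code (C : Circuit) (rest : List Bool) :
    (C.code ++ rest).foldl (step O (List.replicate s true)) (start t) =
      ⟨11, List.replicate C.inputs true, t.drop C.inputs, (t.take C.inputs).reverse,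
        (C.wires O (t.take C.inputs)).reverse, [], [], [], (C.eval O (t.take C.inputs)).reverse,
        (C.shiftedBody s).reverse, rest.reverse⟩ := by
  rw [Circuit.code, List.append_assoc, List.append_assoc, start, foldl_inputs, foldl_gates,
    foldl_outputs, foldl_rest]
  simp [Circuit.eval, Circuit.wires, Circuit.shiftedBody]

/-- In the given mode, the scanner reaches the mode `11` only by reading such a string. -/
def Parses : ℕ → List Bool → Prop
  | 0, l => ∃ k gates outs rest,
      l = encNat k ++ encList Gate.code gates ++ encList encNat outs ++ rest
  | 1, l => ∃ gates outs rest, l = encList Gate.code gates ++ encList encNat outs ++ rest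
  | 2, l => ∃ g gates outs rest,
      l = Gate.code g ++ encList Gate.code gates ++ encList encNat outs ++ rest
  | 3, l => ∃ b gates outs rest, l = b :: encList Gate.code gates ++ encList encNat outs ++ rest
  | 4, l => ∃ g gates outs rest,
      true :: l = Gate.code g ++ encList Gate.code gates ++ encList encNat outs ++ rest
  | 5, l => ∃ i j gates outs rest,
      l = encNat i ++ encNat j ++ encList Gate.code gates ++ encList encNat outs ++ rest
  | 6, l => ∃ j gates outs rest,
      l = encNat j ++ encList Gate.code gates ++ encList encNat outs ++ rest
  | 7, l => ∃ args gates outs rest,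
      l = encList encNat args ++ encList Gate.code gates ++ encList encNat outs ++ rest
  | 8, l => ∃ i args gates outs rest,
      l = encNat i ++ encList encNat args ++ encList Gate.code gates ++ encList encNat outs ++ rest
  | 9, l => ∃ outs rest, l = encList encNat outs ++ rest
  | 10, l => ∃ i outs rest, l = encNat i ++ encList encNat outs ++ rest
  | _, _ => True

/-- Parsing runs backwards through the transition function: the bit just read is prepended to a
parse of the remainder. It follows that mode `11` certifies a well-formed code. -/
theorem parses_cons {S : Scan} (hS : S.mode ≤ 11) {b : Bool} {l : List Bool}
    (h : Parses (step O sh S b).mode l) : Parses S.mode (b :: l) := by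
  obtain ⟨mode, n, t, xR, wR, tmp, qR, a, outR, hR, restR⟩ := S
  dsimp only at hS ⊢
  interval_cases mode <;> cases b
  · obtain ⟨gates, outs, rest, rfl⟩ := h
    exact ⟨0, gates, outs, rest, rfl⟩
  · have h' : Parses 0 l := by cases t <;> exact h
    obtain ⟨k, gates, outs, rest, rfl⟩ := h'
    exact ⟨k + 1, gates, outs, rest, rfl⟩
  · obtain ⟨outs, rest, rfl⟩ := h
    exact ⟨[], outs, rest, rfl⟩
  · obtain ⟨g, gates, outs, rest, rfl⟩ := h
    exact ⟨g :: gates, outs, rest, by simp [encList_cons]⟩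
  · obtain ⟨b, gates, outs, rest, rfl⟩ := h
    exact ⟨.const b, gates, outs, rest, rfl⟩
  · obtain ⟨g, gates, outs, rest, h⟩ := h
    exact ⟨g, gates, outs, rest, h⟩
  · obtain ⟨gates, outs, rest, rfl⟩ := h
    exact ⟨false, gates, outs, rest, rfl⟩
  · obtain ⟨gates, outs, rest, rfl⟩ := h
    exact ⟨true, gates, outs, rest, rfl⟩
  · obtain ⟨i, j, gates, outs, rest, rfl⟩ := h
    exact ⟨.nand i j, gates, outs, rest, rfl⟩
  · obtain ⟨args, gates, outs, rest, rfl⟩ := h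
    exact ⟨.oracle args, gates, outs, rest, rfl⟩
  · obtain ⟨j, gates, outs, rest, rfl⟩ := h
    exact ⟨0, j, gates, outs, rest, rfl⟩
  · obtain ⟨i, j, gates, outs, rest, rfl⟩ := h
    exact ⟨i + 1, j, gates, outs, rest, rfl⟩
  · obtain ⟨gates, outs, rest, rfl⟩ := h
    exact ⟨0, gates, outs, rest, rfl⟩
  · obtain ⟨j, gates, outs, rest, rfl⟩ := h
    exact ⟨j + 1, gates, outs, rest, rfl⟩
  · obtain ⟨gates, outs, rest, rfl⟩ := h
    exact ⟨[], gates, outs, rest, rfl⟩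
  · obtain ⟨i, args, gates, outs, rest, rfl⟩ := h
    exact ⟨i :: args, gates, outs, rest, by simp [encList_cons]⟩
  · obtain ⟨args, gates, outs, rest, rfl⟩ := h
    exact ⟨0, args, gates, outs, rest, rfl⟩
  · obtain ⟨i, args, gates, outs, rest, rfl⟩ := h
    exact ⟨i + 1, args, gates, outs, rest, rfl⟩
  · exact ⟨[], l, rfl⟩
  · obtain ⟨i, outs, rest, rfl⟩ := h
    exact ⟨i :: outs, rest, by simp [encList_cons]⟩
  · obtain ⟨outs, rest, rfl⟩ := h
    exact ⟨0, outs, rest, rfl⟩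
  · obtain ⟨i, outs, rest, rfl⟩ := h
    exact ⟨i + 1, outs, rest, rfl⟩
  all_goals trivial

theorem mode_step_le {S : Scan} (hS : S.mode ≤ 11) (b : Bool) : (step O sh S b).mode ≤ 11 := by
  obtain ⟨mode, n, t, xR, wR, tmp, qR, a, outR, hR, restR⟩ := S
  dsimp only at hS
  interval_cases mode <;> cases b
  pick_goal 2
  · cases t <;> simp [step]
  all_goals simp [step]

theorem parses_of_mode_foldl {S : Scan} (hS : S.mode ≤ 11) {l : List Bool}
    (h : (l.foldl (step O sh) S).mode = 11) : Parses S.mode l := by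
  induction l generalizing S with
  | nil =>
    rw [List.foldl_nil] at h
    rw [h]
    trivial
  | cons b l ih => exact parses_cons hS (ih (mode_step_le hS b) h)

theorem exists_code_of_mode {l : List Bool} (h : (l.foldl (step O sh) (start t)).mode = 11) :
    ∃ (C : Circuit) (rest : List Bool), l = C.code ++ rest := by
  obtain ⟨k, gates, outs, rest, h⟩ := parses_of_mode_foldl (S := start t) (by simp [start]) h
  exact ⟨⟨k, gates, outs⟩, rest, h⟩

end Scan

/-! ### Polynomial-time computations on families of inputs -/

/-- All strings of the list have length at most `M`. -/
def Within (M : ℕ) (l : List (List Bool)) : Prop := ∀ v ∈ l, v.length ≤ M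

namespace Within

variable {M M' : ℕ} {l : List (List Bool)}

theorem mono (h : Within M l) (hM : M ≤ M') : Within M' l := fun v hv => (h v hv).trans hM

theorem length_getD_le (h : Within M l) (r : ℕ) : (l.getD r []).length ≤ M := by
  rw [List.getD_eq_getElem?_getD]
  cases hr : l[r]? with
  | none => simp
  | some v => exact h v (List.mem_of_getElem? hr)

theorem set (h : Within M l) (r : ℕ) {v : List Bool} (hv : v.length ≤ M) : Within M (l.set r v) := by
  intro w hw
  rcases List.mem_or_eq_of_mem_set hw with hw | rfl
  · exact h w hw
  · exact hv

end Within

theorem length_flatMap_le (φ : Bool → List Bool) (l : List Bool) :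
    (l.flatMap φ).length ≤ l.length * ((φ false).length + (φ true).length) := by
  induction l with
  | nil => simp
  | cons b l ih =>
    have : (φ b).length ≤ (φ false).length + (φ true).length := by cases b <;> omega
    rw [List.flatMap_cons, List.length_append, List.length_cons, Nat.succ_mul]
    omega

/-- Loop-free programs run in linear time. -/
theorem Cmd.exists_bound (O : Oracle) (c : Cmd) : ∃ K : ℕ, ∀ l M, Within M l →
    c.cost O l ≤ K * (M + 1) ∧ Within (K * (M + 1)) (c.run O l) := by
  induction c with
  | skip => exact ⟨1, fun l M h => ⟨by simp [cost], h.mono (by omega)⟩⟩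
  | push r b =>
    refine ⟨1, fun l M h => ⟨by simp [cost], (h.mono (by omega)).set r ?_⟩⟩
    have := h.length_getD_le r
    simp only [List.length_cons]
    omega
  | pop r =>
    refine ⟨1, fun l M h => ⟨by simp [cost], (h.mono (by omega)).set r ?_⟩⟩
    have := h.length_getD_le r
    simp only [List.length_tail]
    omega
  | clear r =>
    refine ⟨2, fun l M h => ⟨?_, (h.mono (by omega)).set r (by simp)⟩⟩
    have := h.length_getD_le r
    simp only [cost]
    omega
  | query r =>
    refine ⟨2, fun l M h => ⟨?_, (h.mono (by omega)).set r (by simp; omega)⟩⟩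
    have := h.length_getD_le r
    simp only [cost]
    omega
  | pour φ r d =>
    refine ⟨(φ false).length + (φ true).length + 5, fun l M h => ⟨?_, ((h.mono ?_).set d ?_).set r
      (by simp)⟩⟩
    · have := Nat.mul_le_mul_right ((φ false).length + (φ true).length + 4) (h.length_getD_le r)
      simp only [cost]
      nlinarith
    · nlinarith
    · have h1 := length_flatMap_le φ (l.getD r [])
      have h2 := Nat.mul_le_mul_right ((φ false).length + (φ true).length) (h.length_getD_le r)
      have h3 := h.length_getD_le d
      simp only [List.length_append, List.length_reverse]
      nlinarith
  | dup r d =>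
    have h0 : ∀ M : ℕ, M ≤ 17 * (M + 1) := by omega
    refine ⟨17, fun l M h => ⟨?_, (((h.mono (h0 M)).set d ?_).set r ?_).set 12 (by simp)⟩⟩
    all_goals
      have h1 := h.length_getD_le r
      have h2 := h.length_getD_le d
      have h3 := h.length_getD_le 12
      simp only [cost, List.length_append, List.length_reverse]
      omega
  | diff a b f =>
    have h0 : ∀ M : ℕ, M ≤ 8 * (M + 1) := by omega
    refine ⟨8, fun l M h => ⟨?_, (((h.mono (h0 M)).set f ?_).set a (by simp)).set b (by simp)⟩⟩
    all_goals
      have h1 := h.length_getD_le a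
      have h2 := h.length_getD_le b
      have h3 := h.length_getD_le f
      have h4 := diffCount_le (l.getD a []) (l.getD b [])
      simp only [cost, List.length_append, List.length_replicate]
      omega
  | seq c c' h h' =>
    obtain ⟨K, hK⟩ := h
    obtain ⟨K', hK'⟩ := h'
    -- The second command starts with strings of length `K (M + 1)`, and `K (M + 1) + 1 ≤ (K + 1) (M
    -- + 1)`.
    refine ⟨K' * (K + 1) + K, fun l M h => ?_⟩
    obtain ⟨h1, h2⟩ := hK l M h
    obtain ⟨h3, h4⟩ := hK' _ _ h2
    have h5 : K' * (K * (M + 1) + 1) ≤ K' * (K + 1) * (M + 1) := by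
      rw [mul_assoc]
      exact Nat.mul_le_mul_left _ (by nlinarith)
    refine ⟨?_, h4.mono ?_⟩
    · rw [cost, add_mul]
      omega
    · rw [add_mul]
      omega
  | branch r c c' c'' h h' h'' =>
    obtain ⟨K, hK⟩ := h
    obtain ⟨K', hK'⟩ := h'
    obtain ⟨K'', hK''⟩ := h''
    refine ⟨K + K' + K'' + 1, fun l M h => ?_⟩
    have e : (K + K' + K'' + 1) * (M + 1) = K * (M + 1) + K' * (M + 1) + K'' * (M + 1) + (M + 1) := by
      ring
    rw [e]
    simp only [run, cost]
    split
    · exact ⟨by have := (hK l M h).1; omega, (hK l M h).2.mono (by omega)⟩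
    · exact ⟨by have := (hK' l M h).1; omega, (hK' l M h).2.mono (by omega)⟩
    · exact ⟨by have := (hK'' l M h).1; omega, (hK'' l M h).2.mono (by omega)⟩

section Computes

variable {α ι : Type} {ora : α → ι → List Bool → List Bool} {spec : ι → Bool} {i₀ : ι}
  {O : Oracle} {k k' : ℕ} {P Q R : Prog ι} {D D' : Set α} {pre mid post : α → List (List Bool)}

/-- For all parameters `a ∈ D`, the program transforms the contents `pre a` of the registers into
`post a` in polynomial time and with at most `k` queries to oracles `i` with `spec i`. -/
def Computes (ora : α → ι → List Bool → List Bool) (spec : ι → Bool) (k : ℕ) (P : Prog ι)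
    (D : Set α) (pre post : α → List (List Bool)) : Prop :=
  ∃ p : Polynomial ℕ, ∀ a ∈ D, ∀ M, Within M (pre a) → Within (p.eval M) (post a) ∧
    ∃ t ≤ p.eval M, ∃ log, Runs (ora a) P (load (pre a)) t log (load (post a)) ∧
      log.countP (fun e => spec e.1) ≤ k

namespace Computes

theorem of_exec (hi : spec i₀ = false) (p : Polynomial ℕ)
    (h : ∀ a ∈ D, ∀ M, Within M (pre a) → Within (p.eval M) (post a) ∧
      Exec (ora a) i₀ P (load (pre a)) (p.eval M) (load (post a))) :
    Computes ora spec 0 P D pre post := by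
  refine ⟨p, fun a ha M hM => ?_⟩
  obtain ⟨h1, t, ht, log, h2, h3⟩ := h a ha M hM
  refine ⟨h1, t, ht, log, h2, ?_⟩
  rw [Nat.le_zero, List.countP_eq_zero]
  intro e he
  simp [h3 e he, hi]

theorem seq (h : Computes ora spec k P D pre mid) (h' : Computes ora spec k' Q D mid post) :
    Computes ora spec (k + k') (.seq P Q) D pre post := by
  obtain ⟨p, h⟩ := h
  obtain ⟨q, h'⟩ := h'
  refine ⟨p + q.comp p, fun a ha M hM => ?_⟩
  obtain ⟨h1, t, ht, log, h2, h3⟩ := h a ha M hM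
  obtain ⟨h1', t', ht', log', h2', h3'⟩ := h' a ha _ h1
  rw [Polynomial.eval_add, Polynomial.eval_comp]
  refine ⟨h1'.mono (by omega), t + t', by omega, _, .seq h2 h2', ?_⟩
  rw [List.countP_append]
  omega

theorem branch (r : ℕ)
    (hP : Computes ora spec k P {a ∈ D | (pre a).getD r [] = []} pre post)
    (hQ : Computes ora spec k Q {a ∈ D | ∃ l, (pre a).getD r [] = false :: l} pre post)
    (hR : Computes ora spec k R {a ∈ D | ∃ l, (pre a).getD r [] = true :: l} pre post) :
    Computes ora spec k (.branch r P Q R) D pre post := by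
  obtain ⟨p, hp⟩ := hP
  obtain ⟨q, hq⟩ := hQ
  obtain ⟨s, hs⟩ := hR
  refine ⟨p + q + s + 1, fun a ha M hM => ?_⟩
  simp only [Polynomial.eval_add, Polynomial.eval_one]
  match hl : (pre a).getD r [] with
  | [] =>
    obtain ⟨h1, t, ht, log, h2, h3⟩ := hp a ⟨ha, hl⟩ M hM
    exact ⟨h1.mono (by omega), t + 1, by omega, log, .branchNil hl h2, h3⟩
  | false :: l =>
    obtain ⟨h1, t, ht, log, h2, h3⟩ := hq a ⟨ha, l, hl⟩ M hM
    exact ⟨h1.mono (by omega), t + 1, by omega, log, .branchFalse (by rw [load, hl]; rfl) h2, h3⟩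
  | true :: l =>
    obtain ⟨h1, t, ht, log, h2, h3⟩ := hs a ⟨ha, l, hl⟩ M hM
    exact ⟨h1.mono (by omega), t + 1, by omega, log, .branchTrue (by rw [load, hl]; rfl) h2, h3⟩

theorem cmd (hi : spec i₀ = false) (hO : ∀ a ∈ D, ∀ q, ora a i₀ q = [O q]) (c : Cmd) (N : ℕ)
    (hc : c.Ok N = true) (h : ∀ a ∈ D, N ≤ (pre a).length ∧ c.run O (pre a) = post a) :
    Computes ora spec 0 (c.toProg i₀) D pre post := by
  obtain ⟨K, hK⟩ := c.exists_bound O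
  refine of_exec hi (Polynomial.C K * (Polynomial.X + 1)) fun a ha M hM => ?_
  obtain ⟨h1, h2⟩ := hK _ M hM
  simp only [Polynomial.eval_mul, Polynomial.eval_C, Polynomial.eval_add, Polynomial.eval_X,
    Polynomial.eval_one]
  rw [← (h a ha).2]
  exact ⟨h2, (c.exec (hO a ha) hc _ (h a ha).1).mono h1⟩

theorem query (i : ι) (r K : ℕ)
    (h : ∀ a ∈ D, r < (pre a).length ∧ (pre a).set r (ora a i ((pre a).getD r [])) = post a ∧
      (ora a i ((pre a).getD r [])).length ≤ K * ((pre a).getD r []).length) :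
    Computes ora spec 1 (.query i r) D pre post := by
  refine ⟨1 + Polynomial.X + Polynomial.C K * Polynomial.X, fun a ha M hM => ?_⟩
  obtain ⟨h1, h2, h3⟩ := h a ha
  simp only [Polynomial.eval_add, Polynomial.eval_mul, Polynomial.eval_C, Polynomial.eval_X,
    Polynomial.eval_one]
  have h4 := hM.length_getD_le r
  have h5 := h3.trans (Nat.mul_le_mul_left K h4)
  have h6 : Runs (ora a) (.query i r) (load (pre a)) _ _ _ := .query _ i r
  rw [update_load h1, load, h2] at h6
  refine ⟨?_, _, ?_, _, h6, List.countP_le_length⟩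
  · rw [← h2]
    exact (hM.mono (by omega)).set r (by omega)
  · omega

end Computes

end Computes

/-- Registers beyond the list are empty anyway, so the list of arguments may be padded to the number
of registers that the commands address. -/
theorem load_append_replicate (l : List (List Bool)) (k : ℕ) :
    load (l ++ List.replicate k []) = load l := by
  funext r
  simp only [load, List.getD_eq_getElem?_getD]
  by_cases h : r < l.length
  · rw [List.getElem?_append_left h]
  · rw [List.getElem?_append_right (by omega), List.getElem?_eq_none (by omega : l.length ≤ r),
      List.getElem?_replicate]
    split_ifs <;> rfl

namespace Scan

/-- The program of the scanner. -/
def prog {ι : Type} (i₀ : ι) : Prog ι := .loop 0 (Cmd.scanStep.toProg i₀)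

theorem Le.mode_le {S : Scan} {M : ℕ} (h : S.Le M) : S.mode ≤ 11 := h.1

theorem exec_prog {ι : Type} {ora : ι → List Bool → List Bool} {i₀ : ι} {O : Oracle}
    (hO : ∀ q, ora i₀ q = [O q]) {S : Scan} {M : ℕ} (hS : S.Le M) (src sh : List Bool)
    (e : List (List Bool)) :
    Exec ora i₀ (prog i₀) (load (S.regs src sh e))
      (src.length * (40 * (M + src.length * (sh.length + 1)) + 40 * sh.length + 101) + 1)
      (load ((src.foldl (step O sh) S).regs [] sh e)) := by
  induction src generalizing S M with
  | nil => exact (Exec.loopNil rfl).mono (by simp)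
  | cons b src ih =>
    have h1 := Cmd.exec hO Cmd.scanStep Cmd.ok_scanStep (S.regs (b :: src) sh e) (by simp [regs])
    rw [run_scanStep O S hS.mode_le] at h1
    have h2 := Exec.loopCons (by simp [load, regs]) (h1.mono (cost_scanStep_le O hS b src sh e))
      (ih (hS.step O sh b))
    refine h2.mono ?_
    rw [List.length_cons]
    have : M + (src.length + 1) * (sh.length + 1) =
      M + (sh.length + 1) + src.length * (sh.length + 1) := by ring
    rw [this, Nat.succ_mul (src.length) (_ + _)]
    generalize src.length * (sh.length + 1) = z
    omega

theorem computes_prog {α ι : Type} {ora : α → ι → List Bool → List Bool} {spec : ι → Bool} {i₀ : ι}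
    {O : Oracle} {D : Set α} (hi : spec i₀ = false) (hO : ∀ a ∈ D, ∀ q, ora a i₀ q = [O q])
    (S : α → Scan) (hS : ∀ a ∈ D, (S a).mode ≤ 11) (src sh : α → List Bool)
    (e : α → List (List Bool)) :
    Computes ora spec 0 (prog i₀) D (fun a => (S a).regs (src a) (sh a) (e a))
      (fun a => (((src a).foldl (step O (sh a)) (S a)).regs [] (sh a) (e a))) := by
  refine Computes.of_exec hi (Polynomial.X * (40 * (Polynomial.X + Polynomial.X *
    (Polynomial.X + 1)) + 40 * Polynomial.X + 101) + Polynomial.X + 11 +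
      Polynomial.X * (Polynomial.X + 1)) fun a ha M hM => ?_
  have hsrc : (src a).length ≤ M := hM _ (by simp [regs])
  have hsh : (sh a).length ≤ M := hM _ (by simp [regs])
  have hle : (S a).Le M := ⟨hS a ha, hM _ (by simp [regs]), hM _ (by simp [regs]),
    hM _ (by simp [regs]), hM _ (by simp [regs]), hM _ (by simp [regs]), hM _ (by simp [regs]),
    hM _ (by simp [regs]), hM _ (by simp [regs]), hM _ (by simp [regs]), hM _ (by simp [regs])⟩
  have hle' := hle.foldl O (sh a) (src a)
  have h1 : (src a).length * ((sh a).length + 1) ≤ M * (M + 1) := by gcongr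
  have h2 : (src a).length * (40 * (M + (src a).length * ((sh a).length + 1)) +
      40 * (sh a).length + 101) ≤ M * (40 * (M + M * (M + 1)) + 40 * M + 101) := by gcongr
  have he : (Polynomial.X * (40 * (Polynomial.X + Polynomial.X *
      (Polynomial.X + 1)) + 40 * Polynomial.X + 101) + Polynomial.X + 11 +
      Polynomial.X * (Polynomial.X + 1) : Polynomial ℕ).eval M =
      M * (40 * (M + M * (M + 1)) + 40 * M + 101) + M + 11 + M * (M + 1) := by
    simp
  rw [he]
  refine ⟨?_, (exec_prog (hO a ha) hle (src a) (sh a) (e a)).mono (by omega)⟩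
  obtain ⟨g1, g2, g3, g4, g5, g6, g7, g8, g9, g10, g11⟩ := hle'
  intro v hv
  simp only [regs, List.mem_cons] at hv
  rcases hv with rfl | rfl | rfl | rfl | rfl | rfl | rfl | rfl | rfl | rfl | rfl | rfl | rfl | rfl |
    hv
  case inr.inr.inr.inr.inr.inr.inr.inr.inr.inr.inr.inr.inr.inr =>
    have := hM v (by simp [regs, hv])
    omega
  all_goals
    try simp only [List.length_nil, List.length_replicate]
    omega

end Scan

/-! ### Verification of solutions in polynomial time -/

namespace Cmd

/-- Executes a list of commands. -/
def all : List Cmd → Cmd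
  | [] => skip
  | c :: cs => seq c (all cs)

/-- Moves the reversed content of the register `r` to the top of the register `d`. -/
def move (r d : ℕ) : Cmd := pour (fun b => [b]) r d

/-- Replaces the content of the register `r` by as many ones on the top of the register `d`. -/
def unary (r d : ℕ) : Cmd := pour (fun _ => [true]) r d

/-- Branches on whether the register `r` is empty. -/
def ifNil (r : ℕ) (c c' : Cmd) : Cmd := branch r c c' c'

theorem run_ifNil (O : Oracle) (r : ℕ) (c c' : Cmd) (l : List (List Bool)) :
    (ifNil r c c').run O l = if l.getD r [] = [] then c.run O l else c'.run O l := by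
  simp only [ifNil, run]
  generalize l.getD r [] = v
  rcases v with _ | ⟨_ | _, v⟩ <;> simp

theorem run_move (O : Oracle) (r d : ℕ) (l : List (List Bool)) :
    (move r d).run O l = (l.set d ((l.getD r []).reverse ++ l.getD d [])).set r [] := by
  simp [move, run]

theorem run_unary (O : Oracle) (r d : ℕ) (l : List (List Bool)) :
    (unary r d).run O l =
      (l.set d (List.replicate (l.getD r []).length true ++ l.getD d [])).set r [] := by
  have h : ∀ l : List Bool, l.flatMap (fun _ => [true]) = List.replicate l.length true := by
    intro l
    induction l with
    | nil => rfl
    | cons b l ih => simp [ih, List.replicate_succ]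
  simp [unary, run, h]

/-- Clears the working registers of the scanner except for the registers `0`, `3`, `4`, `9`. -/
def reset : Cmd := all [clear 1, clear 2, clear 5, clear 6, clear 7, clear 8, clear 10, clear 11]

/-- Prepares the first run of the scanner on the string in the register `0`, with the inputs in the
register `1`. -/
def pairInit : Cmd := all [move 1 15, dup 15 3, dup 0 14]

/-- Stores the results of the first run of the scanner and prepares the second one. -/
def pairNext : Cmd := all [move 4 16, move 9 17, reset, move 14 0]

end Cmd

/-- The final state of the scanner. -/
def Scan.scan (O : Oracle) (sh s t : List Bool) : Scan := s.foldl (Scan.step O sh) (Scan.start t)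

section Pair

variable {ι : Type} {ora : List Bool × List Bool → ι → List Bool → List Bool} {spec : ι → Bool}
  {i₀ : ι} {O : Oracle}

open Cmd Scan

/-- Evaluates a circuit on two consecutive segments of a string. -/
def pairProg (i₀ : ι) : Prog ι :=
  .seq (pairInit.toProg i₀) (.seq (Scan.prog i₀) (.seq (pairNext.toProg i₀) (Scan.prog i₀)))

/-- The contents of the registers after the evaluation on two segments. -/
def pairRegs (O : Oracle) (k : ℕ) (a : List Bool × List Bool) : List (List Bool) :=
  (scan O [] a.1 (scan O [] a.1 a.2).t).regs [] []
    ([] :: a.2.reverse :: (scan O [] a.1 a.2).xR.reverse :: (scan O [] a.1 a.2).outR.reverse ::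
      List.replicate k [])

theorem computes_pairProg (hi : spec i₀ = false) (hO : ∀ a q, ora a i₀ q = [O q]) (k : ℕ) :
    Computes ora spec 0 (pairProg i₀) Set.univ (fun a => [a.1, a.2] ++ List.replicate (k + 16) [])
      (pairRegs O k) := by
  have h1 : Computes ora spec 0 (pairInit.toProg i₀) Set.univ
      (fun a => [a.1, a.2] ++ List.replicate (k + 16) [])
      (fun a => (start a.2).regs a.1 []
        (a.1.reverse :: a.2.reverse :: [] :: [] :: List.replicate k [])) := by
    refine Computes.cmd hi (fun a _ => hO a) _ 16 (by decide) fun a _ => ⟨by simp, ?_⟩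
    simp [pairInit, all, run, run_move, List.replicate_succ, start, regs]
  have h2 : Computes ora spec 0 (pairNext.toProg i₀) Set.univ
      (fun a => (scan O [] a.1 a.2).regs [] []
        (a.1.reverse :: a.2.reverse :: [] :: [] :: List.replicate k []))
      (fun a => (start (scan O [] a.1 a.2).t).regs a.1 []
        ([] :: a.2.reverse :: (scan O [] a.1 a.2).xR.reverse ::
          (scan O [] a.1 a.2).outR.reverse :: List.replicate k [])) := by
    refine Computes.cmd hi (fun a _ => hO a) _ 18 (by decide) fun a _ => ⟨by simp [regs], ?_⟩
    simp [pairNext, all, run, run_move, reset, start, regs]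
  exact h1.seq ((Scan.computes_prog hi (fun a _ => hO a) _ (by simp [start]) _ _ _).seq (h2.seq
    (Scan.computes_prog hi (fun a _ => hO a) _ (by simp [start]) _ _ _)))

end Pair

namespace Cmd

/-- Accepts if the registers `x` and `b` are empty and `c` and `d` are not, or if `x` is not empty
and `y` is empty. -/
def verdict (x b c d y : ℕ) : Cmd :=
  ifNil x (ifNil b (ifNil c skip (ifNil d skip (push 0 true))) skip) (ifNil y (push 0 true) skip)

theorem run_verdict (O : Oracle) (x b c d y : ℕ) (l : List (List Bool)) :
    ((verdict x b c d y).run O ([] :: l)).getD 0 [] = [true] ↔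
      if ([] :: l).getD x [] = [] then ([] :: l).getD b [] = [] ∧ ([] :: l).getD c [] ≠ [] ∧
        ([] :: l).getD d [] ≠ [] else ([] :: l).getD y [] = [] := by
  simp only [verdict, run_ifNil, run]
  split_ifs <;> simp_all

/-- Checks the results of the evaluation of a circuit on two segments. -/
def collisionCheck : Cmd := all [
  -- Register `19` collects violations of being an instance, `22` violations of being a collision
  -- other than distinctness, and `23` the differences of the two inputs. Register `15` holds the
  -- claimed solution, which must be empty if there is no instance.
  ones 18 11, diff 1 18 19, diff 11 18 19,
  dup 9 18, unary 18 20, push 20 true, dup 2 18, unary 18 21, diff 20 21 19,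
  diff 3 18 22, dup 4 20, unary 20 21, unary 2 20, diff 20 21 22,
  move 9 20, diff 17 20 22, move 4 20, diff 16 20 23, verdict 19 22 23 23 15]

theorem ok_collisionCheck : collisionCheck.Ok 24 = true := by decide

end Cmd

open Cmd Scan in
theorem run_collisionCheck (O : Oracle) (a : List Bool × List Bool) (S S' : Scan)
    (hS : S = scan O [] a.1 a.2) (hS' : S' = scan O [] a.1 S.t) :
    (collisionCheck.run O (pairRegs O 6 a)).getD 0 [] = [true] ↔
      if S'.mode = 11 ∧ S'.restR = [] ∧ S'.outR.length + 1 = S'.n.length then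
        S'.t = [] ∧ S'.xR.length = S'.n.length ∧ S.outR = S'.outR ∧ S.xR ≠ S'.xR
      else a.2 = [] := by
  rw [pairRegs, ← hS, ← hS', show List.replicate 6 ([] : List Bool) = [[], [], [], [], [], []] from rfl]
  simp [collisionCheck, all, run, run_move, run_unary, run_ones, regs, -List.reduceReplicate]
  rw [← List.getD_eq_getElem?_getD, run_verdict]
  simp [diffCount_eq_zero, ← List.replicate_succ, -List.reduceReplicate]
  split_ifs <;> tauto

/-! ### Two runs of the scanner decide `Collision` -/

namespace Scan

theorem scan_code (O : Oracle) (C : Circuit) (rest t : List Bool) :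
    scan O [] (C.code ++ rest) t =
      ⟨11, List.replicate C.inputs true, t.drop C.inputs, (t.take C.inputs).reverse,
        (C.wires O (t.take C.inputs)).reverse, [], [], [], (C.eval O (t.take C.inputs)).reverse,
        (C.shiftedBody 0).reverse, rest.reverse⟩ :=
  foldl_code (s := 0) C rest

theorem exists_of_mode_scan {O : Oracle} {sh s t : List Bool} (h : (scan O sh s t).mode = 11) :
    ∃ (C : Circuit) (rest : List Bool), s = C.code ++ rest :=
  exists_code_of_mode h

end Scan

open Scan in
-- The two runs consume consecutive segments of `t`. If the second one is full and nothing remains,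
-- then `t` splits into two strings of the right length. The parsed data that decide whether `s` is
-- an instance do not depend on `t`.
theorem collision_iff (O : Oracle) (s t : List Bool) (S S' : Scan)
    (hS : S = scan O [] s t) (hS' : S' = scan O [] s S.t) :
    Collision O s t ↔
      if S'.mode = 11 ∧ S'.restR = [] ∧ S'.outR.length + 1 = S'.n.length then
        S'.t = [] ∧ S'.xR.length = S'.n.length ∧ S.outR = S'.outR ∧ S.xR ≠ S'.xR
      else t = [] := by
  have hvalid : (S'.mode = 11 ∧ S'.restR = [] ∧ S'.outR.length + 1 = S'.n.length) ↔
      ∃ C : Circuit, s = C.code ∧ C.IsCollisionInstance := by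
    constructor
    · rintro ⟨h1, h2, h3⟩
      obtain ⟨C, rest, rfl⟩ := exists_of_mode_scan (hS' ▸ h1)
      rw [hS', scan_code] at h2 h3
      simp only [List.reverse_eq_nil_iff] at h2
      refine ⟨C, by simp [h2], ?_⟩
      simpa [Circuit.length_eval, Circuit.IsCollisionInstance] using h3
    · rintro ⟨C, rfl, hC⟩
      rw [hS', ← List.append_nil C.code, scan_code]
      simpa [Circuit.length_eval, Circuit.IsCollisionInstance] using hC
  split_ifs with h <;> rw [hvalid] at h <;> clear hvalid
  · obtain ⟨C, rfl, hC⟩ := id h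
    rw [← List.append_nil C.code, scan_code] at hS
    rw [hS, ← List.append_nil C.code, scan_code] at hS'
    subst hS hS'
    simp only [List.drop_eq_nil_iff, List.length_drop, List.length_reverse,
      List.length_take, List.length_replicate, List.reverse_inj, ne_eq]
    constructor
    · rintro (⟨C', hc, -, x₁, x₂, rfl, h1, h2, h3, h4⟩ | ⟨h', -⟩)
      · obtain rfl := Circuit.code_injective hc
        simp [List.take_left' h1, List.drop_left' h1, List.take_of_length_le h2.le, h1, h2, h3, h4]
      · exact absurd h h'
    · rintro ⟨h1, h2, h3, h4⟩
      refine Or.inl ⟨C, rfl, hC, t.take C.inputs, (t.drop C.inputs).take C.inputs, ?_, ?_, ?_, h4,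
        h3⟩
      · rw [List.take_of_length_le (l := t.drop _) (by simpa using h1), List.take_append_drop]
      · simp
        omega
      · simp
        omega
  · simp only [Collision]
    constructor
    · rintro (⟨C, h1, h2, -⟩ | ⟨-, h'⟩)
      · exact absurd ⟨C, h1, h2⟩ h
      · exact h'
    · exact fun h' => Or.inr ⟨h, h'⟩

theorem polyTime₂_of_computes {O : Oracle} {spec : Unit → Bool} {P : Prog Unit} {n k : ℕ}
    {post : List Bool × List Bool → List (List Bool)}
    (h : Computes (fun _ _ q => [O q]) spec n P Set.univ
      (fun a => [a.1, a.2] ++ List.replicate k []) post) :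
    PolyTime₂ O fun x y => (post (x, y)).getD 0 [] := by
  obtain ⟨p, h⟩ := h
  refine ⟨P, p, fun x y => ?_⟩
  obtain ⟨-, t, ht, log, h1, -⟩ := h (x, y) trivial (x.length + y.length) (by
    intro v hv
    simp only [List.mem_append, List.mem_cons, List.mem_replicate, List.not_mem_nil, or_false] at hv
    rcases hv with (rfl | rfl) | ⟨-, rfl⟩ <;> simp)
  rw [load_append_replicate] at h1
  exact ⟨t, log, _, h1, rfl, ht⟩

theorem tfnp_collision (O : Oracle) : TFNP O (Collision O) := by
  refine ⟨⟨fun x y => (Cmd.collisionCheck.run O (pairRegs O 6 (x, y))).getD 0 [], ?_, ?_⟩, ?_, ?_⟩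
  · have h1 : Computes (fun _ _ q => [O q]) (fun _ => false) 0 (pairProg ()) Set.univ _ _ :=
      computes_pairProg rfl (fun _ _ => rfl) 6
    have h2 := h1.seq (Computes.cmd (i₀ := ()) rfl (fun _ _ _ => rfl) Cmd.collisionCheck 24
      Cmd.ok_collisionCheck fun a _ => ⟨by simp [pairRegs, Scan.regs], rfl⟩)
    have h3 := polyTime₂_of_computes h2
    exact h3
  · intro x y
    rw [run_collisionCheck O (x, y) _ _ rfl rfl]
    exact collision_iff O x y _ _ rfl rfl
  · refine ⟨2 * Polynomial.X, fun x y h => ?_⟩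
    simpa using Collision.length_le h
  · exact collision_total O

/-- Needed to place `Collision` itself in the class. The back translation returns its second
argument and so has to move it to register `0`. -/
theorem manyOneReducible_refl (O : Oracle) (R : SearchProblem) : ManyOneReducible O R R := by
  refine ⟨id, fun _ y => y, ⟨.skip, 1, fun x => ⟨1, [], _, .skip _, rfl, by simp⟩⟩, ?_,
    fun x y h => h⟩
  have h : Computes (fun _ _ q => [O q]) (fun _ => false) 0
      ((Cmd.all [.clear 0, .move 1 2, .move 2 0]).toProg ()) Set.univ
      (fun a : List Bool × List Bool => [a.1, a.2] ++ List.replicate 1 [])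
      (fun a => [a.2, [], []]) :=
    Computes.cmd rfl (fun _ _ _ => rfl) _ 3 (by decide) fun a _ => ⟨by simp, by
      simp [Cmd.all, Cmd.run, Cmd.run_move]⟩
  have h' := polyTime₂_of_computes h
  exact h'

/-! ### Four runs of the scanner decide `NestedCollision` -/

namespace Cmd

/-- Stores the results of the evaluation on two segments, and prepares the run of the scanner on the
rest of the string. -/
def nestedFirst : Cmd := all [move 2 18, move 9 19, move 4 20, move 1 21, move 11 0, dup 0 14,
  clear 3, dup 15 3, reset]

/-- Stores the results of the third run of the scanner, and prepares the fourth one. -/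
def nestedSecond : Cmd := all [move 4 22, move 9 23, dup 20 24, move 24 3, dup 16 24, move 24 3,
  reset, move 14 0]

/-- Checks the results of the four runs of the scanner. -/
def nestedCheck : Cmd := all [
  -- Register `24` collects violations of being an instance, `25` violations of the lengths and the
  -- output equations, `26` the differences of `x` and `y`, and `27` those of the two inputs of the
  -- inner circuit.
  ones 28 11, diff 21 28 24, ones 28 11, diff 1 28 24, diff 11 28 24,
  dup 19 28, unary 28 29, push 29 true, dup 18 28, unary 28 30, diff 29 30 24,
  -- Three copies of `n`, for the condition that the inner circuit has `3n` inputs.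
  dup 18 28, unary 28 29, dup 18 28, unary 28 29, dup 18 28, unary 28 29,
  dup 2 28, unary 28 30, diff 29 30 24,
  dup 9 28, unary 28 29, dup 19 28, unary 28 30, diff 29 30 24,
  diff 3 28 25, dup 4 28, unary 28 29, unary 2 30, diff 29 30 25,
  diff 17 19 25, move 9 28, diff 23 28 25, diff 16 20 26, move 4 28, diff 22 28 27,
  verdict 24 25 26 27 15]

theorem ok_nestedCheck : nestedCheck.Ok 31 = true := by decide

end Cmd

section Nested

open Cmd Scan

variable (O : Oracle) (a : List Bool × List Bool)

/-- The first run of the scanner. -/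
def scan₁ : Scan := scan O [] a.1 a.2

/-- The second run of the scanner. -/
def scan₂ : Scan := scan O [] a.1 (scan₁ O a).t

/-- The third run of the scanner. -/
def scan₃ : Scan := scan O [] (scan₂ O a).restR.reverse a.2

/-- The fourth run of the scanner. -/
def scan₄ : Scan := scan O [] (scan₂ O a).restR.reverse
  ((scan₁ O a).xR.reverse ++ ((scan₂ O a).xR.reverse ++ (scan₃ O a).t))

/-- The contents of the registers after four runs of the scanner. -/
def nestedRegs : List (List Bool) :=
  (scan₄ O a).regs [] [] [[], a.2.reverse, (scan₁ O a).xR.reverse, (scan₁ O a).outR.reverse,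
    (scan₂ O a).n.reverse, (scan₂ O a).outR.reverse, (scan₂ O a).xR.reverse,
    List.replicate (scan₂ O a).mode true, (scan₃ O a).xR.reverse, (scan₃ O a).outR.reverse,
    [], [], [], [], [], [], []]

/-- Evaluates a pair of circuits on the segments of a string. -/
def nestedProg : Prog Unit :=
  .seq (pairProg ()) (.seq (nestedFirst.toProg ()) (.seq (Scan.prog ())
    (.seq (nestedSecond.toProg ()) (Scan.prog ()))))

variable {O a}

theorem computes_nestedProg :
    Computes (fun _ _ q => [O q]) (fun _ => false) 0 nestedProg Set.univ
      (fun a => [a.1, a.2] ++ List.replicate (13 + 16) []) (nestedRegs O) := by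
  have h0 : Computes (fun _ _ q => [O q]) (fun _ => false) 0 (pairProg ()) Set.univ _ _ :=
    computes_pairProg (O := O) rfl (fun _ _ => rfl) 13
  have h1 : Computes (fun _ _ q => [O q]) (fun _ => false) 0 (nestedFirst.toProg ()) Set.univ
      (pairRegs O 13)
      (fun a => (start a.2).regs (scan₂ O a).restR.reverse [] [(scan₂ O a).restR, a.2.reverse,
        (scan₁ O a).xR.reverse, (scan₁ O a).outR.reverse, (scan₂ O a).n.reverse,
        (scan₂ O a).outR.reverse, (scan₂ O a).xR.reverse, List.replicate (scan₂ O a).mode true,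
        [], [], [], [], [], [], [], [], []]) := by
    refine Computes.cmd (O := O) rfl (fun a _ _ => rfl) _ 22 (by decide) fun a _ => ⟨by simp [pairRegs, regs], ?_⟩
    rw [pairRegs, ← scan₁, ← scan₂]
    simp [nestedFirst, all, run, run_move, reset, start, regs]
  have h2 : Computes (fun _ _ q => [O q]) (fun _ => false) 0 (nestedSecond.toProg ()) Set.univ
      (fun a => (scan₃ O a).regs [] [] [(scan₂ O a).restR, a.2.reverse,
        (scan₁ O a).xR.reverse, (scan₁ O a).outR.reverse, (scan₂ O a).n.reverse,
        (scan₂ O a).outR.reverse, (scan₂ O a).xR.reverse, List.replicate (scan₂ O a).mode true,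
        [], [], [], [], [], [], [], [], []])
      (fun a => (start ((scan₁ O a).xR.reverse ++ ((scan₂ O a).xR.reverse ++ (scan₃ O a).t))).regs
        (scan₂ O a).restR.reverse [] [[], a.2.reverse,
        (scan₁ O a).xR.reverse, (scan₁ O a).outR.reverse, (scan₂ O a).n.reverse,
        (scan₂ O a).outR.reverse, (scan₂ O a).xR.reverse, List.replicate (scan₂ O a).mode true,
        (scan₃ O a).xR.reverse, (scan₃ O a).outR.reverse, [], [], [], [], [], [], []]) := by
    refine Computes.cmd (O := O) rfl (fun a _ _ => rfl) _ 25 (by decide) fun a _ => ⟨by simp [regs], ?_⟩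
    simp [nestedSecond, all, run, run_move, reset, start, regs]
  exact h0.seq (h1.seq ((Scan.computes_prog (O := O) rfl (fun _ _ _ => rfl) _ (by simp [start]) _ _ _).seq
    (h2.seq (Scan.computes_prog (O := O) rfl (fun _ _ _ => rfl) _ (by simp [start]) _ _ _))))

theorem run_nestedCheck (O : Oracle) (a : List Bool × List Bool) :
    (nestedCheck.run O (nestedRegs O a)).getD 0 [] = [true] ↔
      if (scan₂ O a).mode = 11 ∧ (scan₄ O a).mode = 11 ∧ (scan₄ O a).restR = [] ∧
          (scan₂ O a).outR.length + 1 = (scan₂ O a).n.length ∧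
          (scan₄ O a).n.length = 3 * (scan₂ O a).n.length ∧
          (scan₄ O a).outR.length = (scan₂ O a).outR.length then
        (scan₄ O a).t = [] ∧ (scan₄ O a).xR.length = (scan₄ O a).n.length ∧
          (scan₁ O a).outR = (scan₂ O a).outR ∧ (scan₃ O a).outR = (scan₄ O a).outR ∧
          (scan₁ O a).xR ≠ (scan₂ O a).xR ∧ (scan₃ O a).xR ≠ (scan₄ O a).xR
      else a.2 = [] := by
  rw [nestedRegs]
  generalize scan₁ O a = S₁, scan₂ O a = S₂, scan₃ O a = S₃, scan₄ O a = S₄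
  simp [nestedCheck, all, run, run_move, run_unary, run_ones, regs, -List.reduceReplicate]
  rw [← List.getD_eq_getElem?_getD, run_verdict]
  simp [diffCount_eq_zero, ← List.replicate_succ, -List.reduceReplicate]
  rw [show S₂.n.length + (S₂.n.length + S₂.n.length) = 3 * S₂.n.length by ring]
  have e : 3 * S₂.n.length = S₄.n.length ↔ S₄.n.length = 3 * S₂.n.length := eq_comm
  split_ifs <;> tauto

theorem scan_code_nil (O : Oracle) (C : Circuit) (t : List Bool) :
    scan O [] C.code t =
      ⟨11, List.replicate C.inputs true, t.drop C.inputs, (t.take C.inputs).reverse,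
        (C.wires O (t.take C.inputs)).reverse, [], [], [], (C.eval O (t.take C.inputs)).reverse,
        (C.shiftedBody 0).reverse, []⟩ := by
  simpa using scan_code O C [] t

/-- The four runs read `x`, `y`, `x y u` and `x y v`. The last input is assembled from the stored
segments and from what the third run leaves over. That it is exactly used up fixes the length of
`v`, and the common prefix `x y` cancels in the comparison. -/
theorem isNestedCollision_iff {F G : Circuit} (h : IsNestedInstance F G) {t : List Bool}
    (ht : a = (F.code ++ G.code, t)) :
    (∃ x y u v, t = x ++ y ++ u ++ v ∧ IsNestedCollision O F G x y u v) ↔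
      (scan₄ O a).t = [] ∧ (scan₄ O a).xR.length = (scan₄ O a).n.length ∧
        (scan₁ O a).outR = (scan₂ O a).outR ∧ (scan₃ O a).outR = (scan₄ O a).outR ∧
        (scan₁ O a).xR ≠ (scan₂ O a).xR ∧ (scan₃ O a).xR ≠ (scan₄ O a).xR := by
  obtain ⟨hF, hG, -⟩ := h
  simp only [scan₄, scan₃, scan₂, scan₁, ht, scan_code, List.reverse_reverse]
  simp only [scan_code_nil, hG]
  simp only [List.drop_eq_nil_iff, List.length_reverse, List.length_take,
    List.length_replicate, List.reverse_inj, ne_eq, List.length_append, List.length_drop]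
  set n := F.inputs with hn
  constructor
  · rintro ⟨x, y, u, v, rfl, ⟨hx, hy, hu, hv⟩, ⟨h1, h2⟩, h3, h4⟩
    rw [← hn] at hx hy hu hv
    have e1 : (x ++ y ++ u ++ v).take n = x := by
      rw [List.append_assoc, List.append_assoc, List.take_left' hx]
    have e2 : ((x ++ y ++ u ++ v).drop n).take n = y := by
      rw [List.append_assoc, List.append_assoc, List.drop_left' hx, List.take_left' hy]
    have e3 : (x ++ y ++ u ++ v).take (3 * n) = x ++ y ++ u := List.take_left' (by simp; omega)
    have e4 : (x ++ y ++ u ++ v).drop (3 * n) = v := List.drop_left' (by simp; omega)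
    have e5 : (x ++ (y ++ v)).take (3 * n) = x ++ y ++ v := by
      rw [← List.append_assoc, List.take_of_length_le (by simp; omega)]
    simp only [e1, e2, e3, e4, e5, List.length_append, hx, hy, hu, hv, h1, h2, h4,
      List.append_cancel_left_eq, h3, not_false_eq_true, and_true]
    omega
  · rintro ⟨h1, h2, h3, h4, h5, h6⟩
    obtain ⟨x, r, rfl, hx⟩ : ∃ x r, t = x ++ r ∧ x.length = n :=
      ⟨t.take n, t.drop n, by simp, by simp; omega⟩
    simp only [List.length_append, List.take_left' hx, List.drop_left' hx] at h1 h2 h3 h4 h5 h6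
    obtain ⟨y, r, rfl, hy⟩ : ∃ y r', r = y ++ r' ∧ y.length = n :=
      ⟨r.take n, r.drop n, by simp, by simp; omega⟩
    simp only [List.length_append, List.take_left' hy] at h1 h2 h3 h4 h5 h6
    obtain ⟨u, v, rfl, hu⟩ : ∃ u v, r = u ++ v ∧ u.length = n :=
      ⟨r.take n, r.drop n, by simp, by simp; omega⟩
    simp only [List.length_append] at h1 h2
    have hv : v.length = n := by omega
    have e3 : (x ++ (y ++ (u ++ v))).take (3 * n) = x ++ y ++ u := by
      rw [← List.append_assoc, ← List.append_assoc, List.take_left' (by simp; omega)]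
    have e4 : (x ++ (y ++ (u ++ v))).drop (3 * n) = v := by
      rw [← List.append_assoc, ← List.append_assoc, List.drop_left' (by simp; omega)]
    have e5 : (x ++ (y ++ v)).take (3 * n) = x ++ y ++ v := by
      rw [← List.append_assoc, List.take_of_length_le (by simp; omega)]
    rw [e3, e4, e5] at h4 h6
    refine ⟨x, y, u, v, by simp, ⟨hx, hy, hu, hv⟩, ⟨h5, h3⟩, fun h => h6 (by rw [h]), h4⟩

theorem nestedCollision_iff (O : Oracle) (s t : List Bool) (ha : a = (s, t)) :
    NestedCollision O s t ↔
      if (scan₂ O a).mode = 11 ∧ (scan₄ O a).mode = 11 ∧ (scan₄ O a).restR = [] ∧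
          (scan₂ O a).outR.length + 1 = (scan₂ O a).n.length ∧
          (scan₄ O a).n.length = 3 * (scan₂ O a).n.length ∧
          (scan₄ O a).outR.length = (scan₂ O a).outR.length then
        (scan₄ O a).t = [] ∧ (scan₄ O a).xR.length = (scan₄ O a).n.length ∧
          (scan₁ O a).outR = (scan₂ O a).outR ∧ (scan₃ O a).outR = (scan₄ O a).outR ∧
          (scan₁ O a).xR ≠ (scan₂ O a).xR ∧ (scan₃ O a).xR ≠ (scan₄ O a).xR
      else t = [] := by
  have hvalid : ((scan₂ O a).mode = 11 ∧ (scan₄ O a).mode = 11 ∧ (scan₄ O a).restR = [] ∧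
          (scan₂ O a).outR.length + 1 = (scan₂ O a).n.length ∧
          (scan₄ O a).n.length = 3 * (scan₂ O a).n.length ∧
          (scan₄ O a).outR.length = (scan₂ O a).outR.length) ↔
      ∃ F G : Circuit, s = F.code ++ G.code ∧ IsNestedInstance F G := by
    constructor
    · rintro ⟨h1, h2, h3, h4, h5, h6⟩
      obtain ⟨F, r, hF⟩ := exists_of_mode_scan h1
      have hr : (scan₂ O a).restR.reverse = r := by
        rw [scan₂, hF, scan_code]
        simp
      obtain ⟨G, r', hG⟩ := exists_of_mode_scan h2
      rw [scan₄, hG, scan_code] at h3 h5 h6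
      rw [scan₂, hF, scan_code] at h4 h5 h6
      simp only [List.reverse_eq_nil_iff] at h3
      simp only [List.length_reverse, Circuit.length_eval, List.length_replicate] at h4 h5 h6
      refine ⟨F, G, ?_, h4, h5, h6⟩
      rw [ha] at hF
      rw [hr, h3, List.append_nil] at hG
      rw [← hG, ← hF]
    · rintro ⟨F, G, rfl, h1, h2, h3⟩
      simp only [scan₄, scan₂, ha, scan_code, List.reverse_reverse]
      simp only [scan_code_nil]
      simp only [List.length_reverse, Circuit.length_eval, List.length_replicate]
      simp [h1, h2, h3]
  split_ifs with h <;> rw [hvalid] at h <;> clear hvalid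
  · obtain ⟨F, G, rfl, hFG⟩ := id h
    rw [← isNestedCollision_iff hFG ha]
    constructor
    · rintro (⟨F', G', hc, -, h'⟩ | ⟨h', -⟩)
      · obtain ⟨rfl, hG⟩ := Circuit.code_append_inj hc
        obtain rfl := Circuit.code_injective hG
        exact h'
      · exact absurd h h'
    · exact fun h' => Or.inl ⟨F, G, rfl, hFG, h'⟩
  · constructor
    · rintro (⟨F, G, h1, h2, -⟩ | ⟨-, h'⟩)
      · exact absurd ⟨F, G, h1, h2⟩ h
      · exact h'
    · exact fun h' => Or.inr ⟨h, h'⟩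

theorem nestedCollision_total (O : Oracle) (s : List Bool) : ∃ t, NestedCollision O s t := by
  by_cases h : ∃ F G : Circuit, s = F.code ++ G.code ∧ IsNestedInstance F G
  · obtain ⟨F, G, hs, hFG⟩ := h
    obtain ⟨x, y, hx, hy, hne, he⟩ := exists_isCollision (C := F) O hFG.1
    have hcard : (boolLists G.outputs.length).card < (boolLists F.inputs).card := by
      rw [card_boolLists, card_boolLists]
      have := hFG.1
      have := hFG.2.2
      exact Nat.pow_lt_pow_right (by norm_num) (by omega)
    obtain ⟨u, hu, v, hv, huv, h⟩ := Finset.exists_ne_map_eq_of_card_lt_of_maps_to hcard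
      (f := fun u => G.eval O (x ++ y ++ u)) fun u _ => by simp [Circuit.length_eval]
    exact ⟨_, .inl ⟨F, G, hs, hFG, x, y, u, v, rfl,
      ⟨hx, hy, mem_boolLists.1 hu, mem_boolLists.1 hv⟩, ⟨hne, he⟩, huv, h⟩⟩
  · exact ⟨_, .inr ⟨h, rfl⟩⟩

theorem NestedCollision.length_le {s t : List Bool} (h : NestedCollision O s t) :
    t.length ≤ 4 * s.length := by
  rcases h with ⟨F, G, rfl, -, x, y, u, v, rfl, ⟨hx, hy, hu, hv⟩, -⟩ | ⟨-, rfl⟩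
  · have := F.inputs_add_length_gates_le
    simp only [List.length_append]
    omega
  · simp

theorem tfnp_nestedCollision (O : Oracle) : TFNP O (NestedCollision O) := by
  refine ⟨⟨fun x y => (nestedCheck.run O (nestedRegs O (x, y))).getD 0 [], ?_, ?_⟩, ?_, ?_⟩
  · have h := (computes_nestedProg (O := O)).seq (Computes.cmd (i₀ := ()) rfl (fun _ _ _ => rfl)
      nestedCheck 31 ok_nestedCheck fun a _ => ⟨by simp [nestedRegs, Scan.regs], rfl⟩)
    have h' := polyTime₂_of_computes h
    exact h'
  · intro x y
    rw [run_nestedCheck O (x, y)]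
    exact nestedCollision_iff O x y rfl
  · refine ⟨4 * Polynomial.X, fun x y h => ?_⟩
    simpa using NestedCollision.length_le h
  · exact nestedCollision_total O

end Nested

/-! ### The adaptive reduction -/

namespace Computes

variable {α ι : Type} {ora : α → ι → List Bool → List Bool} {spec : ι → Bool} {i₀ : ι}
  {O : Oracle} {k k' : ℕ} {P Q R : Prog ι} {D D' : Set α} {pre pre' post post' : α → List (List Bool)}

theorem congr (h : Computes ora spec k P D pre post) (hD : D' ⊆ D)
    (hpre : ∀ a ∈ D', pre a = pre' a) (hpost : ∀ a ∈ D', post a = post' a) (hk : k ≤ k') :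
    Computes ora spec k' P D' pre' post' := by
  obtain ⟨p, h⟩ := h
  refine ⟨p, fun a ha M hM => ?_⟩
  rw [← hpost a ha]
  rw [← hpre a ha] at hM ⊢
  replace ha := hD ha
  obtain ⟨h1, t, ht, log, h2, h3⟩ := h a ha M hM
  exact ⟨h1, t, ht, log, h2, h3.trans hk⟩

theorem skip : Computes ora spec k .skip D pre pre :=
  ⟨Polynomial.X + 1, fun a _ M hM => ⟨hM.mono (by simp), 1, by simp, [], .skip _, by simp⟩⟩

/-- A loop that counts down a number in unary in the register `r`. -/
theorem loop (hi : spec i₀ = false) (hO : ∀ a ∈ D, ∀ q, ora a i₀ q = [O q]) (r : ℕ) (c : Cmd)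
    (N : ℕ) (hc : c.Ok N = true) (st : α → ℕ → List (List Bool)) (len : α → ℕ) (p : Polynomial ℕ)
    (hN : ∀ a i, N ≤ (st a i).length) (hr : ∀ a i, (st a i).getD r [] = List.replicate i true)
    (hrun : ∀ a ∈ D, ∀ i < len a, c.run O (st a (i + 1)) = st a i)
    (hp : ∀ a ∈ D, ∀ M, Within M (st a (len a)) → ∀ i ≤ len a, Within (p.eval M) (st a i)) :
    Computes ora spec 0 (.loop r (c.toProg i₀)) D (fun a => st a (len a)) (fun a => st a 0) := by
  obtain ⟨K, hK⟩ := c.exists_bound O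
  refine of_exec hi (Polynomial.X * (Polynomial.C K * (p + 1) + 1) + 1 + p) fun a ha M hM => ?_
  have hlen : len a ≤ M := by
    have := hM.length_getD_le r
    rwa [hr, List.length_replicate] at this
  have h : ∀ i ≤ len a, Exec (ora a) i₀ (.loop r (c.toProg i₀)) (load (st a i))
      (i * (K * (p.eval M + 1) + 1) + 1) (load (st a 0)) := by
    intro i hi
    induction i with
    | zero => exact (Exec.loopNil (hr a 0)).mono (by simp)
    | succ i ih =>
      have h1 := c.exec (hO a ha) hc (st a (i + 1)) (hN a _)
      rw [hrun a ha i hi] at h1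
      have h2 := Exec.loopCons (by rw [load, hr]; simp)
        (h1.mono (hK _ _ (hp a ha M hM _ hi)).1) (ih (by omega))
      refine h2.mono ?_
      rw [Nat.succ_mul]
      omega
  have h1 := hp a ha M hM 0 (by omega)
  have h2 := Nat.mul_le_mul_right (K * (p.eval M + 1) + 1) hlen
  simp only [Polynomial.eval_mul, Polynomial.eval_C, Polynomial.eval_add, Polynomial.eval_X,
    Polynomial.eval_one]
  exact ⟨h1.mono (by omega), (h _ le_rfl).mono (by omega)⟩

end Computes

namespace Cmd

/-- Stores the results for the first circuit and prepares the scanning of the second one. -/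
def reduceFirst : Cmd := all [move 1 14, move 2 15, move 9 16, move 10 17, move 11 0, dup 15 13,
  clear 3, clear 4, reset]

/-- Tests whether the scanned string is an instance of `NestedCollision`. -/
def reduceCheck : Cmd := all [
  ones 19 11, diff 14 19 18, ones 19 11, diff 1 19 18, diff 11 19 18,
  dup 16 19, unary 19 20, push 20 true, dup 15 19, unary 19 21, diff 20 21 18,
  dup 15 19, unary 19 20, dup 15 19, unary 19 20, dup 15 19, unary 19 20, unary 2 21, diff 20 21 18,
  unary 9 20, unary 16 21, diff 20 21 18,
  clear 3, clear 4, clear 5, clear 6, clear 7, clear 8, clear 13]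

/-- Prepares the first query. -/
def queryFirst : Cmd := all [move 17 19, move 19 0, push 0 false, dup 15 0]

/-- Stores the answer to the first query and prepares the loop for the negations. -/
def storeFirst : Cmd := all [move 0 19, move 10 0, dup 15 21, unary 21 20]

/-- Prepends the description of a gate that negates the input with the number in the register
`20`. -/
def negGate : Cmd := all [pop 20, push 0 false, dup 20 0, push 0 false, dup 20 0, push 0 false,
  push 0 true, push 0 true]

/-- Prepares the second query. -/
def querySecond : Cmd := all [dup 19 21, move 21 22, pour (fun b => [b, false, true]) 22 0,
  push 0 false, dup 15 0]

/-- Combines the answers to both queries. -/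
def combine : Cmd := all [pour (fun b => [!b]) 0 21, move 21 0, move 19 0]

end Cmd

open Cmd Scan

/-- The descriptions of the gates that negate the inputs `i, …, i + k - 1`. -/
def negCode (i k : ℕ) : List Bool := (List.range' i k).flatMap fun j => true :: (Gate.nand j j).code

/-- The part of the reduction that makes the two queries. -/
def reductionMain : Prog Bool :=
  .seq (queryFirst.toProg false) (.seq (.query true 0) (.seq (storeFirst.toProg false)
    (.seq (.loop 20 (negGate.toProg false)) (.seq (querySecond.toProg false)
      (.seq (.query true 0) (combine.toProg false))))))

/-- The reduction of `NestedCollision` to `Collision`. -/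
def reduction : Prog Bool :=
  .seq (Scan.prog false) (.seq (reduceFirst.toProg false) (.seq (Scan.prog false)
    (.seq (reduceCheck.toProg false) (.branch 18 reductionMain .skip .skip))))

section Reduction

variable (O : Oracle) (a : (List Bool → List Bool) × List Bool)

/-- The result of scanning the first circuit. -/
def scanF : Scan := scan O [] a.2 []

/-- The result of scanning the second circuit. -/
def scanG : Scan := scan O (scanF O a).n (scanF O a).restR.reverse []

/-- The first query. -/
def codeF : List Bool := (scanF O a).n ++ false :: (scanF O a).hR.reverse

/-- The second query. -/
def codeH : List Bool := (scanF O a).n ++ false ::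
  ((a.1 (codeF O a)).flatMap (fun b => [true, false, b]) ++
    (negCode 0 (scanF O a).n.length ++ (scanG O a).hR.reverse))

/-- The number of violated conditions for an instance of `NestedCollision`. -/
def violations : ℕ :=
  diffCount (List.replicate (scanG O a).outR.length true)
    (List.replicate (scanF O a).outR.length true) +
  (diffCount (List.replicate (3 * (scanF O a).n.length) true)
    (List.replicate (scanG O a).n.length true) +
  (diffCount (List.replicate ((scanF O a).outR.length + 1) true)
    (List.replicate (scanF O a).n.length true) +
  (diffCount (scanG O a).restR [] +
  (diffCount (List.replicate (scanG O a).mode true) (List.replicate 11 true) +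
  diffCount (List.replicate (scanF O a).mode true) (List.replicate 11 true)))))

/-- The contents of the registers of the reduction after scanning. -/
def reduceRegs (w h n b f t c : List Bool) : List (List Bool) :=
  [w, [], [], [], [], [], [], [], [], [], h, [], [], [], [], n, [], b, f, t, c, [], []]

theorem run_reduceFirst :
    reduceFirst.run O ((scanF O a).regs [] [] [[], [], [], [], [], [], [], [], []]) =
      (start []).regs (scanF O a).restR.reverse (scanF O a).n
        [List.replicate (scanF O a).mode true, (scanF O a).n.reverse, (scanF O a).outR.reverse,
          (scanF O a).hR.reverse, [], [], [], [], []] := by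
  simp [reduceFirst, all, run, run_move, reset, start, regs]

theorem run_reduceCheck :
    reduceCheck.run O ((scanG O a).regs [] (scanF O a).n
        [List.replicate (scanF O a).mode true, (scanF O a).n.reverse, (scanF O a).outR.reverse,
          (scanF O a).hR.reverse, [], [], [], [], []]) =
      reduceRegs [] (scanG O a).hR (scanF O a).n.reverse (scanF O a).hR.reverse
        (List.replicate (violations O a) true) [] [] := by
  have e : 3 * (scanF O a).n.length = (scanF O a).n.length + ((scanF O a).n.length +
    (scanF O a).n.length) := by ring
  rw [violations, e, List.replicate_succ]
  generalize scanF O a = S, scanG O a = S'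
  simp [reduceCheck, all, run, run_unary, run_ones, regs, -List.reduceReplicate,
    reduceRegs]

theorem run_queryFirst (w h n b : List Bool) :
    queryFirst.run O (reduceRegs w h n b [] [] []) =
      reduceRegs (n.reverse ++ false :: (b ++ w)) h n [] [] [] [] := by
  simp [queryFirst, all, run, run_move, reduceRegs]

theorem run_storeFirst (w h n : List Bool) :
    storeFirst.run O (reduceRegs w h n [] [] [] []) =
      reduceRegs h.reverse [] n [] [] w.reverse (List.replicate n.length true) := by
  simp [storeFirst, all, run, run_move, run_unary, reduceRegs]

theorem run_negGate (w n t : List Bool) (i : ℕ) :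
    negGate.run O (reduceRegs w [] n [] [] t (List.replicate (i + 1) true)) =
      reduceRegs (true :: (Gate.nand i i).code ++ w) [] n [] [] t (List.replicate i true) := by
  simp [negGate, all, run, reduceRegs, Gate.code, encNat, List.replicate_succ]

theorem run_querySecond (w n t : List Bool) :
    querySecond.run O (reduceRegs w [] n [] [] t []) =
      reduceRegs (n.reverse ++ false :: (t.reverse.flatMap (fun b => [true, false, b]) ++ w)) [] n []
        [] t [] := by
  simp [querySecond, all, run, run_move, reduceRegs, List.reverse_flatMap, Function.comp_def]

theorem run_combine (w n t : List Bool) :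
    combine.run O (reduceRegs w [] n [] [] t []) =
      reduceRegs (t.reverse ++ w.map (! ·)) [] n [] [] [] [] := by
  simp [combine, all, run, run_move, reduceRegs, List.map_eq_flatMap]

theorem negCode_succ (i k : ℕ) :
    negCode i (k + 1) = true :: (Gate.nand i i).code ++ negCode (i + 1) k := by
  simp [negCode, List.range'_succ]

theorem length_negCode_le (i k : ℕ) : (negCode i k).length ≤ k * (2 * (i + k) + 5) := by
  induction k generalizing i with
  | zero => simp [negCode]
  | succ k ih =>
    have h := ih (i + 1)
    have h2 : (true :: (Gate.nand i i).code).length = 2 * i + 5 := by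
      simp [Gate.code, encNat]
      omega
    rw [negCode_succ, List.length_append, h2, Nat.succ_mul k, show i + (k + 1) = i + 1 + k by omega]
    omega

variable {O}

theorem computes_negGates (w n t : (List Bool → List Bool) × List Bool → List Bool)
    (len : (List Bool → List Bool) × List Bool → ℕ)
    (D : Set ((List Bool → List Bool) × List Bool)) :
    Computes (fun a => withSolver O a.1) id 0 (.loop 20 (negGate.toProg false)) D
      (fun a => reduceRegs (w a) [] (n a) [] [] (t a) (List.replicate (len a) true))
      (fun a => reduceRegs (negCode 0 (len a) ++ w a) [] (n a) [] [] (t a) []) := by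
  have h := Computes.loop (ora := fun a => withSolver O a.1) (spec := id) (i₀ := false) (D := D)
    (O := O) rfl (fun _ _ _ => rfl) 20 negGate 23 (by decide)
    (fun a i => reduceRegs (negCode i (len a - i) ++ w a) [] (n a) [] [] (t a)
      (List.replicate i true)) len (Polynomial.X * (2 * Polynomial.X + 5) + Polynomial.X)
    (fun a i => by simp [reduceRegs]) (fun a i => by simp [reduceRegs])
    (fun a _ i hi => by
      rw [run_negGate]
      congr 1
      have : len a - i = (len a - (i + 1)) + 1 := by omega
      rw [this, negCode_succ, List.append_assoc])
    (fun a _ M hM i hi => by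
      have h1 : (List.replicate (len a) true).length ≤ M := hM _ (by simp [reduceRegs])
      rw [List.length_replicate] at h1
      have h2 : (w a).length ≤ M := hM _ (by simp [reduceRegs, negCode])
      have h3 := length_negCode_le i (len a - i)
      have h4 : (len a - i) * (2 * (i + (len a - i)) + 5) ≤ M * (2 * M + 5) :=
        Nat.mul_le_mul (by omega) (by omega)
      have h5 : (n a).length ≤ M := hM _ (by simp [reduceRegs])
      have h6 : (t a).length ≤ M := hM _ (by simp [reduceRegs])
      simp only [Polynomial.eval_mul, Polynomial.eval_add, Polynomial.eval_X,
        Polynomial.eval_ofNat]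
      intro v hv
      simp only [reduceRegs, List.mem_cons, List.not_mem_nil, or_false] at hv
      have hv' : v = negCode i (len a - i) ++ w a ∨ v = n a ∨ v = t a ∨
          v = List.replicate i true ∨ v = [] := by tauto
      rcases hv' with rfl | rfl | rfl | rfl | rfl
      · rw [List.length_append]
        omega
      · omega
      · omega
      · rw [List.length_replicate]
        omega
      · simp)
  simpa [negCode] using h

theorem computes_reduction :
    Computes (fun a => withSolver O a.1) id 2 reduction {a | Solves a.1 (Collision O)}
      (fun a => [a.2] ++ List.replicate 22 [])
      (fun a => if violations O a = 0 then
          reduceRegs (a.1 (codeF O a) ++ (a.1 (codeH O a)).map (! ·)) [] (scanF O a).n.reverse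
            [] [] [] []
        else reduceRegs [] (scanG O a).hR (scanF O a).n.reverse (scanF O a).hR.reverse
          (List.replicate (violations O a) true) [] []) := by
  have hO : ∀ (a : (List Bool → List Bool) × List Bool) (q : List Bool),
    withSolver O a.1 false q = [O q] := fun _ _ => rfl
  have hlen : ∀ a : (List Bool → List Bool) × List Bool, Solves a.1 (Collision O) → ∀ q,
    (withSolver O a.1 true q).length ≤ 2 * q.length := fun a ha q => Collision.length_le (ha q)
  set ora := fun a : (List Bool → List Bool) × List Bool => withSolver O a.1 with hora
  set D := {a : (List Bool → List Bool) × List Bool | Solves a.1 (Collision O)} with hD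
  have h1 : Computes ora id 0 (Scan.prog false) D
      (fun a => (start []).regs a.2 [] [[], [], [], [], [], [], [], [], []])
      (fun a => (scanF O a).regs [] [] [[], [], [], [], [], [], [], [], []]) :=
    Scan.computes_prog (O := O) rfl (fun a _ => hO a) _ (by simp [start]) _ _ _
  have h2 : Computes ora id 0 (reduceFirst.toProg false) D _ _ :=
    Computes.cmd (O := O) rfl (fun a _ => hO a) reduceFirst 23 (by decide)
      fun a _ => ⟨by simp [regs], run_reduceFirst O a⟩
  have h3 : Computes ora id 0 (Scan.prog false) D _
      (fun a => (scanG O a).regs [] (scanF O a).n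
        [List.replicate (scanF O a).mode true, (scanF O a).n.reverse, (scanF O a).outR.reverse,
          (scanF O a).hR.reverse, [], [], [], [], []]) :=
    Scan.computes_prog (O := O) rfl (fun a _ => hO a) _ (by simp [start]) _ _ _
  have h4 : Computes ora id 0 (reduceCheck.toProg false) D _ _ :=
    Computes.cmd (O := O) rfl (fun a _ => hO a) reduceCheck 23 (by decide)
      fun a _ => ⟨by simp [regs], run_reduceCheck O a⟩
  have g1 : Computes ora id 0 (queryFirst.toProg false) D
      (fun a => reduceRegs [] (scanG O a).hR (scanF O a).n.reverse (scanF O a).hR.reverse [] [] [])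
      (fun a => reduceRegs (codeF O a) (scanG O a).hR (scanF O a).n.reverse [] [] [] []) :=
    Computes.cmd (O := O) rfl (fun a _ => hO a) queryFirst 23 (by decide)
      fun a _ => ⟨by simp [reduceRegs], by
        rw [run_queryFirst, codeF, List.reverse_reverse, List.append_nil]⟩
  have g2 : Computes ora id 1 (.query true 0) D
      (fun a => reduceRegs (codeF O a) (scanG O a).hR (scanF O a).n.reverse [] [] [] [])
      (fun a => reduceRegs (a.1 (codeF O a)) (scanG O a).hR (scanF O a).n.reverse [] [] [] []) :=
    Computes.query true 0 2 fun a ha => ⟨by simp [reduceRegs], rfl, hlen a ha _⟩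
  have g3 : Computes ora id 0 (storeFirst.toProg false) D _ _ :=
    Computes.cmd (O := O) rfl (fun a _ => hO a) storeFirst 23 (by decide)
      fun a _ => ⟨by simp [reduceRegs], run_storeFirst O (a.1 (codeF O a)) (scanG O a).hR
        (scanF O a).n.reverse⟩
  have g4 : Computes ora id 0 (.loop 20 (negGate.toProg false)) D _ _ :=
    computes_negGates (fun a => (scanG O a).hR.reverse) (fun a => (scanF O a).n.reverse)
      (fun a => (a.1 (codeF O a)).reverse) (fun a => (scanF O a).n.reverse.length) D
  have g5 : Computes ora id 0 (querySecond.toProg false) D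
      (fun a => reduceRegs (negCode 0 (scanF O a).n.reverse.length ++ (scanG O a).hR.reverse) []
        (scanF O a).n.reverse [] [] (a.1 (codeF O a)).reverse [])
      (fun a => reduceRegs (codeH O a) [] (scanF O a).n.reverse [] [] (a.1 (codeF O a)).reverse []) :=
    Computes.cmd (O := O) rfl (fun a _ => hO a) querySecond 23 (by decide)
      fun a _ => ⟨by simp [reduceRegs], by
        rw [run_querySecond, codeH]
        simp only [List.reverse_reverse, List.length_reverse]⟩
  have g6 : Computes ora id 1 (.query true 0) D
      (fun a => reduceRegs (codeH O a) [] (scanF O a).n.reverse [] [] (a.1 (codeF O a)).reverse [])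
      (fun a => reduceRegs (a.1 (codeH O a)) [] (scanF O a).n.reverse [] []
        (a.1 (codeF O a)).reverse []) :=
    Computes.query true 0 2 fun a ha => ⟨by simp [reduceRegs], rfl, hlen a ha _⟩
  have g7 : Computes ora id 0 (combine.toProg false) D _ _ :=
    Computes.cmd (O := O) rfl (fun a _ => hO a) combine 23 (by decide)
      fun a _ => ⟨by simp [reduceRegs], run_combine O (a.1 (codeH O a)) (scanF O a).n.reverse
        (a.1 (codeF O a)).reverse⟩
  have hmain := g1.seq (g2.seq (g3.seq (g4.seq (g5.seq (g6.seq g7)))))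
  have h5 : Computes ora id 2 (.branch 18 reductionMain .skip .skip) D
      (fun a => reduceRegs [] (scanG O a).hR (scanF O a).n.reverse (scanF O a).hR.reverse
        (List.replicate (violations O a) true) [] [])
      (fun a => if violations O a = 0 then
          reduceRegs (a.1 (codeF O a) ++ (a.1 (codeH O a)).map (! ·)) [] (scanF O a).n.reverse
            [] [] [] []
        else reduceRegs [] (scanG O a).hR (scanF O a).n.reverse (scanF O a).hR.reverse
          (List.replicate (violations O a) true) [] []) := by
    refine Computes.branch 18 (hmain.congr (fun a ha => ha.1) ?_ ?_ (by norm_num))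
      (Computes.skip.congr (D := D) (k := 2) (fun a ha => ha.1) (fun _ _ => rfl) ?_ le_rfl)
      (Computes.skip.congr (D := D) (k := 2) (fun a ha => ha.1) (fun _ _ => rfl) ?_ le_rfl)
    · rintro a ⟨-, ha⟩
      have ha' : violations O a = 0 := by simpa [reduceRegs] using ha
      simp only [ha', List.replicate_zero]
    · rintro a ⟨-, ha⟩
      have ha' : violations O a = 0 := by simpa [reduceRegs] using ha
      simp only [ha', if_true, List.reverse_reverse]
    · rintro a ⟨-, l, ha⟩
      have ha' : violations O a ≠ 0 := fun h => by simp [reduceRegs, h] at ha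
      rw [if_neg ha']
    · rintro a ⟨-, l, ha⟩
      have ha' : violations O a ≠ 0 := fun h => by simp [reduceRegs, h] at ha
      rw [if_neg ha']
  exact h1.seq (h2.seq (h3.seq (h4.seq h5)))

end Reduction

/-! ### Correctness of the adaptive reduction -/

/-- The circuit that maps `u ∈ {0,1}ⁿ` to `G(t, ū)`, where `ū` is the complement of `u`. -/
def Circuit.restrict (G : Circuit) (n : ℕ) (t : List Bool) : Circuit where
  inputs := n
  -- The wires after the `n` inputs carry `t` and then `ū`, which is the input of `G` moved by `n`
  -- positions. So shifting all wire numbers of `G` by `n` suffices. The complement appears because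
  -- a single `NAND` gate negates its input and cannot copy it; the reduction flips the answer back.
  gates := t.map Gate.const ++ ((List.range n).map (fun j => Gate.nand j j) ++
    G.gates.map (Gate.shift n))
  outputs := G.outputs.map (n + ·)

theorem foldl_const (O : Oracle) (t w : List Bool) :
    (t.map Gate.const).foldl (fun w g => w ++ [g.eval O w]) w = w ++ t := by
  induction t generalizing w with
  | nil => simp
  | cons b t ih =>
    rw [List.map_cons, List.foldl_cons, ih]
    simp [Gate.eval]

theorem foldl_neg (O : Oracle) {u : List Bool} (t : List Bool) {k : ℕ} (hk : k ≤ u.length) :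
    ((List.range k).map fun j => Gate.nand j j).foldl (fun w g => w ++ [g.eval O w]) (u ++ t) =
      u ++ (t ++ (u.take k).map (! ·)) := by
  induction k with
  | zero => simp
  | succ k ih =>
    rw [List.range_succ, List.map_append, List.foldl_append, ih (by omega)]
    have h : wire (u ++ (t ++ (u.take k).map (! ·))) k = u[k] := by
      rw [wire, List.getD_eq_getElem?_getD, List.getElem?_append_left hk,
        List.getElem?_eq_getElem hk]
      rfl
    simp only [List.map_cons, List.map_nil, List.foldl_cons, List.foldl_nil, Gate.eval, h,
      Bool.and_self]
    rw [List.take_succ_eq_append_getElem hk, List.map_append]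
    simp only [List.append_assoc, List.map_cons, List.map_nil]

theorem wire_append {u : List Bool} {n : ℕ} (hu : u.length = n) (w : List Bool) (i : ℕ) :
    wire (u ++ w) (n + i) = wire w i := by
  rw [wire, List.getD_append_right _ _ _ _ (by omega), hu, Nat.add_sub_cancel_left, wire]

theorem Gate.eval_shift (O : Oracle) {u : List Bool} {n : ℕ} (hu : u.length = n) (w : List Bool)
    (g : Gate) : (g.shift n).eval O (u ++ w) = g.eval O w := by
  cases g with
  | const b => rfl
  | nand i j => simp only [shift, eval, wire_append hu]
  | oracle args => simp only [shift, eval, List.map_map, Function.comp_def, wire_append hu]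

theorem foldl_shift (O : Oracle) {u : List Bool} {n : ℕ} (hu : u.length = n) (w : List Bool)
    (gates : List Gate) : (gates.map (Gate.shift n)).foldl (fun w g => w ++ [g.eval O w]) (u ++ w) =
      u ++ gates.foldl (fun w g => w ++ [g.eval O w]) w := by
  induction gates generalizing w with
  | nil => rfl
  | cons g gates ih =>
    rw [List.map_cons, List.foldl_cons, Gate.eval_shift O hu, List.append_assoc, ih, List.foldl_cons]

theorem Circuit.eval_restrict (O : Oracle) (G : Circuit) {u : List Bool} {n : ℕ} (hu : u.length = n)
    (t : List Bool) : (G.restrict n t).eval O u = G.eval O (t ++ u.map (! ·)) := by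
  rw [Circuit.eval, restrict, List.foldl_append, List.foldl_append, foldl_const,
    foldl_neg O t hu.ge, foldl_shift O hu, ← hu, List.take_length]
  simp only [List.map_map, Function.comp_def, wire_append rfl]
  rfl

theorem Gate.shift_zero : Gate.shift 0 = id := by
  funext g
  cases g <;> simp [shift]

theorem Circuit.code_eq (C : Circuit) : C.code = encNat C.inputs ++ C.shiftedBody 0 := by
  simp [code, shiftedBody, Gate.shift_zero]

theorem Circuit.code_restrict (G : Circuit) (n : ℕ) (t : List Bool) :
    (G.restrict n t).code = encNat n ++ (t.flatMap (fun b => [true, false, b]) ++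
      (negCode 0 n ++ G.shiftedBody n)) := by
  simp [code, restrict, shiftedBody, encList, negCode, List.range_eq_range', List.flatMap_map,
    Gate.code]

/-! ### The strings written by the reduction are the intended circuits -/

open Scan

theorem scan_code_replicate (O : Oracle) (C : Circuit) (n : ℕ) (t : List Bool) :
    scan O (List.replicate n true) C.code t =
      ⟨11, List.replicate C.inputs true, t.drop C.inputs, (t.take C.inputs).reverse,
        (C.wires O (t.take C.inputs)).reverse, [], [], [], (C.eval O (t.take C.inputs)).reverse,
        (C.shiftedBody n).reverse, []⟩ := by
  have := foldl_code (O := O) (s := n) (t := t) C []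
  rwa [List.append_nil] at this

section

variable {O : Oracle} {a : (List Bool → List Bool) × List Bool}

theorem codeF_eq {F G : Circuit} (h : a.2 = F.code ++ G.code) : codeF O a = F.code := by
  rw [codeF, scanF, h, scan_code, F.code_eq]
  simp [encNat]

theorem codeH_eq {F G : Circuit} (h : a.2 = F.code ++ G.code) :
    codeH O a = (G.restrict F.inputs (a.1 F.code)).code := by
  rw [codeH, codeF_eq h, scanG, scanF, h, scan_code]
  simp only [List.reverse_reverse, scan_code_replicate]
  rw [Circuit.code_restrict]
  simp [encNat]

/-- Both scans end in mode `11` exactly when the string starts with two circuit codes. The remaining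
summands compare the lengths and check that nothing follows. -/
theorem violations_eq_zero : violations O a = 0 ↔
    ∃ F G : Circuit, a.2 = F.code ++ G.code ∧ IsNestedInstance F G := by
  simp only [violations, Nat.add_eq_zero_iff, diffCount_eq_zero, List.replicate_inj, and_true,
    or_true]
  constructor
  · rintro ⟨h1, h2, h3, h4, h5, h6⟩
    obtain ⟨F, r, hF⟩ := exists_of_mode_scan h6
    have hf : scanF O a = scan O [] (F.code ++ r) [] := by rw [scanF, hF]
    rw [scan_code] at hf
    obtain ⟨G, r', hG⟩ := exists_of_mode_scan h5
    have hr : r = G.code ++ r' := by simpa [hf] using hG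
    have hg : scanG O a = scan O (List.replicate F.inputs true) (G.code ++ r') [] := by
      rw [scanG, hf]
      simp [hr]
    rw [scan, foldl_code] at hg
    simp only [hf, hg, List.length_reverse, Circuit.length_eval, List.length_replicate,
      List.reverse_eq_nil_iff] at h1 h2 h3 h4
    subst h4
    rw [List.append_nil] at hr
    exact ⟨F, G, by rw [hF, hr], h3, h2.symm, h1⟩
  · rintro ⟨F, G, h, h1, h2, h3⟩
    simp only [scanG, scanF, h, scan_code, List.reverse_reverse, scan_code_replicate]
    simp [Circuit.length_eval, h1, h2, h3]

end

theorem turingReducibleIn_nestedCollision (O : Oracle) :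
    TuringReducibleIn 2 O (NestedCollision O) (Collision O) := by
  obtain ⟨p, hp⟩ := computes_reduction (O := O)
  refine ⟨reduction, p, fun S hS x => ?_⟩
  obtain ⟨-, t, ht, log, h1, h2⟩ := hp (S, x) hS x.length (by
    intro v hv
    simp only [List.mem_append, List.mem_cons, List.mem_replicate, List.not_mem_nil, or_false] at hv
    rcases hv with rfl | ⟨-, rfl⟩ <;> simp)
  rw [load_append_replicate] at h1
  refine ⟨t, log, _, h1, ht, ?_, h2⟩
  dsimp only
  split_ifs with hv
  · obtain ⟨F, G, hx, hFG⟩ := violations_eq_zero.1 hv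
    simp only [load, reduceRegs, List.getD_cons_zero]
    rw [codeH_eq hx, codeF_eq hx]
    dsimp only at hx ⊢
    obtain ⟨y₁, y₂, hy, hy₁, hy₂, hne, he⟩ : ∃ y₁ y₂, S F.code = y₁ ++ y₂ ∧ IsCollision O F y₁ y₂ := by
      rcases hS F.code with ⟨C, hC, -, h⟩ | ⟨h, -⟩
      · obtain rfl := Circuit.code_injective hC
        exact h
      · exact absurd ⟨F, rfl, hFG.1⟩ h
    set H := G.restrict F.inputs (S F.code) with hH
    obtain ⟨u, v, huv, hu, hv, hne', he'⟩ : ∃ u v, S H.code = u ++ v ∧ IsCollision O H u v := by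
      rcases hS H.code with ⟨C, hC, -, h⟩ | ⟨h, -⟩
      · obtain rfl := Circuit.code_injective hC
        exact h
      -- The second query is an instance of `Collision`: it has the `n` inputs of `F`, and as many
      -- outputs as `G` and hence as `F`.
      · refine absurd ⟨H, rfl, ?_⟩ h
        simp only [hH, Circuit.IsCollisionInstance, Circuit.restrict, List.length_map, hFG.2.2]
        exact hFG.1
    have hn : H.inputs = F.inputs := rfl
    rw [hn] at hu hv
    rw [hH, Circuit.eval_restrict O G hu, Circuit.eval_restrict O G hv, hy] at he'
    -- The second circuit evaluates `G` at the complements, so the complements of its collision are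
    -- the inner collision.
    refine Or.inl ⟨F, G, hx, hFG, y₁, y₂, u.map (! ·), v.map (! ·), ?_,
      ⟨hy₁, hy₂, by simpa using hu, by simpa using hv⟩, ⟨hne, he⟩, fun h => hne' ?_, he'⟩
    · rw [huv, hy]
      simp
    · exact List.map_injective_iff.2 Bool.not_injective h
  · exact Or.inr ⟨fun h => hv (violations_eq_zero.2 h), rfl⟩

theorem TuringReducibleIn.turingReducible {k : ℕ} {O : Oracle} {A B : SearchProblem}
    (h : TuringReducibleIn k O A B) : TuringReducible O A B := by
  obtain ⟨P, p, h⟩ := h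
  refine ⟨P, p, fun S hS x => ?_⟩
  obtain ⟨t, log, σ, h1, h2, h3, -⟩ := h S hS x
  exact ⟨t, log, σ, h1, h2, h3⟩

end PWPPTuring

theorem mainTheorem2 :
    -- relative to every oracle, `NestedCollision` is a total search problem that is solvable in
    -- polynomial time with two adaptive calls to a solver of `Collision`
    (∀ O : PWPPTuring.Oracle,
      PWPPTuring.TFNP O (PWPPTuring.NestedCollision O) ∧
      PWPPTuring.TuringReducibleIn 2 O (PWPPTuring.NestedCollision O) (PWPPTuring.Collision O)) ∧
    -- relative to a random oracle, it is not reducible to `Collision` non-adaptively, and `PWPP`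
    -- is not closed under adaptive Turing reductions
    (∀ᵐ O ∂PWPPTuring.randomOracle,
      ¬ PWPPTuring.NonAdaptiveReducible O
          (PWPPTuring.NestedCollision O) (PWPPTuring.Collision O) ∧
      PWPPTuring.NestedCollision O ∉ PWPPTuring.PWPP O ∧
      ¬ PWPPTuring.ClosedUnderTuring O (PWPPTuring.PWPP O)) ∧
    -- on random instances, every black-box non-adaptive reduction with polynomially many queries
    -- has negligible success probability
    (∀ (q : Polynomial ℕ) (T : ℕ → PWPPTuring.BlackBoxReduction),
      (∀ n, (T n).Bounded (q.eval n)) →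
        PWPPTuring.Negligible fun n => PWPPTuring.randomOracle ((T n).Success n)) := by
  refine ⟨fun O => ?_, ?_, fun q T hT => PWPPTuring.negligible_success q T hT⟩
  · exact ⟨PWPPTuring.tfnp_nestedCollision O, PWPPTuring.turingReducibleIn_nestedCollision O⟩
  · filter_upwards [PWPPTuring.ae_not_nonAdaptiveReducible,
      PWPPTuring.ae_not_manyOneReducible] with O h1 h2
    refine ⟨h1, fun h => h2 h.2, fun h => ?_⟩
    -- Closure, applied to `Collision` as a member of its own class, would make `NestedCollision`
    -- many-one reducible to it.
    exact h2 (h _ _ (PWPPTuring.tfnp_nestedCollision O) ⟨PWPPTuring.tfnp_collision O,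
      PWPPTuring.manyOneReducible_refl O _⟩
      (PWPPTuring.turingReducibleIn_nestedCollision O).turingReducible).2
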